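/- Let $N \ge 1$, let $\Omega \subset \mathbb{R}^N$ be open and bounded with smooth boundary $\partial\Omega$ and exterior unit normal $\nu$, and let $T>0$. Let $f \in C^2([0,T]\times\overline\Omega\times\mathbb{R};\mathbb{R}^N)$, $F \in C^2([0,T]\times\overline\Omega\times\mathbb{R};\mathbb{R})$, $u_o \in L^\infty(\Omega;\mathbb{R})$ and $u_b \in L^\infty([0,T]\times\partial\Omega;\mathbb{R})$. Consider the initial-boundary value problem $$\partial_t u + \nabla\cdot f(t,x,u) = F(t,x,u) \text{ in } \Omega,\qquad u(0,\cdot)=u_o,\qquad u=u_b \text{ on } \partial\Omega. \tag{1}$$ A pair $(H,Q)\in C^2(\mathbb{R}^2;\mathbb{R})\times C^2([0,T]\times\overline\Omega\times\mathbb{R}^2;\mathbb{R}^N)$ is a boundary entropy–entropy flux pair (with respect to $f$) if for all $t\in[0,T]$, $x\in\overline\Omega$ and $z,w\in\mathbb{R}$: $z\mapsto H(z,w)$ is convex; $\partial_z Q(t,x,z,w)=\partial_z H(z,w)\,\partial_z f(t,x,z)$; and $H(w,w)=0$, $Q(t,x,w,w)=0$, $\partial_1 H(w,w)=0$. A regular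 entropy solution (RE-solution) to (1) on $[0,T]$ is a map $u\in L^\infty([0,T]\times\Omega;\mathbb{R})$ such that for every boundary entropy–entropy flux pair $(H,Q)$, every $k\in\mathbb{R}$ and every $\phi\in C^1_c(]-\infty,T[\times\mathbb{R}^N;[0,\infty[)$ $$\begin{aligned} &\int_0^T\!\!\int_\Omega \big[H(u,k)\,\partial_t\phi + Q(t,x,u,k)\cdot\nabla\phi\big]\,dx\,dt +\int_0^T\!\!\int_\Omega \partial_1 H(u,k)\,\big[F(t,x,u)-\operatorname{div} f(t,x,u)\big]\,\phi\,dx\,dt\\ &+\int_0^T\!\!\int_\Omega \operatorname{div} Q(t,x,u,k)\,\phi\,dx\,dt +\int_\Omega H(u_o(x),k)\,\phi(0,x)\,dx +L\int_0^T\!\!\int_{\partial\Omega} H(u_b(t,\xi),k)\,\phi(t,\xi)\,d\xi\,dt\ \ge 0, \end{aligned}$$ where $u=u(t,x)$, $\operatorname{div}$ is the divergence with respect to the explicit variable $x$ only (the remaining arguments being frozen), $d\xi$ is the surface measure on $\partial\Omega$, and $L=\sup\{|\partial_z f(t,x,z)| : t\in[0,T],\ x\in\Omega,\ |z|\le \|u\|_{L^\infty([0,T]\times\Omega)}\}$.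 **Lemma.** Let $u$ be an RE-solution to (1) on $[0,T]$. Then for every boundary entropy–entropy flux pair $(H,Q)$ and every $\beta\in L^1(]0,T[\times\partial\Omega;[0,\infty[)$, the function $(t,\xi)\mapsto Q\big(t,\xi,u(t,\xi-\rho\,\nu(\xi)),u_b(t,\xi)\big)\cdot\nu(\xi)\,\beta(t,\xi)$ is integrable on $]0,T[\times\partial\Omega$ for almost every sufficiently small $\rho>0$, and the essential limit $$\operatorname*{ess\,lim}_{\rho\to0^+}\int_0^T\!\!\int_{\partial\Omega} Q\big(t,\xi,u(t,\xi-\rho\,\nu(\xi)),u_b(t,\xi)\big)\cdot\nu(\xi)\,\beta(t,\xi)\,d\xi\,dt$$ exists, is finite, and is $\ge 0$. Here $\operatorname{ess\,lim}_{\rho\to0^+} g(\rho)=l$ means that $g(\rho)\to l$ as $\rho\to 0^+$ outside some Lebesgue null set of $\rho$. -/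

import Mathlib

open MeasureTheory Set Filter Topology
open scoped ContDiff

noncomputable section

namespace BalanceLaw

/-- The Euclidean space `ℝ^N`. -/
abbrev Vec (N : ℕ) : Type := EuclideanSpace ℝ (Fin N)

variable {N : ℕ}

/-- `ψ` is smooth, has nonzero gradient at `ξ`, and near `ξ` the set `Ω` is `{ψ < 0}`. -/
def IsLocalDefiningFunction (Ω : Set (Vec N)) (ξ : Vec N) (ψ : Vec N → ℝ) : Prop :=
  ContDiff ℝ ∞ ψ ∧ gradient ψ ξ ≠ 0 ∧ ∀ᶠ x in 𝓝 ξ, (x ∈ Ω ↔ ψ x < 0)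

/-- The boundary of `Ω` is a smooth hypersurface with `Ω` locally on one side of it. -/
def HasSmoothBoundary (Ω : Set (Vec N)) : Prop :=
  ∀ ξ ∈ frontier Ω, ∃ ψ : Vec N → ℝ, IsLocalDefiningFunction Ω ξ ψ

open Classical in
/-- The exterior unit normal `ν(ξ) = ∇ψ(ξ) / |∇ψ(ξ)|` at a boundary point `ξ`, where `ψ` is any
local defining function at `ξ` (the value does not depend on which one). -/
def exteriorNormal (Ω : Set (Vec N)) (ξ : Vec N) : Vec N :=
  if h : ∃ ψ : Vec N → ℝ, IsLocalDefiningFunction Ω ξ ψ then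
    ‖gradient h.choose ξ‖⁻¹ • gradient h.choose ξ
  else 0

/-- The surface measure `dξ` of `∂Ω`: the `(N-1)`-dimensional Hausdorff measure, normalised to be
Lebesgue measure on hyperplanes, restricted to the boundary. -/
def surfaceMeasure (Ω : Set (Vec N)) : Measure (Vec N) :=
  (Measure.euclideanHausdorffMeasure (N - 1)).restrict (frontier Ω)

/-- Lebesgue measure `dx dt` on `]0,T[ × Ω`. -/
def interiorMeasure (T : ℝ) (Ω : Set (Vec N)) : Measure (ℝ × Vec N) :=
  ((volume : Measure ℝ).restrict (Ioo 0 T)).prod ((volume : Measure (Vec N)).restrict Ω)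

/-- The measure `dξ dt` on `]0,T[ × ∂Ω`. -/
def lateralMeasure (T : ℝ) (Ω : Set (Vec N)) : Measure (ℝ × Vec N) :=
  ((volume : Measure ℝ).restrict (Ioo 0 T)).prod (surfaceMeasure Ω)

/-- The divergence `∑ᵢ ∂gᵢ/∂xᵢ` of a vector field. -/
def divergence (g : Vec N → Vec N) (x : Vec N) : ℝ :=
  ∑ i : Fin N, fderiv ℝ g x (EuclideanSpace.single i 1) i

/-- `f ∈ C²([0,T] × closure Ω × ℝ; V)`; the values of `f` elsewhere play no role. -/
def IsC2 {V : Type*} [NormedAddCommGroup V] [NormedSpace ℝ V] (T : ℝ) (Ω : Set (Vec N))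
    (f : ℝ → Vec N → ℝ → V) : Prop :=
  ContDiffOn ℝ 2 (fun p : ℝ × Vec N × ℝ => f p.1 p.2.1 p.2.2)
    (Icc 0 T ×ˢ closure Ω ×ˢ (univ : Set ℝ))

/-- Boundary entropy--entropy flux pairs `(H, Q)` with respect to the flux `f`. -/
structure IsBoundaryEntropyPair (T : ℝ) (Ω : Set (Vec N)) (f : ℝ → Vec N → ℝ → Vec N)
    (H : ℝ → ℝ → ℝ) (Q : ℝ → Vec N → ℝ → ℝ → Vec N) : Prop where
  contDiff_H : ContDiff ℝ 2 (fun p : ℝ × ℝ => H p.1 p.2)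
  contDiffOn_Q : ContDiffOn ℝ 2
    (fun p : ℝ × Vec N × ℝ × ℝ => Q p.1 p.2.1 p.2.2.1 p.2.2.2)
    (Icc 0 T ×ˢ closure Ω ×ˢ (univ : Set (ℝ × ℝ)))
  convex : ∀ w : ℝ, ConvexOn ℝ univ (fun z => H z w)
  flux : ∀ t ∈ Icc 0 T, ∀ x ∈ closure Ω, ∀ z w : ℝ,
    deriv (fun s => Q t x s w) z = deriv (fun s => H s w) z • deriv (fun s => f t x s) z
  H_diag : ∀ w : ℝ, H w w = 0
  Q_diag : ∀ t ∈ Icc 0 T, ∀ x ∈ closure Ω, ∀ w : ℝ, Q t x w w = 0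
  deriv_H_diag : ∀ w : ℝ, deriv (fun s => H s w) w = 0

/-- Test functions `φ ∈ C¹_c(]-∞,T[ × ℝ^N; [0,∞[)`, extended by zero to `ℝ × ℝ^N`. -/
structure IsTestFunction (T : ℝ) (φ : ℝ × Vec N → ℝ) : Prop where
  contDiff : ContDiff ℝ 1 φ
  hasCompactSupport : HasCompactSupport φ
  tsupport_subset : tsupport φ ⊆ Iio T ×ˢ univ
  nonneg : ∀ p, 0 ≤ φ p

/-- `‖u‖` in `L^∞([0,T] × Ω)`. -/
def supNorm (T : ℝ) (Ω : Set (Vec N)) (u : ℝ → Vec N → ℝ) : ℝ :=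
  (eLpNorm (fun p : ℝ × Vec N => u p.1 p.2) ⊤ (interiorMeasure T Ω)).toReal

/-- The sup norm of the continuous function `∂ᵤf` over `[0,T] × Ω × [-U,U]`. -/
def fluxLipschitzConst (T : ℝ) (Ω : Set (Vec N)) (f : ℝ → Vec N → ℝ → Vec N) (U : ℝ) : ℝ :=
  sSup ((fun p : ℝ × Vec N × ℝ => ‖deriv (fun s => f p.1 p.2.1 s) p.2.2‖) ''
    (Icc 0 T ×ˢ Ω ×ˢ Icc (-U) U))

/-- `u` is a regular entropy solution (RE-solution) on `[0,T]` of
`∂ₜu + ∇·f(t,x,u) = F(t,x,u)` in `Ω`, with initial datum `u₀` and boundary datum `u_b`. -/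
structure IsRESolution (T : ℝ) (Ω : Set (Vec N)) (f : ℝ → Vec N → ℝ → Vec N)
    (F : ℝ → Vec N → ℝ → ℝ) (u₀ : Vec N → ℝ) (u_b : ℝ → Vec N → ℝ)
    (u : ℝ → Vec N → ℝ) : Prop where
  memLp : MemLp (fun p : ℝ × Vec N => u p.1 p.2) ⊤ (interiorMeasure T Ω)
  entropy_ineq : ∀ (H : ℝ → ℝ → ℝ) (Q : ℝ → Vec N → ℝ → ℝ → Vec N),
    IsBoundaryEntropyPair T Ω f H Q → ∀ (k : ℝ) (φ : ℝ × Vec N → ℝ), IsTestFunction T φ →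
    0 ≤ (∫ p, (H (u p.1 p.2) k * deriv (fun t => φ (t, p.2)) p.1
            + inner ℝ (Q p.1 p.2 (u p.1 p.2) k) (gradient (fun x => φ (p.1, x)) p.2))
          ∂(interiorMeasure T Ω))
      + (∫ p, deriv (fun z => H z k) (u p.1 p.2)
            * (F p.1 p.2 (u p.1 p.2) - divergence (fun x => f p.1 x (u p.1 p.2)) p.2) * φ p
          ∂(interiorMeasure T Ω))
      + (∫ p, divergence (fun x => Q p.1 x (u p.1 p.2) k) p.2 * φ p
          ∂(interiorMeasure T Ω))
      + (∫ x in Ω, H (u₀ x) k * φ (0, x))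
      + fluxLipschitzConst T Ω f (supNorm T Ω u)
          * ∫ p, H (u_b p.1 p.2) k * φ p ∂(lateralMeasure T Ω)

/-- `ess lim_{ρ → 0+} g(ρ) = l`: the limit along `ρ > 0` outside some Lebesgue null set. -/
def HasEssLimZero (g : ℝ → ℝ) (l : ℝ) : Prop :=
  ∃ Z : Set ℝ, volume Z = 0 ∧ Tendsto g (𝓝[Ioi 0 \ Z] 0) (𝓝 l)

/-- `Q(t, ξ, u(t, ξ - ρ ν(ξ)), u_b(t, ξ)) · ν(ξ) β(t, ξ)` at `p = (t, ξ)`. -/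
def boundaryIntegrand (Ω : Set (Vec N)) (Q : ℝ → Vec N → ℝ → ℝ → Vec N)
    (u u_b β : ℝ → Vec N → ℝ) (ρ : ℝ) (p : ℝ × Vec N) : ℝ :=
  inner ℝ (Q p.1 p.2 (u p.1 (p.2 - ρ • exteriorNormal Ω p.2)) (u_b p.1 p.2))
    (exteriorNormal Ω p.2) * β p.1 p.2

end BalanceLaw

end

/-!
The idea is that an entropy inequality tested near the boundary controls the normal flux through the
surfaces parallel to `∂Ω`.

Near a boundary point use normal coordinates `x = E(y, s) = γ(y) - s ν(γ(y))`
(`exists_normalChart`). Testing the entropy inequality for a constant state `k` with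
`β(t, y) θ(s)` turns it into an inequality in the single variable `s`:
`0 ≤ ∫ θ' G + ∫ θ R + θ(0) B` for all nonnegative `θ ∈ C¹_c(-r, r)`, where `G(s)` is the flux of
`Q(·, u, k)` through the surface at distance `s` weighted by `β`, the function `R` is bounded, and
`B` is the boundary term `L ∫ H(u_b, k) β`. Choosing `θ` close to a trapezoid shows that `-G(s)`,
the flux in the outward direction, is nondecreasing in `s` up to a multiple of `s`, and that
`B - G(s)` is bounded below by a multiple of `-s`; hence `B - G` has a nonnegative essential limit
(`essLimNonneg_of_weak_ineq`, `NormalChart.essLimNonneg_flux`).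

The property of having a nonnegative essential limit at `0+`, `EssLimNonneg`, is closed under sums,
nonnegative multiples and approximation uniform in `s`. This allows one to pass from smooth `β` to
integrable `β`, to replace the flux at distance `s` by the normal component on the boundary (only
the argument `u` still depends on `s`), and, approximating by simple functions, to replace the
constant `k` by the boundary datum `u_b` (`essLimNonneg_integral_boundary_state`). Once `k = u_b`,
the boundary term disappears because `H(w, w) = 0`, and what remains is the assertion on one chart
(`NormalChart.essLimNonneg_patch`). Finitely many charts cover `∂Ω`, and a measurable partition of
unity gives the global statement (`boundary_trace`).

Essential limits are limits along the filter `essZero = 𝓝[>] 0 ⊓ ae volume`. The solution and the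
boundary datum are replaced by measurable versions that are bounded everywhere; for the solution
this is harmless for almost every `s` only, by Fubini's theorem (`NormalChart.ae_ae_patch_eq`).
-/

namespace BalanceLaw

/-! ### Essential limits at `0+` -/

/-- The filter of essential limits `ρ → 0+`: a set belongs to it when it contains almost every
sufficiently small `ρ > 0`. -/
noncomputable def essZero : Filter ℝ := 𝓝[>] 0 ⊓ ae volume

/-- The essential limit of `g` at `0+` exists, is finite, and is nonnegative. -/
def EssLimNonneg (g : ℝ → ℝ) : Prop := ∃ l : ℝ, 0 ≤ l ∧ Tendsto g essZero (𝓝 l)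

theorem eventually_essZero_iff {p : ℝ → Prop} :
    (∀ᶠ s in essZero, p s) ↔ ∃ r > 0, ∀ᵐ s : ℝ, s ∈ Ioo 0 r → p s := by
  rw [essZero, Filter.eventually_inf]
  constructor
  · rintro ⟨A, hA, B, hB, h⟩
    obtain ⟨r, hr, hA⟩ := mem_nhdsGT_iff_exists_Ioo_subset.1 hA
    exact ⟨r, hr, by filter_upwards [hB] with s hs hs' using h s ⟨hA hs', hs⟩⟩
  · rintro ⟨r, hr, h⟩
    exact ⟨Ioo 0 r, Ioo_mem_nhdsGT hr, _, h, fun s hs => hs.2 hs.1⟩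

theorem eventually_essZero_of_ae {r : ℝ} (hr : 0 < r) {p : ℝ → Prop}
    (h : ∀ᵐ s ∂(volume.restrict (Ioo 0 r)), p s) : ∀ᶠ s in essZero, p s :=
  eventually_essZero_iff.2 ⟨r, hr, (ae_restrict_iff' measurableSet_Ioo).1 h⟩

theorem eventually_essZero_of_forall {r : ℝ} (hr : 0 < r) {p : ℝ → Prop}
    (h : ∀ s ∈ Ioo 0 r, p s) : ∀ᶠ s in essZero, p s :=
  eventually_essZero_iff.2 ⟨r, hr, Eventually.of_forall h⟩

instance : essZero.NeBot := by
  refine ⟨fun h => ?_⟩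
  have h0 : ∀ᶠ s in essZero, False := by rw [h]; trivial
  obtain ⟨r, hr, h1⟩ := eventually_essZero_iff.1 h0
  have : volume (Ioo 0 r) = 0 := measure_mono_null (fun s hs => by simpa using hs) h1
  simp [hr.not_ge] at this

theorem hasEssLimZero_of_tendsto {g : ℝ → ℝ} {l : ℝ} (h : Tendsto g essZero (𝓝 l)) :
    HasEssLimZero g l := by
  have key : ∀ n : ℕ, ∃ r > 0, ∀ᵐ s : ℝ, s ∈ Ioo 0 r → dist (g s) l < 1 / (n + 1 : ℝ) :=
    fun n => eventually_essZero_iff.1 (Metric.tendsto_nhds.1 h _ Nat.one_div_pos_of_nat)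
  choose r hr hg using key
  refine ⟨{s | ¬ ∀ n, s ∈ Ioo 0 (r n) → dist (g s) l < 1 / (n + 1 : ℝ)}, ae_all_iff.2 hg, ?_⟩
  refine Metric.tendsto_nhds.2 fun ε hε => ?_
  obtain ⟨n, hn⟩ := exists_nat_one_div_lt hε
  filter_upwards [self_mem_nhdsWithin,
    mem_nhdsWithin_of_mem_nhds (Iio_mem_nhds (hr n))] with s hs hs'
  have h2 := hs.2
  simp only [mem_ofPred_eq, not_not] at h2
  exact (h2 n ⟨hs.1, hs'⟩).trans hn

theorem EssLimNonneg.congr {g g' : ℝ → ℝ} (h : EssLimNonneg g)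
    (hg : ∀ᶠ s in essZero, g s = g' s) : EssLimNonneg g' := by
  obtain ⟨l, hl, h⟩ := h
  exact ⟨l, hl, h.congr' hg⟩

theorem EssLimNonneg.add {g g' : ℝ → ℝ} (h : EssLimNonneg g) (h' : EssLimNonneg g') :
    EssLimNonneg (fun s => g s + g' s) := by
  obtain ⟨l, hl, h⟩ := h
  obtain ⟨l', hl', h'⟩ := h'
  exact ⟨l + l', add_nonneg hl hl', h.add h'⟩

theorem EssLimNonneg.const_mul {g : ℝ → ℝ} (h : EssLimNonneg g) {c : ℝ} (hc : 0 ≤ c) :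
    EssLimNonneg (fun s => c * g s) := by
  obtain ⟨l, hl, h⟩ := h
  exact ⟨c * l, mul_nonneg hc hl, h.const_mul c⟩

theorem EssLimNonneg.zero : EssLimNonneg (fun _ => 0) := ⟨0, le_rfl, tendsto_const_nhds⟩

theorem EssLimNonneg.sum {ι : Type*} (I : Finset ι) {g : ι → ℝ → ℝ}
    (h : ∀ i ∈ I, EssLimNonneg (g i)) : EssLimNonneg (fun s => ∑ i ∈ I, g i s) := by
  classical
  induction I using Finset.induction_on with
  | empty => simpa using EssLimNonneg.zero
  | insert i I hi ih =>
    simp only [Finset.sum_insert hi]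
    exact (h i (Finset.mem_insert_self _ _)).add
      (ih fun j hj => h j (Finset.mem_insert_of_mem hj))

/-- Having a nonnegative essential limit is stable under uniform approximation. -/
theorem EssLimNonneg.of_approx {g : ℝ → ℝ}
    (h : ∀ ε > 0, ∃ g', EssLimNonneg g' ∧ ∀ᶠ s in essZero, |g s - g' s| ≤ ε) :
    EssLimNonneg g := by
  have hcauchy : Cauchy (map g essZero) := by
    refine Metric.cauchy_iff.2 ⟨inferInstance, fun ε hε => ?_⟩
    obtain ⟨g', ⟨l', -, hg'⟩, hgg⟩ := h (ε / 4) (by positivity)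
    refine ⟨Metric.ball l' (ε / 2), ?_, fun x hx y hy => ?_⟩
    · rw [Filter.mem_map]
      filter_upwards [hgg, Metric.tendsto_nhds.1 hg' (ε / 4) (by positivity)] with s h1 h2
      rw [mem_preimage, Metric.mem_ball]
      rw [← Real.dist_eq] at h1
      linarith [dist_triangle (g s) (g' s) l']
    · rw [Metric.mem_ball] at hx hy
      linarith [dist_triangle_right x y l']
  obtain ⟨l, hl⟩ := CompleteSpace.complete hcauchy
  refine ⟨l, le_of_forall_pos_le_add fun ε hε => ?_, hl⟩
  obtain ⟨g', ⟨l', hl', hg'⟩, hgg⟩ := h ε hε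
  have hl : Tendsto g essZero (𝓝 l) := hl
  have h3 : l' ≤ l + ε :=
    le_of_tendsto_of_tendsto hg' (hl.add_const ε) (by
      filter_upwards [hgg] with s hs
      linarith [(abs_le.1 hs).1])
  linarith

/-- A function that is nonnegative and nondecreasing up to Lipschitz corrections, off a null set,
has a nonnegative essential limit at `0+`. -/
theorem EssLimNonneg.of_almost_monotone {g : ℝ → ℝ} {r M : ℝ} (hr : 0 < r) {S : Set ℝ}
    (hS : ∀ᵐ s : ℝ, s ∈ S)
    (hmono : ∀ s₁ ∈ S, ∀ s₂ ∈ S, 0 < s₁ → s₁ < s₂ → s₂ < r → g s₁ ≤ g s₂ + M * (s₂ - s₁))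
    (hnonneg : ∀ s ∈ S, 0 < s → s < r → 0 ≤ g s + M * s) : EssLimNonneg g := by
  set V : Set ℝ := (fun s => g s + M * s) '' (S ∩ Ioo 0 r) with hV
  have hbdd : BddBelow V := ⟨0, by rintro _ ⟨s, hs, rfl⟩; exact hnonneg s hs.1 hs.2.1 hs.2.2⟩
  have hne : V.Nonempty := by
    have : ∃ᶠ s in essZero, s ∈ S ∩ Ioo 0 r := by
      refine Eventually.frequently ?_
      exact eventually_essZero_iff.2 ⟨r, hr, by filter_upwards [hS] with s h1 h2 using ⟨h1, h2⟩⟩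
    obtain ⟨s, hs⟩ := this.exists
    exact ⟨_, s, hs, rfl⟩
  have hlim : Tendsto (fun s => g s + M * s) essZero (𝓝 (sInf V)) := by
    refine Metric.tendsto_nhds.2 fun ε hε => ?_
    obtain ⟨_, ⟨s₀, hs₀, rfl⟩, hlt⟩ := exists_lt_of_csInf_lt hne (lt_add_of_pos_right (sInf V) hε)
    refine eventually_essZero_iff.2 ⟨s₀, hs₀.2.1, ?_⟩
    filter_upwards [hS] with s hs hs'
    have h1 : sInf V ≤ g s + M * s := csInf_le hbdd ⟨s, ⟨hs, hs'.1, hs'.2.trans hs₀.2.2⟩, rfl⟩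
    have h2 := hmono s hs s₀ hs₀.1 hs'.1 hs'.2 hs₀.2.2
    rw [Real.dist_eq, abs_lt]
    simp only at hlt
    constructor <;> linarith [mul_sub M s₀ s]
  have hMs : Tendsto (fun s : ℝ => M * s) essZero (𝓝 0) := by
    have : Tendsto (fun s : ℝ => M * s) (𝓝 0) (𝓝 (M * 0)) := tendsto_id.const_mul M
    rw [mul_zero] at this
    exact this.mono_left (inf_le_left.trans nhdsWithin_le_nhds)
  refine ⟨sInf V, le_csInf hne ?_, ?_⟩
  · rintro _ ⟨s, hs, rfl⟩; exact hnonneg s hs.1 hs.2.1 hs.2.2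
  · simpa using hlim.sub hMs

/-! ### Differential inequalities in one variable -/

/-- The primitive of a mollifier is a smooth monotone step from `0` to `1`. -/
theorem exists_primitive_normed_bump (f : ContDiffBump (0 : ℝ)) :
    ∃ Φ : ℝ → ℝ, ContDiff ℝ 1 Φ ∧ (∀ x, deriv Φ x = f.normed volume x) ∧ Monotone Φ ∧
      (∀ x ≤ -f.rOut, Φ x = 0) ∧ ∀ x ≥ f.rOut, Φ x = 1 := by
  have hcont : Continuous (f.normed volume) := f.continuous_normed
  have hderiv : ∀ x, HasDerivAt (fun x => ∫ τ in (-f.rOut)..x, f.normed volume τ)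
      (f.normed volume x) x := fun x =>
    intervalIntegral.integral_hasDerivAt_right (hcont.intervalIntegrable _ _)
      (hcont.stronglyMeasurableAtFilter _ _) hcont.continuousAt
  have hd : deriv (fun x => ∫ τ in (-f.rOut)..x, f.normed volume τ) = f.normed volume :=
    funext fun x => (hderiv x).deriv
  refine ⟨fun x => ∫ τ in (-f.rOut)..x, f.normed volume τ, ?_, fun x => (hderiv x).deriv, ?_, ?_, ?_⟩
  · refine contDiff_one_iff_deriv.2 ⟨fun x => (hderiv x).differentiableAt, ?_⟩
    rw [hd]; exact hcont
  · exact monotone_of_deriv_nonneg (fun x => (hderiv x).differentiableAt)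
      fun x => by rw [hd]; exact f.nonneg_normed x
  · intro x hx
    refine intervalIntegral.integral_zero_ae (Eventually.of_forall fun t ht => ?_)
    rw [uIoc_of_ge hx] at ht
    have : t ∉ Function.support (f.normed volume) := by
      rw [f.support_normed_eq, Metric.mem_ball, Real.dist_eq, abs_lt]
      intro h
      linarith [h.1, ht.2]
    simpa using this
  · intro x hx
    have : Function.support (f.normed volume) ⊆ Ioc (-f.rOut) x := by
      rw [f.support_normed_eq, Real.ball_eq_Ioo]
      exact fun t ht => ⟨by simpa using ht.1, le_trans (by simpa using ht.2.le) hx⟩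
    change (∫ τ in (-f.rOut)..x, f.normed volume τ) = 1
    rw [intervalIntegral.integral_eq_integral_of_support_subset this]
    exact f.integral_normed

/-- If `-G' + R + B δ₀ ≥ 0` in the sense of distributions on `(-r, r)`, where `G` and `R` are
bounded functions living on `(0, r)`, then `G` has an essential limit at `0+`, at most `B`. -/
theorem essLimNonneg_of_weak_ineq {r M B : ℝ} (hr : 0 < r) (hM : 0 ≤ M) {G R : ℝ → ℝ}
    (hG : AEStronglyMeasurable G (volume.restrict (Ioo 0 r)))
    (hGM : ∀ᵐ s ∂(volume.restrict (Ioo 0 r)), |G s| ≤ M)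
    (hRM : ∀ᵐ s ∂(volume.restrict (Ioo 0 r)), |R s| ≤ M)
    (h : ∀ θ : ℝ → ℝ, ContDiff ℝ 1 θ → (∀ s, 0 ≤ θ s) → tsupport θ ⊆ Ioo (-r) r →
      0 ≤ (∫ s in Ioo 0 r, deriv θ s * G s) + (∫ s in Ioo 0 r, θ s * R s) + θ 0 * B) :
    EssLimNonneg (fun s => B - G s) := by
  set G' : ℝ → ℝ := (Ioo 0 r).indicator G with hG'
  have hGint : IntegrableOn G (Ioo 0 r) :=
    Integrable.of_bound hG M (by simpa using hGM)
  have hGint' : Integrable G' := (integrable_indicator_iff measurableSet_Ioo).2 hGint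
  let φ : ℕ → ContDiffBump (0 : ℝ) := fun n =>
    ⟨1 / (2 * (n + 1 : ℝ)), 1 / (n + 1 : ℝ), by positivity,
      one_div_lt_one_div_of_lt (by positivity) (by linarith [(Nat.cast_nonneg n : (0:ℝ) ≤ n)])⟩
  have hφ0 : Tendsto (fun n => (φ n).rOut) atTop (𝓝 0) := tendsto_one_div_add_atTop_nhds_zero_nat
  have hae := ContDiffBump.ae_convolution_tendsto_right_of_locallyIntegrable (φ := φ) (K := 2)
    hφ0 (Eventually.of_forall fun n => le_of_eq (by
      change 1 / (n + 1 : ℝ) = 2 * (1 / (2 * (n + 1 : ℝ)))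
      field_simp)) hGint'.locallyIntegrable
  set S := {x₀ : ℝ | Tendsto (fun n =>
    (MeasureTheory.convolution ((φ n).normed volume) G' (ContinuousLinearMap.lsmul ℝ ℝ) volume) x₀)
      atTop (𝓝 (G' x₀))} with hS
  have hconv : ∀ n x, (MeasureTheory.convolution ((φ n).normed volume) G'
      (ContinuousLinearMap.lsmul ℝ ℝ) volume) x
      = ∫ s in Ioo 0 r, (φ n).normed volume (s - x) * G s := by
    intro n x
    rw [convolution_eq_swap, ← integral_indicator measurableSet_Ioo]
    congr 1; ext s
    simp only [ContinuousLinearMap.lsmul_apply, smul_eq_mul, hG', indicator_apply]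
    rw [show s - x = - (x - s) by ring, (φ n).normed_neg]
    split_ifs <;> simp
  have key : ∀ s₁ ∈ S, ∀ s₂ ∈ S, -r < s₁ → s₁ ≠ 0 → s₁ < s₂ → 0 < s₂ → s₂ < r →
      0 ≤ G' s₁ - G' s₂ + M * (s₂ - s₁) + (if s₁ < 0 then B else 0) := by
    intro s₁ hs₁ s₂ hs₂ h1 h10 h12 h20 h2
    have hlim : Tendsto (fun n => (MeasureTheory.convolution ((φ n).normed volume) G'
        (ContinuousLinearMap.lsmul ℝ ℝ) volume) s₁ - (MeasureTheory.convolution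
        ((φ n).normed volume) G' (ContinuousLinearMap.lsmul ℝ ℝ) volume) s₂
        + M * (s₂ - s₁ + 2 * (φ n).rOut) + (if s₁ < 0 then B else 0)) atTop
        (𝓝 (G' s₁ - G' s₂ + M * (s₂ - s₁ + 2 * 0) + (if s₁ < 0 then B else 0))) :=
      ((hs₁.sub hs₂).add (((hφ0.const_mul 2).const_add _).const_mul M)).add_const _
    rw [mul_zero, add_zero] at hlim
    refine ge_of_tendsto hlim ?_
    have hsmall : ∀ᶠ n in atTop, (φ n).rOut < min (min (s₁ + r) (r - s₂)) (min |s₁| s₂) :=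
      hφ0.eventually (gt_mem_nhds (by
        simp only [lt_min_iff, abs_pos]
        exact ⟨⟨by linarith, by linarith⟩, h10, h20⟩))
    filter_upwards [hsmall] with n hn
    simp only [lt_min_iff] at hn
    obtain ⟨⟨hn1, hn2⟩, hn3, hn4⟩ := hn
    obtain ⟨Φ, hΦ, hΦd, hΦm, hΦ0, hΦ1⟩ := exists_primitive_normed_bump (φ n)
    have hpos := (φ n).rOut_pos
    set ε := (φ n).rOut with hε
    set θ : ℝ → ℝ := fun s => Φ (s - s₁) - Φ (s - s₂) with hθ
    have hΦle : ∀ x, Φ x ≤ 1 := fun x => by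
      rcases le_total x ε with hx | hx
      · exact (hΦm hx).trans (hΦ1 ε le_rfl).le
      · exact (hΦ1 x hx).le
    have hΦge : ∀ x, 0 ≤ Φ x := fun x => by
      rcases le_total x (-ε) with hx | hx
      · exact (hΦ0 x hx).ge
      · exact (hΦ0 (-ε) le_rfl).ge.trans (hΦm hx)
    have hθ0 : ∀ s, 0 ≤ θ s := fun s => sub_nonneg.2 (hΦm (by linarith))
    have hθ1 : ∀ s, θ s ≤ 1 := fun s => by linarith [hΦle (s - s₁), hΦge (s - s₂)]
    have hθsupp : Function.support θ ⊆ Icc (s₁ - ε) (s₂ + ε) := by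
      intro s hs
      by_contra hs'
      apply hs
      rw [mem_Icc, not_and_or, not_le, not_le] at hs'
      rcases hs' with hs' | hs'
      · simp only [hθ]; rw [hΦ0 _ (by linarith), hΦ0 _ (by linarith), sub_self]
      · simp only [hθ]; rw [hΦ1 _ (by linarith), hΦ1 _ (by linarith), sub_self]
    have hθts : tsupport θ ⊆ Icc (s₁ - ε) (s₂ + ε) := closure_minimal hθsupp isClosed_Icc
    have hθd : ∀ s, deriv θ s
        = (φ n).normed volume (s - s₁) - (φ n).normed volume (s - s₂) := by
      intro s
      have hd : Differentiable ℝ Φ := hΦ.differentiable (by simp)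
      have e1 : HasDerivAt (fun s => Φ (s - s₁)) ((φ n).normed volume (s - s₁)) s := by
        have := (hd (s - s₁)).hasDerivAt.comp_sub_const s s₁
        rwa [hΦd] at this
      have e2 : HasDerivAt (fun s => Φ (s - s₂)) ((φ n).normed volume (s - s₂)) s := by
        have := (hd (s - s₂)).hasDerivAt.comp_sub_const s s₂
        rwa [hΦd] at this
      exact (e1.sub e2).deriv
    have hineq := h θ ((hΦ.comp (contDiff_id.sub contDiff_const)).sub
      (hΦ.comp (contDiff_id.sub contDiff_const))) hθ0
      (hθts.trans fun s hs => ⟨by linarith [hs.1], by linarith [hs.2]⟩)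
    have hb : ∀ x, IntegrableOn (fun s => (φ n).normed volume (s - x) * G s) (Ioo 0 r) := by
      intro x
      refine hGint.bdd_mul (c := ((φ n).normed volume 0) + sSup (range ((φ n).normed volume))) ?_ ?_
      · exact ((φ n).continuous_normed.comp (continuous_id.sub continuous_const)).aestronglyMeasurable
      · refine Eventually.of_forall fun s => ?_
        have hbdd : BddAbove (range ((φ n).normed volume)) :=
          (φ n).continuous_normed.bddAbove_range_of_hasCompactSupport (φ n).hasCompactSupport_normed
        rw [Real.norm_of_nonneg ((φ n).nonneg_normed _)]
        linarith [le_csSup hbdd (mem_range_self (s - x)), (φ n).nonneg_normed (μ := volume) 0]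
    have e1 : (∫ s in Ioo 0 r, deriv θ s * G s)
        = (∫ s in Ioo 0 r, (φ n).normed volume (s - s₁) * G s)
          - ∫ s in Ioo 0 r, (φ n).normed volume (s - s₂) * G s := by
      rw [← integral_sub (hb s₁) (hb s₂)]
      congr 1; ext s; rw [hθd]; ring
    have e2 : (∫ s in Ioo 0 r, θ s * R s) ≤ M * (s₂ - s₁ + 2 * ε) := by
      have hle : ∀ᵐ s ∂(volume.restrict (Ioo 0 r)),
          θ s * R s ≤ (Icc (s₁ - ε) (s₂ + ε)).indicator (fun _ => M) s := by
        filter_upwards [hRM] with s hs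
        by_cases hs' : s ∈ Icc (s₁ - ε) (s₂ + ε)
        · rw [indicator_of_mem hs']
          calc θ s * R s ≤ θ s * M := mul_le_mul_of_nonneg_left ((le_abs_self _).trans hs) (hθ0 s)
            _ ≤ 1 * M := mul_le_mul_of_nonneg_right (hθ1 s) hM
            _ = M := one_mul M
        · rw [indicator_of_notMem hs', show θ s = 0 from by
            by_contra h0; exact hs' (hθsupp h0), zero_mul]
      have hind : Integrable ((Icc (s₁ - ε) (s₂ + ε)).indicator (fun _ => M)) (volume : Measure ℝ) :=
        (integrable_indicator_iff measurableSet_Icc).2 (integrableOn_const (by simp))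
      calc (∫ s in Ioo 0 r, θ s * R s)
          ≤ ∫ s in Ioo 0 r, (Icc (s₁ - ε) (s₂ + ε)).indicator (fun _ => M) s := by
            by_cases hi : IntegrableOn (fun s => θ s * R s) (Ioo 0 r)
            · exact integral_mono_ae hi hind.integrableOn hle
            · rw [integral_undef hi]
              exact integral_nonneg fun s => indicator_nonneg (fun _ _ => hM) s
        _ ≤ ∫ s, (Icc (s₁ - ε) (s₂ + ε)).indicator (fun _ => M) s :=
            setIntegral_le_integral hind
              (Eventually.of_forall fun s => indicator_nonneg (fun _ _ => hM) s)
        _ = M * (s₂ - s₁ + 2 * ε) := by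
            rw [integral_indicator measurableSet_Icc, setIntegral_const]
            simp only [measureReal_def, Real.volume_Icc, smul_eq_mul]
            rw [ENNReal.toReal_ofReal (by linarith)]
            ring
    have e3 : θ 0 * B = if s₁ < 0 then B else 0 := by
      split_ifs with hneg
      · rw [abs_of_neg hneg] at hn3
        simp only [hθ]; rw [hΦ1 _ (by linarith), hΦ0 _ (by linarith)]; ring
      · rw [abs_of_nonneg (not_lt.1 hneg)] at hn3
        simp only [hθ]; rw [hΦ0 _ (by linarith), hΦ0 _ (by linarith)]; ring
    rw [hconv, hconv]
    rw [e1, e3] at hineq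
    linarith
  have hSG : ∀ s, 0 < s → s < r → G' s = G s := fun s h0 h1 =>
    indicator_of_mem (show s ∈ Ioo 0 r from ⟨h0, h1⟩) _
  refine EssLimNonneg.of_almost_monotone (M := M) hr hae ?_ ?_
  · intro s₁ h1 s₂ h2 h0 h12 h2r
    have := key s₁ h1 s₂ h2 (by linarith) h0.ne' h12 (h0.trans h12) h2r
    rw [hSG _ h0 (h12.trans h2r), hSG _ (h0.trans h12) h2r, if_neg h0.not_gt] at this
    linarith
  · intro s hs h0 hsr
    -- Negative first step points `s₁ → 0-` give test functions equal to `1` at `0`.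
    refine le_of_forall_pos_le_add fun ε hε => ?_
    set δ := min r (ε / (M + 1)) with hδ
    have hδ0 : 0 < δ := lt_min hr (by positivity)
    have : ∃ s₁ ∈ S, s₁ ∈ Ioo (-δ) 0 := by
      by_contra hcon
      push Not at hcon
      have : volume (Ioo (-δ) 0) = 0 := measure_mono_null (fun x hx hxS => hcon x hxS hx) hae
      simp [hδ0.not_ge] at this
    obtain ⟨s₁, hs₁, hs₁'⟩ := this
    have h3 := key s₁ hs₁ s hs (by linarith [hs₁'.1, min_le_left r (ε / (M + 1))])
      hs₁'.2.ne (hs₁'.2.trans h0) h0 hsr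
    rw [if_pos hs₁'.2, hSG s h0 hsr, show G' s₁ = 0 from
      indicator_of_notMem (fun h' : s₁ ∈ Ioo 0 r => (hs₁'.2.trans h'.1).false) _] at h3
    have h4 : M * -s₁ ≤ ε := by
      have : -s₁ ≤ ε / (M + 1) := by linarith [hs₁'.1, min_le_right r (ε / (M + 1))]
      calc M * -s₁ ≤ M * (ε / (M + 1)) := mul_le_mul_of_nonneg_left this hM
        _ = ε * (M / (M + 1)) := by ring
        _ ≤ ε * 1 := mul_le_mul_of_nonneg_left
            ((div_le_one (by positivity)).2 (by linarith)) hε.le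
        _ = ε := mul_one ε
    linarith

/-! ### Density and approximation arguments -/

section Density

variable {X : Type*} [MeasurableSpace X] {lam : Measure X}

theorem integrable_mul_of_bounded {a β : X → ℝ} {M : ℝ} (ha : AEStronglyMeasurable a lam)
    (haM : ∀ᵐ x ∂lam, |a x| ≤ M) (hβ : Integrable β lam) : Integrable (fun x => a x * β x) lam :=
  hβ.bdd_mul ha haM

/-- For bounded coefficients `a s`, the weights `β` for which `∫ a s β` has a nonnegative essential
limit are closed in `L¹`. -/
theorem essLimNonneg_of_L1_approx {a : ℝ → X → ℝ} {M : ℝ}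
    (ha : ∀ᶠ s in essZero, AEStronglyMeasurable (a s) lam ∧ ∀ᵐ x ∂lam, |a s x| ≤ M)
    {β : X → ℝ} (hβ : Integrable β lam)
    (h : ∀ ε > 0, ∃ β', Integrable β' lam ∧
      EssLimNonneg (fun s => ∫ x, a s x * β' x ∂lam) ∧ ∫ x, |β x - β' x| ∂lam ≤ ε) :
    EssLimNonneg (fun s => ∫ x, a s x * β x ∂lam) := by
  refine EssLimNonneg.of_approx fun ε hε => ?_
  obtain ⟨β', hβ', hlim, hle⟩ := h (ε / (|M| + 1)) (by positivity)
  refine ⟨_, hlim, ?_⟩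
  filter_upwards [ha] with s hs
  rw [← integral_sub (integrable_mul_of_bounded hs.1 hs.2 hβ)
    (integrable_mul_of_bounded hs.1 hs.2 hβ')]
  calc |∫ x, (a s x * β x - a s x * β' x) ∂lam|
      ≤ ∫ x, |M| * |β x - β' x| ∂lam := by
        rw [← Real.norm_eq_abs]
        refine norm_integral_le_of_norm_le ((hβ.sub hβ').abs.const_mul _) ?_
        filter_upwards [hs.2] with x hx
        rw [← mul_sub, Real.norm_eq_abs, abs_mul]
        exact mul_le_mul_of_nonneg_right (hx.trans (le_abs_self M)) (abs_nonneg _)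
    _ = |M| * ∫ x, |β x - β' x| ∂lam := integral_const_mul _ _
    _ ≤ |M| * (ε / (|M| + 1)) := mul_le_mul_of_nonneg_left hle (abs_nonneg _)
    _ = ε * (|M| / (|M| + 1)) := by ring
    _ ≤ ε * 1 := mul_le_mul_of_nonneg_left
        ((div_le_one (by positivity)).2 (by linarith)) hε.le
    _ = ε := mul_one ε

/-- Indicators of measurable sets are `L¹`-limits of nonnegative `C¹` functions with compact
support in an open set of full measure. -/
theorem exists_contDiff_integral_indicator_sub_le {X : Type*} [NormedAddCommGroup X]
    [NormedSpace ℝ X] [FiniteDimensional ℝ X] [MeasurableSpace X] [BorelSpace X] {lam : Measure X}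
    [IsFiniteMeasure lam] {O : Set X} (hO : IsOpen O) (hlam : ∀ᵐ x ∂lam, x ∈ O) {A : Set X}
    (hA : MeasurableSet A) {ε : ℝ} (hε : 0 < ε) :
    ∃ g : X → ℝ, ContDiff ℝ 1 g ∧ HasCompactSupport g ∧ tsupport g ⊆ O ∧ (∀ x, 0 ≤ g x) ∧
      ∫ x, |A.indicator 1 x - g x| ∂lam ≤ ε := by
  have : ProperSpace X := FiniteDimensional.proper_real X
  have hε2 : ENNReal.ofReal (ε / 2) ≠ 0 := by simpa using half_pos hε
  obtain ⟨K, hKA, hK, hKlt⟩ := (hA.inter hO.measurableSet).exists_isCompact_sdiff_lt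
    (measure_ne_top lam _) hε2
  obtain ⟨V, hKV, hV, hVlt⟩ := hK.exists_isOpen_lt_add (μ := lam) hε2
  obtain ⟨L, hL, hKL, hLV⟩ := exists_compact_between hK (hV.inter hO)
    (subset_inter hKV (hKA.trans inter_subset_right))
  obtain ⟨f, hf0, hf1, hf⟩ := exists_contMDiffMap_zero_one_of_isClosed (n := 1)
    (modelWithCornersSelf ℝ X) isOpen_interior.isClosed_compl hK.isClosed
    (disjoint_compl_left_iff_subset.2 hKL)
  have hsupp : Function.support f ⊆ L := fun x hx => by
    by_contra hxL
    exact hx (hf0 (fun h => hxL (interior_subset h)))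
  have hts : tsupport f ⊆ L := closure_minimal hsupp hL.isClosed
  have hVK : lam (V \ K) ≤ ENNReal.ofReal (ε / 2) := by
    rw [measure_sdiff hKV hK.nullMeasurableSet (measure_ne_top _ _)]
    exact tsub_le_iff_left.2 hVlt.le
  refine ⟨f, f.contMDiff.contDiff, hL.of_isClosed_subset (isClosed_tsupport _) hts,
    hts.trans (hLV.trans inter_subset_right), fun x => (hf x).1, ?_⟩
  have hAK := (hA.inter hO.measurableSet).diff hK.measurableSet
  have hVKm := hV.measurableSet.diff hK.measurableSet
  calc ∫ x, |A.indicator 1 x - f x| ∂lam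
      ≤ ∫ x, (((A ∩ O) \ K).indicator 1 x + (V \ K).indicator 1 x : ℝ) ∂lam := by
        refine integral_mono_of_nonneg (Eventually.of_forall fun x => abs_nonneg _)
          (((integrable_const (1 : ℝ)).indicator hAK).add
            ((integrable_const (1 : ℝ)).indicator hVKm)) ?_
        filter_upwards [hlam] with x hx
        have h1 := hf x
        by_cases hxK : x ∈ K
        · have : f x = 1 := hf1 hxK
          simp [this, (hKA hxK).1, hxK]
        · by_cases hxV : x ∈ V
          · by_cases hxA : x ∈ A <;> simp [hxA, hxV, hx, hxK, abs_le] <;>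
              constructor <;> linarith [h1.1, h1.2]
          · have : f x = 0 := by
              by_contra h0
              exact hxV (hLV (hsupp h0)).1
            by_cases hxA : x ∈ A <;> simp [hxA, hxV, hx, hxK, this]
    _ = lam.real ((A ∩ O) \ K) + lam.real (V \ K) := by
        rw [← integral_indicator_one hAK, ← integral_indicator_one hVKm]
        exact integral_add ((integrable_const (1 : ℝ)).indicator hAK)
            ((integrable_const (1 : ℝ)).indicator hVKm)
    _ ≤ ε / 2 + ε / 2 := add_le_add
        (ENNReal.toReal_le_of_le_ofReal (by positivity) hKlt.le)
        (ENNReal.toReal_le_of_le_ofReal (by positivity) hVK)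
    _ = ε := add_halves ε

/-- It suffices to test a nonnegative essential limit against nonnegative `C¹` weights. -/
theorem essLimNonneg_integral_of_test {X : Type*} [NormedAddCommGroup X]
    [NormedSpace ℝ X] [FiniteDimensional ℝ X] [MeasurableSpace X] [BorelSpace X] {lam : Measure X}
    [IsFiniteMeasure lam] {O : Set X} (hO : IsOpen O) (hlam : ∀ᵐ x ∂lam, x ∈ O)
    {a : ℝ → X → ℝ} {M : ℝ}
    (ha : ∀ᶠ s in essZero, AEStronglyMeasurable (a s) lam ∧ ∀ᵐ x ∂lam, |a s x| ≤ M)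
    (h : ∀ β : X → ℝ, ContDiff ℝ 1 β → HasCompactSupport β → tsupport β ⊆ O → (∀ x, 0 ≤ β x) →
      EssLimNonneg (fun s => ∫ x, a s x * β x ∂lam))
    {β : X → ℝ} (hβ : Integrable β lam) (hβ0 : ∀ᵐ x ∂lam, 0 ≤ β x) :
    EssLimNonneg (fun s => ∫ x, a s x * β x ∂lam) := by
  have hind : ∀ A : Set X, MeasurableSet A →
      EssLimNonneg (fun s => ∫ x, a s x * A.indicator 1 x ∂lam) := by
    intro A hA
    refine essLimNonneg_of_L1_approx ha ((integrable_const (1 : ℝ)).indicator hA) fun ε hε => ?_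
    obtain ⟨g, hg, hgc, hgO, hg0, hgε⟩ := exists_contDiff_integral_indicator_sub_le hO hlam hA hε
    exact ⟨g, hg.continuous.integrable_of_hasCompactSupport hgc, h g hg hgc hgO hg0, hgε⟩
  have hsimple : ∀ f : SimpleFunc X ℝ, (∀ x, 0 ≤ f x) →
      EssLimNonneg (fun s => ∫ x, a s x * f x ∂lam) := by
    intro f
    induction f using SimpleFunc.induction with
    | @const c A hA =>
      intro hf
      rcases A.eq_empty_or_nonempty with rfl | ⟨x₀, hx₀⟩
      · simpa using EssLimNonneg.zero
      · have hc : 0 ≤ c := by simpa [SimpleFunc.piecewise_apply, hx₀] using hf x₀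
        refine ((hind A hA).const_mul hc).congr (Eventually.of_forall fun s => ?_)
        rw [← integral_const_mul]
        congr 1; ext x
        by_cases hx : x ∈ A <;> simp [SimpleFunc.piecewise_apply, hx, mul_comm]
    | @add f g hfg ihf ihg =>
      intro hf
      have hdisj : ∀ x, f x = 0 ∨ g x = 0 := fun x => by
        by_contra hcon
        rw [not_or] at hcon
        exact disjoint_left.1 hfg hcon.1 hcon.2
      have hf0 : ∀ x, 0 ≤ f x := fun x => by
        rcases hdisj x with h0 | h0
        · exact h0.ge
        · simpa [h0] using hf x
      have hg0 : ∀ x, 0 ≤ g x := fun x => by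
        rcases hdisj x with h0 | h0
        · simpa [h0] using hf x
        · exact h0.ge
      refine ((ihf hf0).add (ihg hg0)).congr ?_
      filter_upwards [ha] with s hs
      rw [← integral_add
        (integrable_mul_of_bounded hs.1 hs.2 (SimpleFunc.integrable_of_isFiniteMeasure f))
        (integrable_mul_of_bounded hs.1 hs.2 (SimpleFunc.integrable_of_isFiniteMeasure g))]
      simp [mul_add]
  obtain ⟨β', hβ'm, hβ'0, hββ'⟩ : ∃ β' : X → ℝ, Measurable β' ∧ (∀ x, 0 ≤ β' x) ∧ β =ᵐ[lam] β' := by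
    refine ⟨fun x => max (hβ.1.mk β x) 0, hβ.1.stronglyMeasurable_mk.measurable.max
      measurable_const, fun x => le_max_right _ _, ?_⟩
    filter_upwards [hβ0, hβ.1.ae_eq_mk] with x hx hx'
    rw [← hx', max_eq_left hx]
  have hβ'i : Integrable β' lam := hβ.congr hββ'
  have hlim : EssLimNonneg (fun s => ∫ x, a s x * β' x ∂lam) := by
    refine essLimNonneg_of_L1_approx ha hβ'i fun ε hε => ?_
    have h0mem : (0 : ℝ) ∈ Ici (0 : ℝ) := self_mem_Ici
    have htend := SimpleFunc.tendsto_approxOn_L1_enorm (μ := lam) hβ'm h0mem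
      (Eventually.of_forall fun x => subset_closure (hβ'0 x)) (by simpa using hβ'i.2)
    have hev := htend.eventually (gt_mem_nhds (ENNReal.ofReal_pos.2 hε))
    obtain ⟨n, hn⟩ := hev.exists
    refine ⟨_, SimpleFunc.integrable_of_isFiniteMeasure
      (SimpleFunc.approxOn β' hβ'm (Ici 0) 0 h0mem n),
      hsimple _ fun x => SimpleFunc.approxOn_mem hβ'm h0mem n x, ?_⟩
    have hdiff : AEStronglyMeasurable
        (fun x => |β' x - SimpleFunc.approxOn β' hβ'm (Ici 0) 0 h0mem n x|) lam :=
      (hβ'i.sub (SimpleFunc.integrable_of_isFiniteMeasure _)).abs.1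
    rw [integral_eq_lintegral_of_nonneg_ae (Eventually.of_forall fun x => abs_nonneg _) hdiff]
    refine ENNReal.toReal_le_of_le_ofReal hε.le (le_trans (le_of_eq ?_) hn.le)
    congr 1; ext x
    rw [abs_sub_comm, ← Real.enorm_eq_ofReal_abs]
  refine hlim.congr (Eventually.of_forall fun s => integral_congr_ae ?_)
  filter_upwards [hββ'] with x hx
  rw [hx]

/-- A parameter `k` on which the coefficients depend equicontinuously can be replaced by a bounded
measurable function `w`: approximate `w` by functions with finitely many values. -/
theorem essLimNonneg_integral_of_const {w : X → ℝ} (hw : Measurable w) {C r M : ℝ}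
    (hr : 0 < r) (hwC : ∀ x, |w x| ≤ C) {a : ℝ → ℝ → X → ℝ}
    (ha : ∀ k, ∀ s ∈ Ioo 0 r, AEStronglyMeasurable (a k s) lam)
    (haM : ∀ s ∈ Ioo 0 r, ∀ᵐ x ∂lam, ∀ k ∈ Icc (-(C + 1)) (C + 1), |a k s x| ≤ M)
    (haw : ∀ s ∈ Ioo 0 r, AEStronglyMeasurable (fun x => a (w x) s x) lam)
    (hunif : ∀ ε > 0, ∃ δ > 0, ∀ s ∈ Ioo 0 r, ∀ᵐ x ∂lam, ∀ k ∈ Icc (-(C + 1)) (C + 1),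
      ∀ k' ∈ Icc (-(C + 1)) (C + 1), |k - k'| ≤ δ → |a k s x - a k' s x| ≤ ε)
    (h : ∀ k ∈ Icc (-(C + 1)) (C + 1), ∀ β : X → ℝ, Integrable β lam → (∀ᵐ x ∂lam, 0 ≤ β x) →
      EssLimNonneg (fun s => ∫ x, a k s x * β x ∂lam))
    {β : X → ℝ} (hβ : Integrable β lam) (hβ0 : ∀ᵐ x ∂lam, 0 ≤ β x) :
    EssLimNonneg (fun s => ∫ x, a (w x) s x * β x ∂lam) := by
  refine EssLimNonneg.of_approx fun ε hε => ?_
  set I := ∫ x, |β x| ∂lam with hI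
  have hI0 : 0 ≤ I := integral_nonneg fun x => abs_nonneg _
  obtain ⟨δ, hδ, hδa⟩ := hunif (ε / (I + 1)) (by positivity)
  obtain ⟨n, hn⟩ := exists_nat_one_div_lt (lt_min hδ one_pos)
  have hn0 : (0 : ℝ) < n + 1 := by positivity
  set fl : X → ℤ := fun x => ⌊(n + 1 : ℝ) * w x⌋ with hfl
  have hflm : Measurable fl := (hw.const_mul _).floor
  set κ : ℤ → ℝ := fun i => i / (n + 1 : ℝ) with hκ
  have hκw : ∀ x, |w x - κ (fl x)| ≤ 1 / (n + 1 : ℝ) := by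
    intro x
    have h1 := Int.floor_le ((n + 1 : ℝ) * w x)
    have h2 := (Int.lt_floor_add_one ((n + 1 : ℝ) * w x)).le
    have h3 : w x - κ (fl x) = ((n + 1 : ℝ) * w x - fl x) / (n + 1 : ℝ) := by
      simp only [hκ]; field_simp
    rw [h3, abs_div, abs_of_pos hn0]
    refine div_le_div_of_nonneg_right ?_ hn0.le
    rw [abs_le]
    constructor <;> simp only [hfl] <;> linarith
  have hwI : ∀ x, w x ∈ Icc (-(C + 1)) (C + 1) := fun x => by
    have := abs_le.1 (hwC x)
    exact ⟨by linarith [this.1], by linarith [this.2]⟩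
  have hκI : ∀ x, κ (fl x) ∈ Icc (-(C + 1)) (C + 1) := fun x => by
    have h1 := abs_le.1 (hwC x)
    have h2 := abs_le.1 (hκw x)
    have h3 := hn.trans_le (min_le_right _ _)
    exact ⟨by linarith [h1.1, h2.2], by linarith [h1.2, h2.1]⟩
  obtain ⟨m, hm⟩ := exists_nat_ge ((n + 1 : ℝ) * C + 1)
  set J : Finset ℤ := (Finset.Icc (-(m : ℤ)) m).filter fun i => κ i ∈ Icc (-(C + 1)) (C + 1)
    with hJ
  have hflJ : ∀ x, fl x ∈ J := by
    intro x
    refine Finset.mem_filter.2 ⟨Finset.mem_Icc.2 ⟨?_, ?_⟩, hκI x⟩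
    · refine Int.le_floor.2 ?_
      push_cast
      nlinarith [(abs_le.1 (hwC x)).1]
    · refine Int.floor_le_iff.2 ?_
      push_cast
      nlinarith [(abs_le.1 (hwC x)).2]
  have hAm : ∀ i, MeasurableSet (fl ⁻¹' {i}) := fun i => hflm (measurableSet_singleton i)
  refine ⟨_, EssLimNonneg.sum J fun i hi => h (κ i) (Finset.mem_filter.1 hi).2
    ((fl ⁻¹' {i}).indicator β) (hβ.indicator (hAm i)) ?_, ?_⟩
  · filter_upwards [hβ0] with x hx
    exact indicator_nonneg (fun _ _ => hx) x
  refine eventually_essZero_of_forall hr fun s hs => ?_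
  have hint : ∀ i ∈ J, Integrable (fun x => a (κ i) s x * (fl ⁻¹' {i}).indicator β x) lam := by
    intro i hi
    refine integrable_mul_of_bounded (ha _ s hs) ?_ (hβ.indicator (hAm i)) (M := M)
    filter_upwards [haM s hs] with x hx using hx _ (Finset.mem_filter.1 hi).2
  have hsum : ∀ x, ∑ i ∈ J, a (κ i) s x * (fl ⁻¹' {i}).indicator β x
      = a (κ (fl x)) s x * β x := by
    intro x
    rw [Finset.sum_eq_single_of_mem _ (hflJ x)]
    · simp
    · intro i _ hne
      rw [indicator_of_notMem (fun hx => hne (by simpa using Eq.symm hx)), mul_zero]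
  have hintw : Integrable (fun x => a (w x) s x * β x) lam := by
    refine integrable_mul_of_bounded (haw s hs) ?_ hβ (M := M)
    filter_upwards [haM s hs] with x hx using hx _ (hwI x)
  rw [← integral_finsetSum _ hint, ← integral_sub hintw (integrable_finsetSum _ hint)]
  calc |∫ x, (a (w x) s x * β x - ∑ i ∈ J, a (κ i) s x * (fl ⁻¹' {i}).indicator β x) ∂lam|
      ≤ ∫ x, ε / (I + 1) * |β x| ∂lam := by
        rw [← Real.norm_eq_abs]
        refine norm_integral_le_of_norm_le (hβ.abs.const_mul _) ?_
        filter_upwards [hδa s hs] with x hx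
        rw [hsum x, ← sub_mul, Real.norm_eq_abs, abs_mul]
        exact mul_le_mul_of_nonneg_right (hx _ (hwI x) _ (hκI x)
          ((hκw x).trans (hn.le.trans (min_le_left _ _)))) (abs_nonneg _)
    _ = ε / (I + 1) * I := integral_const_mul _ _
    _ = ε * (I / (I + 1)) := by ring
    _ ≤ ε * 1 := mul_le_mul_of_nonneg_left ((div_le_one (by positivity)).2 (by linarith)) hε.le
    _ = ε := mul_one ε

end Density

/-! ### Normal coordinates near a smooth boundary -/

section Normal

variable {N : ℕ} {Ω : Set (Vec N)}

theorem IsLocalDefiningFunction.differentiable {ξ : Vec N} {ψ : Vec N → ℝ}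
    (h : IsLocalDefiningFunction Ω ξ ψ) : Differentiable ℝ ψ :=
  h.1.differentiable (by simp)

theorem contDiff_gradient {ψ : Vec N → ℝ} (h : ContDiff ℝ ∞ ψ) : ContDiff ℝ 1 (gradient ψ) := by
  refine contDiff_euclidean.2 fun i => ?_
  have h1 : (fun x => gradient ψ x i) = fun x => fderiv ℝ ψ x (EuclideanSpace.single i 1) := by
    ext x
    rw [← inner_gradient_left, EuclideanSpace.inner_single_right]
    simp
  rw [h1]
  exact (h.fderiv_right (m := 1) (by norm_cast)).clm_apply contDiff_const

/-- Where `∇ψ ≠ 0`, this is the unit normal of the level sets of `ψ`. -/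
noncomputable def unitGradient (ψ : Vec N → ℝ) (x : Vec N) : Vec N := ‖gradient ψ x‖⁻¹ • gradient ψ x

theorem contDiffAt_unitGradient {ψ : Vec N → ℝ} (h : ContDiff ℝ ∞ ψ) {x : Vec N}
    (hx : gradient ψ x ≠ 0) : ContDiffAt ℝ 1 (unitGradient ψ) x :=
  ((contDiff_gradient h).contDiffAt.norm ℝ hx |>.inv (norm_ne_zero_iff.2 hx)).smul
    (contDiff_gradient h).contDiffAt

theorem norm_unitGradient {ψ : Vec N → ℝ} {x : Vec N} (hx : gradient ψ x ≠ 0) :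
    ‖unitGradient ψ x‖ = 1 := by
  rw [unitGradient, norm_smul, norm_inv, norm_norm, inv_mul_cancel₀ (norm_ne_zero_iff.2 hx)]

theorem gradient_eq_smul_unitGradient {ψ : Vec N → ℝ} {x : Vec N} (hx : gradient ψ x ≠ 0) :
    gradient ψ x = ‖gradient ψ x‖ • unitGradient ψ x := by
  rw [unitGradient, smul_smul, mul_inv_cancel₀ (norm_ne_zero_iff.2 hx), one_smul]

theorem hasDerivAt_along {ψ : Vec N → ℝ} (h : Differentiable ℝ ψ) (x v : Vec N) (s : ℝ) :
    HasDerivAt (fun s : ℝ => ψ (x + s • v)) (inner ℝ (gradient ψ (x + s • v)) v) s := by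
  have h1 : HasDerivAt (fun s : ℝ => x + s • v) v s := by
    simpa using ((hasDerivAt_id s).smul_const v).const_add x
  rw [inner_gradient_left]
  exact (h _).hasFDerivAt.comp_hasDerivAt s h1

theorem eventually_neg_along {ψ : Vec N → ℝ} (h : Differentiable ℝ ψ) {x v : Vec N}
    (hx : ψ x = 0) (hv : inner ℝ (gradient ψ x) v < 0) :
    ∀ᶠ s in 𝓝[>] (0 : ℝ), ψ (x + s • v) < 0 := by
  have h1 := hasDerivAt_along h x v 0
  rw [zero_smul, add_zero] at h1
  have h2 := h1.tendsto_slope_zero_right.eventually (gt_mem_nhds hv)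
  filter_upwards [h2, self_mem_nhdsWithin] with s hs hs0
  simp only [zero_add, zero_smul, add_zero, hx, sub_zero, smul_eq_mul] at hs
  have hs0 : 0 < s := hs0
  by_contra hcon
  exact hs.not_ge (mul_nonneg (inv_nonneg.2 hs0.le) (not_lt.1 hcon))

theorem tendsto_along (x v : Vec N) : Tendsto (fun s : ℝ => x + s • v) (𝓝[>] 0) (𝓝 x) := by
  have : Continuous fun s : ℝ => x + s • v := by fun_prop
  simpa using (this.tendsto 0).mono_left nhdsWithin_le_nhds

theorem IsLocalDefiningFunction.eventually {ξ : Vec N} {ψ : Vec N → ℝ}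
    (h : IsLocalDefiningFunction Ω ξ ψ) : ∀ᶠ x in 𝓝 ξ, IsLocalDefiningFunction Ω x ψ := by
  filter_upwards [h.2.2.eventually_nhds,
    (contDiff_gradient h.1).continuous.continuousAt.eventually_ne h.2.1] with x h1 h2
  exact ⟨h.1, h2, h1⟩

theorem IsLocalDefiningFunction.mem_iff {ξ : Vec N} {ψ : Vec N → ℝ}
    (h : IsLocalDefiningFunction Ω ξ ψ) : ξ ∈ Ω ↔ ψ ξ < 0 := h.2.2.self_of_nhds

theorem IsLocalDefiningFunction.mem_frontier_iff (hΩ : IsOpen Ω) {ξ : Vec N} {ψ : Vec N → ℝ}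
    (h : IsLocalDefiningFunction Ω ξ ψ) : ξ ∈ frontier Ω ↔ ψ ξ = 0 := by
  rw [hΩ.frontier_eq]
  constructor
  · rintro ⟨hc, hn⟩
    refine le_antisymm (le_of_not_gt fun hpos => ?_) (not_lt.1 fun hneg => hn (h.mem_iff.2 hneg))
    have h1 : ∀ᶠ x in 𝓝 ξ, x ∉ Ω := by
      filter_upwards [h.2.2, h.differentiable.continuous.continuousAt.eventually
        (lt_mem_nhds hpos)] with x h1 h2 h3
      exact (h1.1 h3).not_gt h2
    obtain ⟨x, h3, h4⟩ := (h1.and_frequently (mem_closure_iff_frequently.1 hc)).exists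
    exact h3 h4
  · intro h0
    refine ⟨?_, fun hmem => (h.mem_iff.1 hmem).ne h0⟩
    have hv : inner ℝ (gradient ψ ξ) (-gradient ψ ξ) < 0 := by
      rw [inner_neg_right, real_inner_self_eq_norm_sq]
      exact neg_neg_of_pos (pow_pos (norm_pos_iff.2 h.2.1) 2)
    refine mem_closure_of_tendsto (tendsto_along ξ (-gradient ψ ξ)) ?_
    filter_upwards [eventually_neg_along h.differentiable h0 hv,
      (tendsto_along ξ (-gradient ψ ξ)).eventually h.2.2] with s h1 h2 using h2.2 h1

/-- The exterior normal can be computed from any local defining function: a direction along which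
one defining function decreases points into `Ω`, so no other one increases along it. -/
theorem IsLocalDefiningFunction.exteriorNormal_eq (hΩ : IsOpen Ω) {ξ : Vec N} (hξ : ξ ∈ frontier Ω)
    {ψ : Vec N → ℝ} (h : IsLocalDefiningFunction Ω ξ ψ) :
    exteriorNormal Ω ξ = unitGradient ψ ξ := by
  have hex : ∃ ψ : Vec N → ℝ, IsLocalDefiningFunction Ω ξ ψ := ⟨ψ, h⟩
  have h' := hex.choose_spec
  rw [exteriorNormal, dif_pos hex]
  set ψ' := hex.choose
  change unitGradient ψ' ξ = unitGradient ψ ξ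
  have h1 := norm_unitGradient h.2.1
  have h1' := norm_unitGradient h'.2.1
  by_contra hne
  have hlt : inner ℝ (unitGradient ψ ξ) (unitGradient ψ' ξ) < 1 :=
    (inner_lt_one_iff_real_of_norm_eq_one h1 h1').2 fun h => hne h.symm
  set v := unitGradient ψ' ξ - unitGradient ψ ξ with hv
  have hdec : inner ℝ (gradient ψ ξ) v < 0 := by
    rw [gradient_eq_smul_unitGradient h.2.1, real_inner_smul_left, hv, inner_sub_right,
      real_inner_self_eq_norm_sq, h1]
    exact mul_neg_of_pos_of_neg (norm_pos_iff.2 h.2.1) (by linarith)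
  have hinc : inner ℝ (gradient ψ' ξ) (-v) < 0 := by
    rw [gradient_eq_smul_unitGradient h'.2.1, real_inner_smul_left, hv, inner_neg_right,
      inner_sub_right, real_inner_self_eq_norm_sq, h1', real_inner_comm]
    exact mul_neg_of_pos_of_neg (norm_pos_iff.2 h'.2.1) (by linarith)
  have hψ : ψ ξ = 0 := (h.mem_frontier_iff hΩ).1 hξ
  have hψ' : ψ' ξ = 0 := (h'.mem_frontier_iff hΩ).1 hξ
  have hd' := hasDerivAt_along h'.differentiable ξ v 0
  rw [zero_smul, add_zero] at hd'
  have hpos : 0 < inner ℝ (gradient ψ' ξ) v := by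
    rw [inner_neg_right] at hinc; linarith
  have h2 := hd'.tendsto_slope_zero_right.eventually (lt_mem_nhds hpos)
  obtain ⟨s, ⟨⟨⟨hs1, hs2⟩, hs3⟩, hs4⟩, hs0⟩ :=
    ((((eventually_neg_along h.differentiable hψ hdec).and
    ((tendsto_along ξ v).eventually h.2.2)).and ((tendsto_along ξ v).eventually h'.2.2)).and
    h2).and self_mem_nhdsWithin |>.exists
  have hs0 : 0 < s := hs0
  simp only [zero_add, zero_smul, add_zero, hψ', sub_zero, smul_eq_mul] at hs4
  exact hs4.not_ge (mul_nonpos_of_nonneg_of_nonpos (inv_nonneg.2 hs0.le)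
    (hs3.1 (hs2.2 hs1)).le)

/-- Flattening: there is a local diffeomorphism, tangent to the identity, that maps the hyperplane
orthogonal to the normal into the zero set of `ψ`. -/
theorem IsLocalDefiningFunction.exists_flattening {ξ : Vec N} {ψ : Vec N → ℝ}
    (h : IsLocalDefiningFunction Ω ξ ψ) (h0 : ψ ξ = 0) :
    ∃ Ψ : Vec N → Vec N, Ψ 0 = ξ ∧ ContDiffAt ℝ 1 Ψ 0 ∧
      HasFDerivAt Ψ (ContinuousLinearMap.id ℝ (Vec N)) 0 ∧
      ∀ᶠ z in 𝓝 0, inner ℝ (unitGradient ψ ξ) z = 0 → ψ (Ψ z) = 0 := by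
  set n := unitGradient ψ ξ with hn
  have hn1 : ‖n‖ = 1 := norm_unitGradient h.2.1
  have hg : ‖gradient ψ ξ‖ ≠ 0 := norm_ne_zero_iff.2 h.2.1
  set Φ : Vec N → Vec N := fun x =>
    (x - ξ) + (‖gradient ψ ξ‖⁻¹ * ψ x - inner ℝ n (x - ξ)) • n with hΦ
  have hΦξ : Φ ξ = 0 := by simp [hΦ, h0]
  have hΦc : ContDiff ℝ 1 Φ := by
    have : ContDiff ℝ 1 ψ := h.1.of_le (by norm_cast)
    have hin : ContDiff ℝ 1 fun x : Vec N => inner ℝ n (x - ξ) :=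
      contDiff_const.inner ℝ (contDiff_id.sub contDiff_const)
    exact (contDiff_id.sub contDiff_const).add
      (((contDiff_const.mul this).sub hin).smul contDiff_const)
  have hΦd : HasFDerivAt Φ
      ((ContinuousLinearEquiv.refl ℝ (Vec N) : Vec N ≃L[ℝ] Vec N) : Vec N →L[ℝ] Vec N) ξ := by
    have h1 : HasFDerivAt (fun x => x - ξ) (ContinuousLinearMap.id ℝ (Vec N)) ξ :=
      (hasFDerivAt_id ξ).sub_const ξ
    have h2 : HasFDerivAt (fun x => inner ℝ n (x - ξ)) (innerSL ℝ n) ξ :=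
      (innerSL ℝ n).hasFDerivAt.comp ξ h1
    have h3 : HasFDerivAt (fun x => ‖gradient ψ ξ‖⁻¹ * ψ x)
        (‖gradient ψ ξ‖⁻¹ • fderiv ℝ ψ ξ) ξ := (h.differentiable ξ).hasFDerivAt.const_mul _
    refine (h1.add ((h3.sub h2).smul_const n)).congr_fderiv (ContinuousLinearMap.ext fun v => ?_)
    have h4 : ‖gradient ψ ξ‖⁻¹ * fderiv ℝ ψ ξ v = inner ℝ n v := by
      rw [← inner_gradient_left, hn, unitGradient, real_inner_smul_left]
    simp [h4]
  have hne : (1 : WithTop ℕ∞) ≠ 0 := one_ne_zero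
  have hcd := hΦc.contDiffAt (x := ξ)
  refine ⟨hcd.localInverse hΦd hne, ?_, ?_, ?_, ?_⟩
  · have := hcd.localInverse_apply_image hΦd hne
    rwa [hΦξ] at this
  · have := hcd.to_localInverse hΦd hne
    rwa [hΦξ] at this
  · have := ((hcd.hasStrictFDerivAt' hΦd hne).to_localInverse).hasFDerivAt
    rw [hΦξ] at this
    exact this
  · have := (hcd.hasStrictFDerivAt' hΦd hne).eventually_right_inverse
    rw [hΦξ] at this
    filter_upwards [this] with z hz hz0
    change Φ (hcd.localInverse hΦd hne z) = z at hz
    rw [← hz] at hz0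
    simp only [hΦ, inner_add_right, real_inner_smul_right, real_inner_self_eq_norm_sq, hn1] at hz0
    have : ‖gradient ψ ξ‖⁻¹ * ψ (hcd.localInverse hΦd hne z) = 0 := by linarith
    exact (mul_eq_zero.1 this).resolve_left (inv_ne_zero hg)

end Normal

/-- A linear parametrization of `ℝ^(m+1)` by a hyperplane and its normal line. -/
theorem exists_hyperplane_coordinates {m : ℕ} {n : Vec (m + 1)} (hn : ‖n‖ = 1) :
    ∃ (ι : Vec m →L[ℝ] Vec (m + 1)) (A : (Vec m × ℝ) ≃L[ℝ] Vec (m + 1)),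
      (∀ y, inner ℝ n (ι y) = 0) ∧ ∀ y s, A (y, s) = ι y - s • n := by
  have hn0 : n ≠ 0 := fun h => by simp [h] at hn
  have : Fact (Module.finrank ℝ (Vec (m + 1)) = m + 1) := ⟨by simp⟩
  let e := (OrthonormalBasis.fromOrthogonalSpanSingleton (𝕜 := ℝ) m hn0).repr.symm
  let ι : Vec m →L[ℝ] Vec (m + 1) :=
    ((ℝ ∙ n)ᗮ).subtypeL.comp (e.toContinuousLinearEquiv : Vec m →L[ℝ] (ℝ ∙ n)ᗮ)
  have hι : ∀ y, inner ℝ n (ι y) = 0 := fun y =>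
    Submodule.mem_orthogonal_singleton_iff_inner_right.1 (e y).2
  let A₀ : (Vec m × ℝ) →ₗ[ℝ] Vec (m + 1) :=
    (ι.comp (ContinuousLinearMap.fst ℝ (Vec m) ℝ)
      - (ContinuousLinearMap.snd ℝ (Vec m) ℝ).smulRight n : (Vec m × ℝ) →L[ℝ] Vec (m + 1))
  have hA₀ : ∀ y s, A₀ (y, s) = ι y - s • n := fun y s => rfl
  have hinj : Function.Injective A₀ := by
    refine (injective_iff_map_eq_zero A₀).2 ?_
    rintro ⟨y, s⟩ hys
    rw [hA₀] at hys
    have hs : s = 0 := by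
      have := congrArg (inner ℝ n) hys
      simpa [inner_sub_right, hι, real_inner_smul_right, real_inner_self_eq_norm_sq, hn] using this
    rw [hs, zero_smul, sub_zero] at hys
    have hy : e y = 0 := Subtype.ext hys
    rw [map_eq_zero_iff e e.injective] at hy
    rw [hs, hy]; rfl
  refine ⟨ι, (LinearMap.linearEquivOfInjective A₀ hinj (by simp)).toContinuousLinearEquiv, hι,
    fun y s => ?_⟩
  exact hA₀ y s

/-- Normal coordinates `x = E(y, s)` near a boundary point: `y` is a parameter on the boundary and
`s` is the signed length of the normal segment from `E(y, 0) ∈ ∂Ω` to `x`, positive in `Ω`.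
The map `E` is a `C¹` diffeomorphism of the open set `U`, with inverse `I`; outside `U` its values
carry no information, and only the box `ball 0 r × (-r, r)` inside `U` is related to `Ω`. -/
structure NormalChart {m : ℕ} (Ω : Set (Vec (m + 1))) where
  /-- The parametrization. -/
  E : Vec m × ℝ → Vec (m + 1)
  /-- The inverse of the parametrization. -/
  I : Vec (m + 1) → Vec m × ℝ
  /-- The domain on which the parametrization is a diffeomorphism. -/
  U : Set (Vec m × ℝ)
  /-- The size of the box on which `E` describes `Ω`. -/
  r : ℝ
  r_pos : 0 < r
  isOpen_U : IsOpen U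
  box_subset : Metric.closedBall 0 r ×ˢ Icc (-r) r ⊆ U
  measurable_E : Measurable E
  contDiffOn_E : ContDiffOn ℝ 1 E U
  isOpen_image : ∀ V ⊆ U, IsOpen V → IsOpen (E '' V)
  contDiffOn_I : ContDiffOn ℝ 1 I (E '' U)
  left_inv : ∀ z ∈ U, I (E z) = z
  mem_iff : ∀ y ∈ Metric.ball 0 r, ∀ s ∈ Ioo (-r) r, (E (y, s) ∈ Ω ↔ 0 < s)
  mem_frontier_iff : ∀ y ∈ Metric.ball 0 r, ∀ s ∈ Ioo (-r) r, (E (y, s) ∈ frontier Ω ↔ s = 0)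
  E_eq : ∀ y ∈ Metric.ball 0 r, ∀ s ∈ Ioo (-r) r,
    E (y, s) = E (y, 0) - s • exteriorNormal Ω (E (y, 0))
  fderiv_I : ∀ y ∈ Metric.ball 0 r, ∀ v,
    (fderiv ℝ I (E (y, 0)) v).2 = -inner ℝ v (exteriorNormal Ω (E (y, 0)))

/-- Normal coordinates exist near every boundary point: apply the inverse function theorem to
`(y, s) ↦ γ(y) - s ν(γ(y))`, where `γ` parametrizes the boundary. -/
theorem exists_normalChart {m : ℕ} {Ω : Set (Vec (m + 1))} (hΩ : IsOpen Ω)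
    (hsm : HasSmoothBoundary Ω) {ξ : Vec (m + 1)} (hξ : ξ ∈ frontier Ω) :
    ∃ c : NormalChart Ω, c.E (0, 0) = ξ := by
  classical
  obtain ⟨ψ, hψ⟩ := hsm ξ hξ
  have hψξ := (hψ.mem_frontier_iff hΩ).1 hξ
  obtain ⟨Ψ, hΨ0, hΨc, hΨd, hΨz⟩ := hψ.exists_flattening hψξ
  obtain ⟨ι, A, hι, hA⟩ := exists_hyperplane_coordinates (norm_unitGradient hψ.2.1)
  set n := unitGradient ψ with hn
  set γ : Vec m → Vec (m + 1) := fun y => Ψ (ι y) with hγ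
  set E₀ : Vec m × ℝ → Vec (m + 1) := fun z => γ z.1 - z.2 • n (γ z.1) with hE₀
  have hγ0 : γ 0 = ξ := by simp [hγ, hΨ0]
  have hE0 : E₀ 0 = ξ := by simp [hE₀, hγ0]
  have hγc : ContDiffAt ℝ 1 γ 0 :=
    ContDiffAt.comp 0 (by rwa [map_zero]) ι.contDiff.contDiffAt
  have hγ1c : ContDiffAt ℝ 1 (fun z : Vec m × ℝ => γ z.1) 0 :=
    ContDiffAt.comp (0 : Vec m × ℝ) (g := γ) hγc contDiff_fst.contDiffAt
  have hnc : ContDiffAt ℝ 1 (fun z : Vec m × ℝ => n (γ z.1)) 0 :=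
    ContDiffAt.comp (0 : Vec m × ℝ) (g := n)
      (by simpa [hγ0] using contDiffAt_unitGradient hψ.1 hψ.2.1) hγ1c
  have hE₀c : ContDiffAt ℝ 1 E₀ 0 := hγ1c.sub (contDiff_snd.contDiffAt.smul hnc)
  have hE₀d : HasFDerivAt E₀ (A : (Vec m × ℝ) →L[ℝ] Vec (m + 1)) 0 := by
    have h1 : HasFDerivAt (fun z : Vec m × ℝ => γ z.1)
        (((ContinuousLinearMap.id ℝ _).comp ι).comp (ContinuousLinearMap.fst ℝ (Vec m) ℝ)) 0 := by
      have h2 : HasFDerivAt γ ((ContinuousLinearMap.id ℝ _).comp ι) 0 :=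
        HasFDerivAt.comp (0 : Vec m) (g := Ψ) (by rwa [map_zero]) ι.hasFDerivAt
      exact HasFDerivAt.comp (0 : Vec m × ℝ) (g := γ) h2 hasFDerivAt_fst
    have h2 := (hasFDerivAt_snd (𝕜 := ℝ) (E := Vec m) (F := ℝ) (p := 0)).smul
      (hnc.differentiableAt one_ne_zero).hasFDerivAt
    refine (h1.sub h2).congr_fderiv (ContinuousLinearMap.ext fun z => ?_)
    obtain ⟨y, s⟩ := z
    rw [ContinuousLinearEquiv.coe_coe, hA]
    simp [hγ0]
  have hne : (1 : WithTop ℕ∞) ≠ 0 := one_ne_zero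
  set e := hE₀c.toOpenPartialHomeomorph E₀ hE₀d hne with he
  have hecoe : ∀ z, e z = E₀ z := fun z => rfl
  have hesrc : (0 : Vec m × ℝ) ∈ e.source := hE₀c.mem_toOpenPartialHomeomorph_source hE₀d hne
  have hIc : ContDiffAt ℝ 1 e.symm ξ := by
    have := hE₀c.to_localInverse hE₀d hne
    rwa [hE0] at this
  have hE₀t : Tendsto E₀ (𝓝 0) (𝓝 ξ) := by
    have := hE₀c.continuousAt.tendsto
    rwa [hE0] at this
  have hγt : Tendsto (fun z : Vec m × ℝ => γ z.1) (𝓝 0) (𝓝 ξ) := by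
    have := hγ1c.continuousAt.tendsto
    simpa [hγ0] using this
  have hιt : Tendsto (fun z : Vec m × ℝ => ι z.1) (𝓝 0) (𝓝 0) := by
    have : Continuous fun z : Vec m × ℝ => ι z.1 := ι.continuous.comp continuous_fst
    simpa using this.tendsto 0
  have hpos : ∀ᶠ z : Vec m × ℝ in 𝓝 0,
      0 < inner ℝ (gradient ψ (E₀ z)) (n (γ z.1)) := by
    have h1 : Tendsto (fun z : Vec m × ℝ => inner ℝ (gradient ψ (E₀ z)) (n (γ z.1))) (𝓝 0)
        (𝓝 (inner ℝ (gradient ψ ξ) (n ξ))) := by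
      refine Tendsto.inner (((contDiff_gradient hψ.1).continuous.tendsto ξ).comp hE₀t) ?_
      have := hnc.continuousAt.tendsto
      simpa [hγ0] using this
    refine h1.eventually (lt_mem_nhds ?_)
    rw [gradient_eq_smul_unitGradient hψ.2.1, real_inner_smul_left, real_inner_self_eq_norm_sq,
      norm_unitGradient hψ.2.1]
    simpa using hψ.2.1
  have hgood : ∀ᶠ z : Vec m × ℝ in 𝓝 0, z ∈ e.source ∧ ContDiffAt ℝ 1 E₀ z ∧
      ContDiffAt ℝ 1 e.symm (E₀ z) ∧ IsLocalDefiningFunction Ω (E₀ z) ψ ∧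
      IsLocalDefiningFunction Ω (γ z.1) ψ ∧ ψ (γ z.1) = 0 ∧
      0 < inner ℝ (gradient ψ (E₀ z)) (n (γ z.1)) := by
    filter_upwards [e.open_source.mem_nhds hesrc, hE₀c.eventually (by simp),
      hE₀t.eventually (hIc.eventually (by simp)), hE₀t.eventually hψ.eventually,
      hγt.eventually hψ.eventually, hιt.eventually hΨz, hpos] with z h1 h2 h3 h4 h5 h6 h7
    exact ⟨h1, h2, h3, h4, h5, h6 (hι _), h7⟩
  obtain ⟨U, hU, hUo, hU0⟩ := eventually_nhds_iff.1 hgood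
  obtain ⟨r, hr, hrU⟩ := Metric.nhds_basis_closedBall.mem_iff.1 (hUo.mem_nhds hU0)
  have hbox : Metric.closedBall (0 : Vec m) r ×ˢ Icc (-r) r ⊆ U := by
    refine Subset.trans (fun z hz => ?_) hrU
    rw [show (0 : Vec m × ℝ) = ((0 : Vec m), (0 : ℝ)) from rfl, ← closedBall_prod_same,
      Real.closedBall_eq_Icc]
    simpa using hz
  have hboxo : ∀ y ∈ Metric.ball (0 : Vec m) r, ∀ s ∈ Icc (-r) r, (y, s) ∈ U := fun y hy s hs =>
    hbox ⟨Metric.ball_subset_closedBall hy, hs⟩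
  set E : Vec m × ℝ → Vec (m + 1) := U.piecewise E₀ (fun _ => 0) with hE
  have hEU : EqOn E E₀ U := fun z hz => piecewise_eq_of_mem _ _ _ hz
  have himg : ∀ V ⊆ U, E '' V = E₀ '' V := fun V hV => (hEU.mono hV).image_eq
  have hUsrc : U ⊆ e.source := fun z hz => (hU z hz).1
  have h00 : (0 : ℝ) ∈ Icc (-r) r := ⟨by linarith, hr.le⟩
  have hEγ : ∀ y ∈ Metric.ball (0 : Vec m) r, E (y, 0) = γ y := fun y hy => by
    rw [hEU (hboxo y hy 0 h00)]; simp [hE₀]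
  have hfr : ∀ y ∈ Metric.ball (0 : Vec m) r, γ y ∈ frontier Ω := fun y hy => by
    obtain ⟨-, -, -, -, h5, h6, -⟩ := hU _ (hboxo y hy 0 h00)
    exact (h5.mem_frontier_iff hΩ).2 h6
  have hnormal : ∀ y ∈ Metric.ball (0 : Vec m) r, exteriorNormal Ω (E (y, 0)) = n (γ y) :=
    fun y hy => by
      obtain ⟨-, -, -, -, h5, h6, -⟩ := hU _ (hboxo y hy 0 h00)
      rw [hEγ y hy, h5.exteriorNormal_eq hΩ (hfr y hy)]
  have hanti : ∀ y ∈ Metric.ball (0 : Vec m) r,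
      StrictAntiOn (fun s => ψ (E₀ (y, s))) (Icc (-r) r) := by
    intro y hy
    have hd : ∀ s, HasDerivAt (fun s => ψ (E₀ (y, s)))
        (inner ℝ (gradient ψ (E₀ (y, s))) (-n (γ y))) s := by
      intro s
      have := hasDerivAt_along hψ.differentiable (γ y) (-n (γ y)) s
      simpa only [hE₀, smul_neg, ← sub_eq_add_neg] using this
    refine strictAntiOn_of_deriv_neg (convex_Icc _ _)
      (fun s _ => (hd s).continuousAt.continuousWithinAt) fun s hs => ?_
    rw [(hd s).deriv, inner_neg_right]
    obtain ⟨-, -, -, -, -, -, h7⟩ := hU _ (hboxo y hy s (interior_subset hs))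
    exact neg_neg_of_pos h7
  have hψ0 : ∀ y ∈ Metric.ball (0 : Vec m) r, ψ (E₀ (y, 0)) = 0 := fun y hy => by
    obtain ⟨-, -, -, -, -, h6, -⟩ := hU _ (hboxo y hy 0 h00)
    simpa [hE₀] using h6
  refine ⟨⟨E, e.symm, U, r, hr, hUo, hbox, ?_, ?_, ?_, ?_, ?_, ?_, ?_, ?_, ?_⟩, ?_⟩
  · exact ContinuousOn.measurable_piecewise
      (fun z hz => (hU z hz).2.1.continuousAt.continuousWithinAt) continuousOn_const
      hUo.measurableSet
  · exact ContDiffOn.congr (fun z hz => (hU z hz).2.1.contDiffWithinAt) hEU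
  · intro V hV hVo
    rw [himg V hV]
    exact e.isOpen_image_of_subset_source hVo (hV.trans hUsrc)
  · rw [himg U subset_rfl]
    rintro _ ⟨z, hz, rfl⟩
    exact (hU z hz).2.2.1.contDiffWithinAt
  · intro z hz
    rw [hEU hz]
    exact e.left_inv (hUsrc hz)
  · intro y hy s hs
    have hsI := Ioo_subset_Icc_self hs
    obtain ⟨-, -, -, h4, -, -, -⟩ := hU _ (hboxo y hy s hsI)
    rw [hEU (hboxo y hy s hsI), h4.mem_iff]
    conv_lhs => rw [← hψ0 y hy]
    exact (hanti y hy).lt_iff_gt hsI h00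
  · intro y hy s hs
    have hsI := Ioo_subset_Icc_self hs
    obtain ⟨-, -, -, h4, -, -, -⟩ := hU _ (hboxo y hy s hsI)
    rw [hEU (hboxo y hy s hsI), h4.mem_frontier_iff hΩ]
    conv_lhs => rw [← hψ0 y hy]
    exact (hanti y hy).injOn.eq_iff hsI h00
  · intro y hy s hs
    rw [hnormal y hy, hEγ y hy, hEU (hboxo y hy s (Ioo_subset_Icc_self hs))]
  · intro y hy v
    have hy0 := hboxo y hy 0 h00
    obtain ⟨-, h2, h3, -, h5, -, -⟩ := hU _ hy0
    have hE₀y : E₀ (y, 0) = γ y := by simp [hE₀]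
    rw [hnormal y hy, hEγ y hy]
    rw [hE₀y] at h3
    set B := fderiv ℝ E₀ (y, 0) with hB
    have hBd : HasFDerivAt E₀ B (y, 0) := (h2.differentiableAt one_ne_zero).hasFDerivAt
    set C := fderiv ℝ e.symm (γ y) with hC
    have hCd : HasFDerivAt e.symm C (γ y) := (h3.differentiableAt one_ne_zero).hasFDerivAt
    have hey : e.symm (γ y) = (y, 0) := by
      rw [← hE₀y]; exact e.left_inv (hUsrc hy0)
    have hBC : ∀ v, B (C v) = v := by
      have h6 : HasFDerivAt (fun x => E₀ (e.symm x)) (B.comp C) (γ y) :=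
        HasFDerivAt.comp (γ y) (g := E₀) (by rwa [hey]) hCd
      have h7 : (fun x => E₀ (e.symm x)) =ᶠ[𝓝 (γ y)] id := by
        have h8 : γ y ∈ e.target := by
          rw [← hE₀y]; exact e.map_source (hUsrc hy0)
        filter_upwards [e.open_target.mem_nhds h8] with x hx using e.right_inv hx
      have h9 := h6.unique ((hasFDerivAt_id (γ y)).congr_of_eventuallyEq h7)
      intro v
      exact congrArg (fun L : Vec (m + 1) →L[ℝ] Vec (m + 1) => L v) h9
    -- The normal component of `B (y', s')` is `-s'`: tangential directions do not contribute.
    have hBs : B (0, 1) = -n (γ y) := by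
      have h6 : HasDerivAt (fun s : ℝ => ((y, s) : Vec m × ℝ)) (0, 1) 0 :=
        (hasDerivAt_const (0 : ℝ) y).prodMk (hasDerivAt_id (0 : ℝ))
      have h7 : HasDerivAt (fun s : ℝ => E₀ (y, s)) (B (0, 1)) 0 := hBd.comp_hasDerivAt 0 h6
      have h8 : HasDerivAt (fun s : ℝ => E₀ (y, s)) (-n (γ y)) 0 := by
        simpa [hE₀] using ((hasDerivAt_id (0 : ℝ)).smul_const (n (γ y))).const_sub (γ y)
      exact h7.unique h8
    have hBy : ∀ y', inner ℝ (gradient ψ (γ y)) (B (y', 0)) = 0 := by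
      intro y'
      have h6 : HasDerivAt (fun τ : ℝ => ((y + τ • y', 0) : Vec m × ℝ)) (y', 0) 0 := by
        refine HasDerivAt.prodMk ?_ (hasDerivAt_const _ _)
        simpa using ((hasDerivAt_id (0 : ℝ)).smul_const y').const_add y
      have h7 : HasDerivAt (fun τ : ℝ => E₀ (y + τ • y', 0)) (B (y', 0)) 0 :=
        HasFDerivAt.comp_hasDerivAt (0 : ℝ) (l := E₀) (by simpa using hBd) h6
      have h8 : HasDerivAt (fun τ : ℝ => ψ (E₀ (y + τ • y', 0)))
          (fderiv ℝ ψ (γ y) (B (y', 0))) 0 :=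
        HasFDerivAt.comp_hasDerivAt (0 : ℝ) (l := ψ)
          (by simpa [hE₀] using (hψ.differentiable (γ y)).hasFDerivAt) h7
      have h9 : (fun τ : ℝ => ψ (E₀ (y + τ • y', 0))) =ᶠ[𝓝 0] fun _ => 0 := by
        have hc : Continuous fun τ : ℝ => y + τ • y' := by fun_prop
        have h10 : ∀ᶠ τ : ℝ in 𝓝 0, y + τ • y' ∈ Metric.ball (0 : Vec m) r :=
          (hc.tendsto 0).eventually (Metric.isOpen_ball.mem_nhds (by simpa using hy))
        filter_upwards [h10] with τ hτ using hψ0 _ hτ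
      rw [inner_gradient_left]
      exact h8.unique ((hasDerivAt_const (0 : ℝ) (0 : ℝ)).congr_of_eventuallyEq h9)
    have hsplit : v = B ((C v).1, 0) + (C v).2 • B (0, 1) := by
      conv_lhs => rw [← hBC v]
      rw [← map_smul, ← map_add]
      congr 1
      ext <;> simp
    have h11 : inner ℝ (n (γ y)) (B ((C v).1, 0)) = 0 := by
      rw [hn, unitGradient, real_inner_smul_left, hBy, mul_zero]
    rw [real_inner_comm]
    conv_rhs => rw [hsplit]
    rw [inner_add_right, h11, hBs, real_inner_smul_right, inner_neg_right,
      real_inner_self_eq_norm_sq, norm_unitGradient h5.2.1]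
    ring
  · exact (hEU hU0).trans hE0

/-! ### Measures in normal coordinates -/

theorem map_withDensity_comp {X Y : Type*} [MeasurableSpace X] [MeasurableSpace Y] (μ : Measure X)
    {g : X → Y} (hg : Measurable g) {φ : Y → ENNReal} (hφ : Measurable φ) :
    (μ.map g).withDensity φ = (μ.withDensity (fun x => φ (g x))).map g := by
  ext A hA
  rw [withDensity_apply _ hA, setLIntegral_map hA hφ hg, Measure.map_apply hg hA,
    withDensity_apply _ (hg hA)]

/-- The parameter measure `dt dy` on `(0, T) × ball 0 r`. -/
noncomputable def paramMeasure (m : ℕ) (T r : ℝ) : Measure (ℝ × Vec m) :=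
  ((volume : Measure ℝ).restrict (Ioo 0 T)).prod
    ((volume : Measure (Vec m)).restrict (Metric.ball 0 r))

instance {m : ℕ} (r : ℝ) :
    IsFiniteMeasure ((volume : Measure (Vec m)).restrict (Metric.ball 0 r)) :=
  ⟨by rw [Measure.restrict_apply_univ]; exact measure_ball_lt_top⟩

instance {m : ℕ} (T r : ℝ) : IsFiniteMeasure (paramMeasure m T r) := by
  unfold paramMeasure; infer_instance

theorem ae_paramMeasure {m : ℕ} (T r : ℝ) :
    ∀ᵐ x ∂(paramMeasure m T r), x ∈ Ioo 0 T ×ˢ Metric.ball (0 : Vec m) r := by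
  rw [paramMeasure, Measure.prod_restrict]
  exact ae_restrict_mem (measurableSet_Ioo.prod measurableSet_ball)

namespace NormalChart

variable {m : ℕ} {Ω : Set (Vec (m + 1))} (c : NormalChart Ω)

/-- The part of a neighbourhood of the boundary point that the coordinates describe. -/
def tube : Set (Vec (m + 1)) := c.E '' (Metric.ball 0 c.r ×ˢ Ioo (-c.r) c.r)

/-- The part of the boundary that the coordinates describe. -/
def patch : Set (Vec (m + 1)) := c.tube ∩ frontier Ω

theorem openBox_subset : Metric.ball 0 c.r ×ˢ Ioo (-c.r) c.r ⊆ c.U :=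
  (Set.prod_mono Metric.ball_subset_closedBall Ioo_subset_Icc_self).trans c.box_subset

theorem zero_mem_Ioo : (0 : ℝ) ∈ Ioo (-c.r) c.r := ⟨by linarith [c.r_pos], c.r_pos⟩

theorem isOpen_tube : IsOpen c.tube :=
  c.isOpen_image _ c.openBox_subset (Metric.isOpen_ball.prod isOpen_Ioo)

theorem measurableSet_patch : MeasurableSet c.patch :=
  c.isOpen_tube.measurableSet.inter isClosed_frontier.measurableSet

theorem injOn_E : InjOn c.E c.U := fun z hz z' hz' h => by
  rw [← c.left_inv z hz, h, c.left_inv z' hz']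

theorem exists_of_mem_patch {x : Vec (m + 1)} (hx : x ∈ c.patch) :
    ∃ y ∈ Metric.ball (0 : Vec m) c.r, c.E (y, 0) = x := by
  obtain ⟨⟨⟨y, s⟩, ⟨hy, hs⟩, rfl⟩, hfr⟩ := hx
  rw [c.mem_frontier_iff y hy s hs] at hfr
  exact ⟨y, hy, by rw [hfr]⟩

theorem measurable_param : Measurable fun y : Vec m => c.E (y, 0) :=
  c.measurable_E.comp (measurable_id.prodMk measurable_const)

theorem tube_inter : Ω ∩ c.tube = c.E '' (Metric.ball 0 c.r ×ˢ Ioo 0 c.r) := by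
  ext x
  constructor
  · rintro ⟨hx, ⟨⟨y, s⟩, ⟨hy, hs⟩, rfl⟩⟩
    exact ⟨(y, s), ⟨hy, (c.mem_iff y hy s hs).1 hx, hs.2⟩, rfl⟩
  · rintro ⟨⟨y, s⟩, ⟨hy, hs⟩, rfl⟩
    have hs' : s ∈ Ioo (-c.r) c.r := ⟨by linarith [hs.1, c.r_pos], hs.2⟩
    exact ⟨(c.mem_iff y hy s hs').2 hs.1, (y, s), ⟨hy, hs'⟩, rfl⟩

/-- The Lebesgue measure in normal coordinates has a positive continuous density `J`. Since Lebesgue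
measures are only compared up to the Haar constant of a linear isomorphism, this constant is part
of `J`. -/
theorem exists_jacobian : ∃ J : Vec m × ℝ → ℝ, Measurable J ∧ ContinuousOn J c.U ∧
    (∀ z ∈ c.U, 0 < J z) ∧ ∀ V ⊆ c.U, MeasurableSet V →
      volume.restrict (c.E '' V)
        = ((volume.restrict V).withDensity fun z => ENNReal.ofReal (J z)).map c.E := by
  classical
  let L : Vec (m + 1) ≃L[ℝ] (Vec m × ℝ) := ContinuousLinearEquiv.ofFinrankEq (by simp)
  have hL : Measurable L := L.continuous.measurable
  have hHaar : (volume : Measure (Vec m × ℝ)).IsAddHaarMeasure := by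
    rw [Measure.volume_eq_prod]; infer_instance
  set κ := Measure.addHaarScalarFactor
    ((volume : Measure (Vec (m + 1))).map L) (volume : Measure (Vec m × ℝ)) with hκ
  have hmap : (volume : Measure (Vec (m + 1))).map L = κ • (volume : Measure (Vec m × ℝ)) :=
    Measure.isAddLeftInvariant_eq_smul _ _
  have hκ0 : 0 < κ := Measure.addHaarScalarFactor_pos_of_isAddHaarMeasure _ _
  set d : Vec m × ℝ → ℝ := fun z =>
    |((fderiv ℝ c.E z).comp (L : Vec (m + 1) →L[ℝ] (Vec m × ℝ))).det| with hd
  have hdc : ContinuousOn d c.U := by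
    have h1 : ContinuousOn (fderiv ℝ c.E) c.U :=
      c.contDiffOn_E.continuousOn_fderiv_of_isOpen c.isOpen_U le_rfl
    exact (ContinuousLinearMap.continuous_det.comp_continuousOn
      (h1.clm_comp continuousOn_const)).abs
  have hdpos : ∀ z ∈ c.U, 0 < d z := by
    intro z hz
    have hE : HasFDerivAt c.E (fderiv ℝ c.E z) z :=
      ((c.contDiffOn_E.contDiffAt (c.isOpen_U.mem_nhds hz)).differentiableAt
        one_ne_zero).hasFDerivAt
    have hI : HasFDerivAt c.I (fderiv ℝ c.I (c.E z)) (c.E z) :=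
      ((c.contDiffOn_I.contDiffAt ((c.isOpen_image _ subset_rfl c.isOpen_U).mem_nhds
        (mem_image_of_mem _ hz))).differentiableAt one_ne_zero).hasFDerivAt
    have h2 : (fderiv ℝ c.I (c.E z)).comp (fderiv ℝ c.E z) = ContinuousLinearMap.id ℝ _ := by
      refine (hI.comp z hE).unique ((hasFDerivAt_id z).congr_of_eventuallyEq ?_)
      filter_upwards [c.isOpen_U.mem_nhds hz] with z' hz' using c.left_inv z' hz'
    have h3 : (((L.symm : (Vec m × ℝ) →L[ℝ] Vec (m + 1)).comp (fderiv ℝ c.I (c.E z))).comp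
        ((fderiv ℝ c.E z).comp (L : Vec (m + 1) →L[ℝ] (Vec m × ℝ))))
        = ContinuousLinearMap.id ℝ _ := by
      ext1 v
      have := congrArg (fun A : (Vec m × ℝ) →L[ℝ] (Vec m × ℝ) => A (L v)) h2
      simp only [ContinuousLinearMap.comp_apply, ContinuousLinearMap.id_apply] at this
      simp [this]
    have h4 := congrArg ContinuousLinearMap.det h3
    rw [show ∀ A B : Vec (m + 1) →L[ℝ] Vec (m + 1), (A.comp B).det = A.det * B.det from
      fun A B => LinearMap.det_comp _ _] at h4
    refine abs_pos.2 fun h0 => ?_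
    rw [h0, mul_zero] at h4
    simp [ContinuousLinearMap.det] at h4
  set J : Vec m × ℝ → ℝ := c.U.piecewise (fun z => κ * d z) (fun _ => 0) with hJ
  have hJU : EqOn J (fun z => κ * d z) c.U := fun z hz => piecewise_eq_of_mem _ _ _ hz
  have hJm : Measurable J := ContinuousOn.measurable_piecewise (continuousOn_const.mul hdc)
    continuousOn_const c.isOpen_U.measurableSet
  refine ⟨J, hJm, (continuousOn_const.mul hdc).congr hJU, fun z hz => ?_, fun V hV hVm => ?_⟩
  · rw [hJU hz]; exact mul_pos (by exact_mod_cast hκ0) (hdpos z hz)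
  · have hVL : MeasurableSet (L ⁻¹' V) := hL hVm
    have hder : ∀ x ∈ L ⁻¹' V, HasFDerivWithinAt (fun x => c.E (L x))
        ((fderiv ℝ c.E (L x)).comp (L : Vec (m + 1) →L[ℝ] (Vec m × ℝ))) (L ⁻¹' V) x := by
      intro x hx
      have hE : HasFDerivAt c.E (fderiv ℝ c.E (L x)) (L x) :=
        ((c.contDiffOn_E.contDiffAt (c.isOpen_U.mem_nhds (hV hx))).differentiableAt
          one_ne_zero).hasFDerivAt
      exact (hE.comp x L.hasFDerivAt).hasFDerivWithinAt
    have hinj : InjOn (fun x => c.E (L x)) (L ⁻¹' V) := fun x hx x' hx' h =>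
      L.injective (c.injOn_E (hV hx) (hV hx') h)
    have key := map_withDensity_abs_det_fderiv_eq_addHaar volume hVL.nullMeasurableSet hder hinj
    have himg : (fun x => c.E (L x)) '' (L ⁻¹' V) = c.E '' V := by
      rw [← image_image c.E L, image_preimage_eq V L.surjective]
    rw [himg] at key
    rw [← key]
    have hinv : ∀ z, (κ : ℝ)⁻¹ * (κ * d z) = d z := fun z => by
      rw [← mul_assoc, inv_mul_cancel₀ (by exact_mod_cast hκ0.ne'), one_mul]
    have h5 : ((volume.restrict (L ⁻¹' V)).withDensity fun x => ENNReal.ofReal (d (L x)))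
        = (volume.restrict (L ⁻¹' V)).withDensity
          fun x => ENNReal.ofReal ((κ : ℝ)⁻¹ * J (L x)) := by
      refine withDensity_congr_ae ?_
      filter_upwards [ae_restrict_mem hVL] with x hx
      rw [hJU (hV hx)]
      simp only [hinv]
    have h6 : Measurable fun z => ENNReal.ofReal ((κ : ℝ)⁻¹ * J z) :=
      (hJm.const_mul _).ennreal_ofReal
    rw [show (fun x => c.E (L x)) = c.E ∘ L from rfl, ← Measure.map_map c.measurable_E hL]
    change Measure.map c.E (Measure.map L
      ((volume.restrict (L ⁻¹' V)).withDensity fun x => ENNReal.ofReal (d (L x)))) = _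
    rw [h5, ← map_withDensity_comp _ hL h6, ← Measure.restrict_map hL hVm, hmap,
      Measure.restrict_smul]
    congr 1
    ext A hA
    rw [withDensity_apply _ hA, withDensity_apply _ hA, Measure.restrict_smul,
      lintegral_smul_measure, ENNReal.smul_def, smul_eq_mul, ← lintegral_const_mul _ h6]
    congr 1; ext z
    rw [← ENNReal.ofReal_coe_nnreal, ← ENNReal.ofReal_mul NNReal.zero_le_coe, ← mul_assoc,
      mul_inv_cancel₀ (by exact_mod_cast hκ0.ne'), one_mul]

/-- The surface measure on the patch has a bounded density `w` with respect to the parameter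
measure, because the parametrization of the boundary is Lipschitz. -/
theorem exists_surface_density : ∃ (w : Vec m → NNReal) (C : NNReal), Measurable w ∧
    (∀ y, w y ≤ C) ∧ (surfaceMeasure Ω).restrict c.patch
      = ((volume.restrict (Metric.ball 0 c.r)).withDensity fun y => (w y : ENNReal)).map
        (fun y => c.E (y, 0)) := by
  set γ : Vec m → Vec (m + 1) := fun y => c.E (y, 0) with hγ
  have hγm : Measurable γ := c.measurable_param
  set D : Set (Vec m) := Metric.ball 0 c.r with hD
  obtain ⟨K, hK⟩ : ∃ K, LipschitzOnWith K γ (Metric.closedBall 0 c.r) := by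
    refine LocallyLipschitzOn.exists_lipschitzOnWith_of_compact (isCompact_closedBall _ _) ?_
    intro y hy
    have hyU : (y, (0 : ℝ)) ∈ c.U := c.box_subset ⟨hy, Ioo_subset_Icc_self c.zero_mem_Ioo⟩
    have h1 : ContDiffAt ℝ 1 γ y :=
      ContDiffAt.comp y (g := c.E) (c.contDiffOn_E.contDiffAt (c.isOpen_U.mem_nhds hyU))
        (contDiff_id.prodMk contDiff_const).contDiffAt
    obtain ⟨K, t, ht, hKt⟩ := h1.exists_lipschitzOnWith
    exact ⟨K, t, mem_nhdsWithin_of_mem_nhds ht, hKt⟩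
  set C : NNReal := K ^ m with hC
  set ν := (volume.restrict D).map γ with hν
  set σ : Measure (Vec (m + 1)) := (surfaceMeasure Ω).restrict c.patch with hσ
  have hle : σ ≤ C • ν := by
    refine Measure.le_iff.2 fun A hA => ?_
    rw [hσ, Measure.restrict_apply hA, Measure.smul_apply, hν, Measure.map_apply hγm hA,
      Measure.restrict_apply (hγm hA)]
    have hsub : A ∩ c.patch ⊆ γ '' (γ ⁻¹' A ∩ D) := by
      rintro x ⟨hxA, hxP⟩
      obtain ⟨y, hy, rfl⟩ := c.exists_of_mem_patch hxP
      exact ⟨y, ⟨hxA, hy⟩, rfl⟩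
    have h1 : surfaceMeasure Ω (A ∩ c.patch)
        ≤ Measure.euclideanHausdorffMeasure m (γ '' (γ ⁻¹' A ∩ D)) :=
      (Measure.restrict_apply_le _ _).trans (measure_mono hsub)
    refine h1.trans ?_
    have h2 := (hK.mono (inter_subset_right.trans Metric.ball_subset_closedBall :
      γ ⁻¹' A ∩ D ⊆ _)).hausdorffMeasure_image_le (d := m) (by positivity)
    rw [← EuclideanSpace.euclideanHausdorffMeasure_eq_volume]
    simp only [Measure.euclideanHausdorffMeasure_def, Measure.smul_apply]
    rw [smul_comm]
    rw [ENNReal.rpow_natCast] at h2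
    refine smul_le_smul_of_nonneg_left ?_ zero_le
    simpa [hC, ENNReal.smul_def] using h2
  have : IsFiniteMeasure ν := by rw [hν]; infer_instance
  have : IsFiniteMeasure σ := isFiniteMeasure_of_le _ hle
  have : IsFiniteMeasure (C • ν) := Measure.smul_finite ν (c := (C : ENNReal)) ENNReal.coe_ne_top
  have hdecomp : σ.HaveLebesgueDecomposition (C • ν) :=
    Measure.haveLebesgueDecomposition_of_sigmaFinite σ (C • ν)
  have hac : σ ≪ C • ν := Measure.absolutelyContinuous_of_le hle
  set ρ := σ.rnDeriv (C • ν) with hρ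
  have hρ1 : ∀ᵐ x ∂ν, C * ρ x = ((C * min (ρ x) 1 : ENNReal)) := by
    rcases eq_or_ne C 0 with h0 | h0
    · simp [h0]
    · have h1 : ρ ≤ᵐ[C • ν] 1 := Measure.rnDeriv_le_one_of_le hle
      have h2 : ν ≪ C • ν := Measure.absolutelyContinuous_smul (by exact_mod_cast h0)
      filter_upwards [h2.ae_le h1] with x hx
      rw [Pi.one_apply] at hx
      rw [min_eq_left hx]
  have hρm : Measurable ρ := Measure.measurable_rnDeriv _ _
  have hmin : ∀ x, min (ρ x) 1 ≠ ⊤ := fun x => ne_top_of_le_ne_top ENNReal.one_ne_top (min_le_right _ _)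
  refine ⟨fun y => C * (min (ρ (γ y)) 1).toNNReal, C, ?_, fun y => ?_, ?_⟩
  · exact (((hρm.comp hγm).min measurable_const).ennreal_toNNReal).const_mul _
  · refine mul_le_of_le_one_right' ?_
    exact ENNReal.toNNReal_mono ENNReal.one_ne_top (min_le_right (ρ (γ y)) 1)
  · have h1 : σ = ν.withDensity (fun x => C * min (ρ x) 1) := by
      rw [← withDensity_congr_ae hρ1]
      have h2 := Measure.withDensity_rnDeriv_eq σ (C • ν) hac
      conv_lhs => rw [← h2]
      ext A hA
      rw [withDensity_apply _ hA, withDensity_apply _ hA, Measure.restrict_smul,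
        lintegral_smul_measure, ENNReal.smul_def, smul_eq_mul, ← lintegral_const_mul _ hρm]
    rw [h1, hν, map_withDensity_comp _ hγm ((hρm.min measurable_const).const_mul _)]
    congr 2; ext y
    rw [ENNReal.coe_mul, ENNReal.coe_toNNReal (hmin _)]

theorem surfaceMeasure_patch_lt_top : surfaceMeasure Ω c.patch < ⊤ := by
  obtain ⟨w, C, hw, hwC, h⟩ := c.exists_surface_density
  rw [← Measure.restrict_apply_univ, h, Measure.map_apply c.measurable_param MeasurableSet.univ,
    preimage_univ, withDensity_apply _ MeasurableSet.univ, Measure.restrict_univ]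
  refine lt_of_le_of_lt (lintegral_mono fun y => ENNReal.coe_le_coe.2 (hwC y)) ?_
  rw [lintegral_const]
  exact ENNReal.mul_lt_top ENNReal.coe_lt_top (measure_lt_top _ _)

/-- Lebesgue measure on the part of `(0, T) × Ω` described by the chart, in normal coordinates. -/
theorem interiorMeasure_restrict {J : Vec m × ℝ → ℝ} (hJm : Measurable J)
    (hJ : ∀ V ⊆ c.U, MeasurableSet V → volume.restrict (c.E '' V)
        = ((volume.restrict V).withDensity fun z => ENNReal.ofReal (J z)).map c.E) (T : ℝ) :
    (interiorMeasure T Ω).restrict (univ ×ˢ c.tube)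
      = (((paramMeasure m T c.r).prod (volume.restrict (Ioo 0 c.r))).withDensity
          fun p => ENNReal.ofReal (J (p.1.2, p.2))).map
        (fun p => (p.1.1, c.E (p.1.2, p.2))) := by
  set D : Set (Vec m) := Metric.ball 0 c.r with hD
  have hJe : Measurable fun z => ENNReal.ofReal (J z) := hJm.ennreal_ofReal
  have hV : D ×ˢ Ioo 0 c.r ⊆ c.U :=
    (Set.prod_mono subset_rfl (Ioo_subset_Ioo_left (by linarith [c.r_pos]))).trans c.openBox_subset
  have h1 := hJ _ hV (measurableSet_ball.prod measurableSet_Ioo)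
  rw [Measure.volume_eq_prod, ← Measure.prod_restrict] at h1
  rw [interiorMeasure, ← Measure.prod_restrict, Measure.restrict_univ,
    Measure.restrict_restrict c.isOpen_tube.measurableSet, inter_comm, c.tube_inter, h1,
    ← Measure.map_id (μ := (volume : Measure ℝ).restrict (Ioo 0 T)),
    Measure.map_prod_map _ _ measurable_id c.measurable_E,
    prod_withDensity_right hJe, ← Measure.prodAssoc_prod,
    map_withDensity_comp _ MeasurableEquiv.prodAssoc.measurable
      (φ := fun z : ℝ × (Vec m × ℝ) => ENNReal.ofReal (J z.2)) (hJe.comp measurable_snd),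
    Measure.map_map (measurable_id.prodMap c.measurable_E)
      MeasurableEquiv.prodAssoc.measurable]
  rfl

/-- The measure `dξ dt` on the patch, in terms of the parameter measure. -/
theorem lateralMeasure_restrict [IsFiniteMeasure (surfaceMeasure Ω)] {w : Vec m → NNReal}
    (hw : Measurable w) (h : (surfaceMeasure Ω).restrict c.patch
      = ((volume.restrict (Metric.ball 0 c.r)).withDensity fun y => (w y : ENNReal)).map
        (fun y => c.E (y, 0))) (T : ℝ) :
    (lateralMeasure T Ω).restrict (univ ×ˢ c.patch)
      = ((paramMeasure m T c.r).withDensity fun p => (w p.2 : ENNReal)).map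
        (fun p => (p.1, c.E (p.2, 0))) := by
  have hwe : Measurable fun y => (w y : ENNReal) := hw.coe_nnreal_ennreal
  rw [lateralMeasure, ← Measure.prod_restrict, Measure.restrict_univ, h,
    ← Measure.map_id (μ := (volume : Measure ℝ).restrict (Ioo 0 T)),
    Measure.map_prod_map _ _ measurable_id c.measurable_param,
    prod_withDensity_right hwe]
  rfl

end NormalChart

theorem Measurable.clm_apply_apply {X F G : Type*} [MeasurableSpace X] [NormedAddCommGroup F]
    [NormedSpace ℝ F] [SecondCountableTopology F] [MeasurableSpace F] [BorelSpace F]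
    [NormedAddCommGroup G] [NormedSpace ℝ G] [MeasurableSpace G] [BorelSpace G]
    {L : X → F →L[ℝ] G} {v : X → F} (hL : Measurable L) (hv : Measurable v) :
    Measurable fun x => L x (v x) :=
  (isBoundedBilinearMap_apply (𝕜 := ℝ) (E := F) (F := G)).continuous.measurable.comp
    (hL.prodMk hv)

namespace NormalChart

variable {m : ℕ} {Ω : Set (Vec (m + 1))} (c : NormalChart Ω)

/-- The density of Lebesgue measure in normal coordinates. -/
noncomputable def jac : Vec m × ℝ → ℝ := c.exists_jacobian.choose

theorem measurable_jac : Measurable c.jac := c.exists_jacobian.choose_spec.1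

theorem continuousOn_jac : ContinuousOn c.jac c.U := c.exists_jacobian.choose_spec.2.1

theorem jac_pos {z : Vec m × ℝ} (hz : z ∈ c.U) : 0 < c.jac z :=
  c.exists_jacobian.choose_spec.2.2.1 z hz

/-- The density of the surface measure with respect to the parameter measure. -/
noncomputable def dens : Vec m → NNReal := c.exists_surface_density.choose

/-- A bound for the density of the surface measure. -/
noncomputable def densBound : NNReal := c.exists_surface_density.choose_spec.choose

theorem measurable_dens : Measurable c.dens := c.exists_surface_density.choose_spec.choose_spec.1

theorem dens_le (y : Vec m) : c.dens y ≤ c.densBound :=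
  c.exists_surface_density.choose_spec.choose_spec.2.1 y

theorem lateral_restrict_eq [IsFiniteMeasure (surfaceMeasure Ω)] (T : ℝ) :
    (lateralMeasure T Ω).restrict (univ ×ˢ c.patch)
      = ((paramMeasure m T c.r).withDensity fun p => (c.dens p.2 : ENNReal)).map
        (fun p => (p.1, c.E (p.2, 0))) :=
  c.lateralMeasure_restrict c.measurable_dens c.exists_surface_density.choose_spec.choose_spec.2.2 T

theorem interior_restrict_eq (T : ℝ) :
    (interiorMeasure T Ω).restrict (univ ×ˢ c.tube)
      = (((paramMeasure m T c.r).prod (volume.restrict (Ioo 0 c.r))).withDensity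
          fun p => ENNReal.ofReal (c.jac (p.1.2, p.2))).map
        (fun p => (p.1.1, c.E (p.1.2, p.2))) :=
  c.interiorMeasure_restrict c.measurable_jac c.exists_jacobian.choose_spec.2.2.2 T

theorem measurable_lateralParam :
    Measurable fun p : ℝ × Vec m => ((p.1, c.E (p.2, 0)) : ℝ × Vec (m + 1)) :=
  measurable_fst.prodMk (c.measurable_E.comp (measurable_snd.prodMk measurable_const))

theorem measurable_interiorParam :
    Measurable fun p : (ℝ × Vec m) × ℝ => ((p.1.1, c.E (p.1.2, p.2)) : ℝ × Vec (m + 1)) :=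
  measurable_fst.fst.prodMk (c.measurable_E.comp (measurable_fst.snd.prodMk measurable_snd))

theorem setIntegral_lateral [IsFiniteMeasure (surfaceMeasure Ω)] {T : ℝ} {g : ℝ × Vec (m + 1) → ℝ}
    (hg : AEStronglyMeasurable g ((lateralMeasure T Ω).restrict (univ ×ˢ c.patch))) :
    ∫ p in univ ×ˢ c.patch, g p ∂(lateralMeasure T Ω)
      = ∫ x, c.dens x.2 * g (x.1, c.E (x.2, 0)) ∂(paramMeasure m T c.r) := by
  have hd : Measurable fun x : ℝ × Vec m => c.dens x.2 := c.measurable_dens.comp measurable_snd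
  rw [c.lateral_restrict_eq T] at hg ⊢
  rw [integral_map c.measurable_lateralParam.aemeasurable hg,
    integral_withDensity_eq_integral_smul hd]
  rfl

theorem ae_openBox (T : ℝ) : ∀ᵐ p ∂((paramMeasure m T c.r).prod (volume.restrict (Ioo 0 c.r))),
    p.1.1 ∈ Ioo 0 T ∧ (p.1.2, p.2) ∈ Metric.ball (0 : Vec m) c.r ×ˢ Ioo 0 c.r := by
  rw [paramMeasure, Measure.prod_restrict, Measure.prod_restrict]
  filter_upwards [ae_restrict_mem ((measurableSet_Ioo.prod measurableSet_ball).prod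
    measurableSet_Ioo)] with p hp
  exact ⟨hp.1.1, hp.1.2, hp.2⟩

theorem openHalfBox_subset :
    Metric.ball (0 : Vec m) c.r ×ˢ Ioo 0 c.r ⊆ Metric.ball 0 c.r ×ˢ Ioo (-c.r) c.r :=
  Set.prod_mono subset_rfl (Ioo_subset_Ioo_left (by linarith [c.r_pos]))

theorem setIntegral_interior {T : ℝ} {g : ℝ × Vec (m + 1) → ℝ}
    (hg : AEStronglyMeasurable g (interiorMeasure T Ω)) :
    ∫ p in univ ×ˢ c.tube, g p ∂(interiorMeasure T Ω)
      = ∫ p, c.jac (p.1.2, p.2) * g (p.1.1, c.E (p.1.2, p.2))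
        ∂((paramMeasure m T c.r).prod (volume.restrict (Ioo 0 c.r))) := by
  have hJ : Measurable fun p : (ℝ × Vec m) × ℝ => ENNReal.ofReal (c.jac (p.1.2, p.2)) :=
    (c.measurable_jac.comp (measurable_fst.snd.prodMk measurable_snd)).ennreal_ofReal
  have hg' := hg.mono_measure (Measure.restrict_le_self (s := univ ×ˢ c.tube))
  rw [c.interior_restrict_eq T] at hg' ⊢
  rw [integral_map c.measurable_interiorParam.aemeasurable hg',
    integral_withDensity_eq_integral_toReal_smul hJ (Eventually.of_forall fun _ =>
      ENNReal.ofReal_lt_top)]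
  refine integral_congr_ae ?_
  filter_upwards [c.ae_openBox T] with p hp
  rw [ENNReal.toReal_ofReal (c.jac_pos (c.openBox_subset (c.openHalfBox_subset hp.2))).le,
    smul_eq_mul]

/-- A property that holds almost everywhere in `(0, T) × Ω` holds, for almost every small `s`, for
almost all points at normal distance `s` from the patch. -/
theorem ae_ae_of_ae_interior {T : ℝ} {p : ℝ × Vec (m + 1) → Prop}
    (h : ∀ᵐ x ∂(interiorMeasure T Ω), p x) :
    ∀ᵐ s ∂(volume.restrict (Ioo 0 c.r)), ∀ᵐ x ∂(paramMeasure m T c.r),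
      p (x.1, c.E (x.2, s)) := by
  have h1 := ae_restrict_of_ae (s := univ ×ˢ c.tube) h
  rw [c.interior_restrict_eq T] at h1
  have h2 := ae_of_ae_map c.measurable_interiorParam.aemeasurable h1
  have hJ : Measurable fun p : (ℝ × Vec m) × ℝ => ENNReal.ofReal (c.jac (p.1.2, p.2)) :=
    (c.measurable_jac.comp (measurable_fst.snd.prodMk measurable_snd)).ennreal_ofReal
  rw [ae_withDensity_iff hJ] at h2
  have h3 : ∀ᵐ q ∂((paramMeasure m T c.r).prod (volume.restrict (Ioo 0 c.r))),
      p (q.1.1, c.E (q.1.2, q.2)) := by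
    filter_upwards [h2, c.ae_openBox T] with q hq hq'
    refine hq ?_
    simpa using c.jac_pos (c.openBox_subset (c.openHalfBox_subset hq'.2))
  have h4 : ∀ᵐ q ∂((volume.restrict (Ioo 0 c.r)).prod (paramMeasure m T c.r)),
      p (q.2.1, c.E (q.2.2, q.1)) := by
    rw [← Measure.prod_swap] at h3
    exact ae_of_ae_map measurable_swap.aemeasurable h3
  exact Measure.ae_ae_of_ae_prod h4

/-- A property that holds almost everywhere with respect to the parameter measure holds almost
everywhere on the patch. -/
theorem ae_lateral_of_ae_param [IsFiniteMeasure (surfaceMeasure Ω)] {T : ℝ}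
    {p : ℝ × Vec (m + 1) → Prop} (hp : MeasurableSet {x | p x})
    (h : ∀ᵐ x ∂(paramMeasure m T c.r), p (x.1, c.E (x.2, 0))) :
    ∀ᵐ x ∂((lateralMeasure T Ω).restrict (univ ×ˢ c.patch)), p x := by
  rw [c.lateral_restrict_eq T, ae_map_iff c.measurable_lateralParam.aemeasurable hp]
  exact (withDensity_absolutelyContinuous _ _).ae_le h

/-! ### Localized test functions -/

/-- The test function `(t, x) ↦ β(t, y) θ(s)` in normal coordinates `x = E(y, s)`, extended by
zero. -/
noncomputable def localTest (β : ℝ × Vec m → ℝ) (θ : ℝ → ℝ) (p : ℝ × Vec (m + 1)) : ℝ :=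
  (univ ×ˢ c.tube).indicator (fun p => β (p.1, (c.I p.2).1) * θ (c.I p.2).2) p

variable {T : ℝ} {β : ℝ × Vec m → ℝ} {θ : ℝ → ℝ}

theorem localTest_apply {t : ℝ} {z : Vec m × ℝ}
    (hz : z ∈ Metric.ball (0 : Vec m) c.r ×ˢ Ioo (-c.r) c.r) :
    c.localTest β θ (t, c.E z) = β (t, z.1) * θ z.2 := by
  rw [localTest, indicator_of_mem (show (t, c.E z) ∈ univ ×ˢ c.tube from
    ⟨mem_univ _, z, hz, rfl⟩), c.left_inv z (c.openBox_subset hz)]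

theorem localTest_nonneg (hβ : ∀ x, 0 ≤ β x) (hθ : ∀ s, 0 ≤ θ s) (p : ℝ × Vec (m + 1)) :
    0 ≤ c.localTest β θ p :=
  indicator_nonneg (fun _ _ => mul_nonneg (hβ _) (hθ _)) p

theorem exists_isCompact_tsupport_localTest (hβc : HasCompactSupport β)
    (hβs : tsupport β ⊆ Ioo 0 T ×ˢ Metric.ball 0 c.r) (hθs : tsupport θ ⊆ Ioo (-c.r) c.r) :
    ∃ K, IsCompact K ∧ K ⊆ Ioo 0 T ×ˢ c.tube ∧ tsupport (c.localTest β θ) ⊆ K := by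
  set f : (ℝ × Vec m) × ℝ → ℝ × Vec (m + 1) := fun p => (p.1.1, c.E (p.1.2, p.2)) with hf
  have hθc : IsCompact (tsupport θ) :=
    (isCompact_Icc (a := -c.r) (b := c.r)).of_isClosed_subset (isClosed_tsupport _)
      (hθs.trans Ioo_subset_Icc_self)
  have hsub : ∀ p ∈ tsupport β ×ˢ tsupport θ,
      (p.1.2, p.2) ∈ Metric.ball (0 : Vec m) c.r ×ˢ Ioo (-c.r) c.r :=
    fun p hp => ⟨(hβs hp.1).2, hθs hp.2⟩
  have hfc : ContinuousOn f (tsupport β ×ˢ tsupport θ) := by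
    refine continuous_fst.fst.continuousOn.prodMk (c.contDiffOn_E.continuousOn.comp
      (continuous_fst.snd.prodMk continuous_snd).continuousOn fun p hp =>
        c.openBox_subset (hsub p hp))
  have hK : IsCompact (f '' (tsupport β ×ˢ tsupport θ)) :=
    (IsCompact.prod hβc hθc).image_of_continuousOn hfc
  refine ⟨_, hK, ?_, closure_minimal ?_ hK.isClosed⟩
  · rintro _ ⟨p, hp, rfl⟩
    exact ⟨(hβs hp.1).1, _, hsub p hp, rfl⟩
  · rintro ⟨t, x⟩ hx
    have hmem : (t, x) ∈ univ ×ˢ c.tube := mem_of_indicator_ne_zero hx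
    obtain ⟨z, hz, rfl⟩ := hmem.2
    rw [Function.mem_support, c.localTest_apply hz] at hx
    exact ⟨((t, z.1), z.2), ⟨subset_tsupport _ (left_ne_zero_of_mul hx),
      subset_tsupport _ (right_ne_zero_of_mul hx)⟩, rfl⟩

theorem contDiffAt_I {x : Vec (m + 1)} (hx : x ∈ c.tube) : ContDiffAt ℝ 1 c.I x :=
  c.contDiffOn_I.contDiffAt (Filter.mem_of_superset (c.isOpen_tube.mem_nhds hx)
    (image_mono c.openBox_subset))

theorem localTest_eventuallyEq {p : ℝ × Vec (m + 1)} (hp : p.2 ∈ c.tube) :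
    c.localTest β θ =ᶠ[𝓝 p] fun p => β (p.1, (c.I p.2).1) * θ (c.I p.2).2 := by
  filter_upwards [(isOpen_univ.prod c.isOpen_tube).mem_nhds
    (show p ∈ univ ×ˢ c.tube from ⟨mem_univ _, hp⟩)] with q hq
  exact indicator_of_mem hq _

theorem contDiff_localTest (hβ : ContDiff ℝ 1 β) (hβc : HasCompactSupport β)
    (hβs : tsupport β ⊆ Ioo 0 T ×ˢ Metric.ball 0 c.r) (hθ : ContDiff ℝ 1 θ)
    (hθs : tsupport θ ⊆ Ioo (-c.r) c.r) : ContDiff ℝ 1 (c.localTest β θ) := by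
  obtain ⟨K, hK, hKs, hsupp⟩ := c.exists_isCompact_tsupport_localTest hβc hβs hθs
  refine contDiff_iff_contDiffAt.2 fun p => ?_
  by_cases hp : p.2 ∈ c.tube
  · have hI : ContDiffAt ℝ 1 (fun p : ℝ × Vec (m + 1) => c.I p.2) p :=
      ContDiffAt.comp p (g := c.I) (c.contDiffAt_I hp) contDiff_snd.contDiffAt
    refine ContDiffAt.congr_of_eventuallyEq ?_ (c.localTest_eventuallyEq hp)
    exact (hβ.contDiffAt.comp p (contDiff_fst.contDiffAt.prodMk hI.fst)).mul
      (hθ.contDiffAt.comp p hI.snd)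
  · have hpK : p ∈ (tsupport (c.localTest β θ))ᶜ := fun h => hp (hKs (hsupp h)).2
    refine (contDiffAt_const (c := (0 : ℝ))).congr_of_eventuallyEq ?_
    filter_upwards [(isClosed_tsupport _).isOpen_compl.mem_nhds hpK] with q hq
    exact image_eq_zero_of_notMem_tsupport hq

/-- The derivative of a localized test function: only the factor `θ(s)` varies in the direction in
which `s` varies. -/
theorem fderiv_localTest (hβ : ContDiff ℝ 1 β) (hθ : ContDiff ℝ 1 θ) {t : ℝ} {z : Vec m × ℝ}
    (hz : z ∈ Metric.ball (0 : Vec m) c.r ×ˢ Ioo (-c.r) c.r) (τ : ℝ) (v : Vec (m + 1)) :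
    fderiv ℝ (c.localTest β θ) (t, c.E z) (τ, v)
      = fderiv ℝ β (t, z.1) (τ, (fderiv ℝ c.I (c.E z) v).1) * θ z.2
        + deriv θ z.2 * (fderiv ℝ c.I (c.E z) v).2 * β (t, z.1) := by
  have hx : c.E z ∈ c.tube := ⟨z, hz, rfl⟩
  have hIz : c.I (c.E z) = z := c.left_inv z (c.openBox_subset hz)
  have hI : HasFDerivAt (fun p : ℝ × Vec (m + 1) => c.I p.2)
      ((fderiv ℝ c.I (c.E z)).comp (ContinuousLinearMap.snd ℝ ℝ (Vec (m + 1)))) (t, c.E z) :=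
    HasFDerivAt.comp (t, c.E z) (g := c.I)
      ((c.contDiffAt_I hx).differentiableAt one_ne_zero).hasFDerivAt hasFDerivAt_snd
  have h1 : HasFDerivAt (fun p : ℝ × Vec (m + 1) => β (p.1, (c.I p.2).1)) _ (t, c.E z) :=
    HasFDerivAt.comp (t, c.E z) (g := β) (g' := fderiv ℝ β (t, z.1))
      (by rw [hIz]; exact (hβ.differentiable one_ne_zero _).hasFDerivAt)
      (hasFDerivAt_fst.prodMk hI.fst)
  have h2 : HasFDerivAt (fun p : ℝ × Vec (m + 1) => θ (c.I p.2).2) _ (t, c.E z) :=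
    HasDerivAt.comp_hasFDerivAt (t, c.E z) (h₂ := θ) (h₂' := deriv θ z.2)
      (by rw [hIz]; exact (hθ.differentiable one_ne_zero _).hasDerivAt) hI.snd
  have h3 := (h1.mul h2).congr_of_eventuallyEq (c.localTest_eventuallyEq hx)
  rw [h3.fderiv]
  simp [hIz]
  ring

end NormalChart

/-! ### The one-dimensional reduction in a chart -/

theorem exists_bound_of_hasCompactSupport {X V : Type*} [TopologicalSpace X]
    [NormedAddCommGroup V] {g : X → V} (hg : Continuous g) (hgc : HasCompactSupport g) :
    ∃ C, 0 ≤ C ∧ ∀ x, ‖g x‖ ≤ C := by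
  obtain ⟨C, hC⟩ := hg.bounded_above_of_compact_support hgc
  exact ⟨max C 0, le_max_right _ _, fun x => (hC x).trans (le_max_left _ _)⟩

namespace NormalChart

variable {m : ℕ} {Ω : Set (Vec (m + 1))} (c : NormalChart Ω)

theorem isCompact_closedBox : IsCompact (Metric.closedBall (0 : Vec m) c.r ×ˢ Icc (-c.r) c.r) :=
  (isCompact_closedBall _ _).prod isCompact_Icc

theorem exists_bound_jac : ∃ C, 0 ≤ C ∧
    ∀ z ∈ Metric.closedBall (0 : Vec m) c.r ×ˢ Icc (-c.r) c.r, |c.jac z| ≤ C := by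
  obtain ⟨C, hC⟩ := c.isCompact_closedBox.exists_bound_of_continuousOn
    (c.continuousOn_jac.mono c.box_subset)
  exact ⟨max C 0, le_max_right _ _, fun x hx => (hC x hx).trans (le_max_left _ _)⟩

theorem continuousOn_fderiv_I : ContinuousOn (fun z => fderiv ℝ c.I (c.E z)) c.U :=
  (c.contDiffOn_I.continuousOn_fderiv_of_isOpen (c.isOpen_image _ subset_rfl c.isOpen_U)
    le_rfl).comp c.contDiffOn_E.continuousOn (mapsTo_image _ _)

theorem exists_bound_fderiv_I : ∃ C, 0 ≤ C ∧
    ∀ z ∈ Metric.closedBall (0 : Vec m) c.r ×ˢ Icc (-c.r) c.r, ‖fderiv ℝ c.I (c.E z)‖ ≤ C := by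
  obtain ⟨C, hC⟩ := c.isCompact_closedBox.exists_bound_of_continuousOn
    (c.continuousOn_fderiv_I.mono c.box_subset)
  exact ⟨max C 0, le_max_right _ _, fun x hx => (hC x hx).trans (le_max_left _ _)⟩

theorem openHalfBox_subset_closedBox : Metric.ball (0 : Vec m) c.r ×ˢ Ioo 0 c.r ⊆
    Metric.closedBall (0 : Vec m) c.r ×ˢ Icc (-c.r) c.r :=
  c.openHalfBox_subset.trans (Set.prod_mono Metric.ball_subset_closedBall Ioo_subset_Icc_self)

/-- The weighted flux of the vector field `q` across the surface at normal distance `s` from the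
boundary, as a density in the parameters `(t, y)`; the weight is the Jacobian. -/
noncomputable def flux (q : ℝ × Vec (m + 1) → Vec (m + 1)) (s : ℝ) (x : ℝ × Vec m) : ℝ :=
  (fderiv ℝ c.I (c.E (x.2, s)) (q (x.1, c.E (x.2, s)))).2 * c.jac (x.2, s)

theorem measurable_flux {q : ℝ × Vec (m + 1) → Vec (m + 1)} (hq : Measurable q) :
    Measurable fun p : (ℝ × Vec m) × ℝ => c.flux q p.2 p.1 := by
  have hE : Measurable fun p : (ℝ × Vec m) × ℝ => c.E (p.1.2, p.2) :=
    c.measurable_E.comp (measurable_fst.snd.prodMk measurable_snd)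
  exact (Measurable.clm_apply_apply ((measurable_fderiv ℝ c.I).comp hE)
    (hq.comp c.measurable_interiorParam)).snd.mul
    (c.measurable_jac.comp (measurable_fst.snd.prodMk measurable_snd))

theorem exists_bound_flux (M : ℝ) (hM : 0 ≤ M) : ∃ C, 0 ≤ C ∧
    ∀ q : ℝ × Vec (m + 1) → Vec (m + 1), (∀ p, ‖q p‖ ≤ M) →
      ∀ (t : ℝ), ∀ z ∈ Metric.ball (0 : Vec m) c.r ×ˢ Ioo 0 c.r, |c.flux q z.2 (t, z.1)| ≤ C := by
  obtain ⟨CJ, hCJ0, hCJ⟩ := c.exists_bound_jac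
  obtain ⟨CI, hCI0, hCI⟩ := c.exists_bound_fderiv_I
  refine ⟨CI * M * CJ, by positivity, fun q hq t z hz => ?_⟩
  have hz' := c.openHalfBox_subset_closedBox hz
  rw [flux, abs_mul]
  refine mul_le_mul ?_ (hCJ z hz') (abs_nonneg _) (by positivity)
  exact (norm_snd_le _).trans ((ContinuousLinearMap.le_opNorm _ _).trans
    (mul_le_mul (hCI z hz') (hq _) (norm_nonneg _) hCI0))

/-- The core of the trace argument. If the bounded field `(h, q)` satisfies
`∂ₜh + ∇·q ≤ S + b dξ` in the sense of distributions, then the flux of `q` across the surfaces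
parallel to the boundary, tested with a nonnegative `β`, has an essential limit at the boundary,
which is bounded by `b`: test with `β(t, y) θ(s)` and apply the one-dimensional lemma. -/
theorem essLimNonneg_flux [IsFiniteMeasure (surfaceMeasure Ω)] {T M : ℝ}
    {h S b : ℝ × Vec (m + 1) → ℝ} {q : ℝ × Vec (m + 1) → Vec (m + 1)}
    (hh : Measurable h) (hS : Measurable S) (hb : Measurable b) (hq : Measurable q)
    (hhM : ∀ p, |h p| ≤ M) (hSM : ∀ p, |S p| ≤ M) (hbM : ∀ p, |b p| ≤ M) (hqM : ∀ p, ‖q p‖ ≤ M)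
    (hweak : ∀ φ : ℝ × Vec (m + 1) → ℝ, ContDiff ℝ 1 φ → HasCompactSupport φ →
      tsupport φ ⊆ Ioo 0 T ×ˢ univ → (∀ p, 0 ≤ φ p) →
      0 ≤ (∫ p, (h p * fderiv ℝ φ p (1, 0) + fderiv ℝ φ p (0, q p) + S p * φ p)
          ∂(interiorMeasure T Ω)) + ∫ p, b p * φ p ∂(lateralMeasure T Ω))
    {β : ℝ × Vec m → ℝ} (hβ : ContDiff ℝ 1 β) (hβc : HasCompactSupport β)
    (hβs : tsupport β ⊆ Ioo 0 T ×ˢ Metric.ball 0 c.r) (hβ0 : ∀ x, 0 ≤ β x) :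
    EssLimNonneg (fun s => ∫ x, (-c.flux q s x + c.dens x.2 * b (x.1, c.E (x.2, 0))) * β x
      ∂(paramMeasure m T c.r)) := by
  have hM : 0 ≤ M := (abs_nonneg _).trans (hhM 0)
  obtain ⟨CJ, hCJ0, hCJ⟩ := c.exists_bound_jac
  obtain ⟨CI, hCI0, hCI⟩ := c.exists_bound_fderiv_I
  obtain ⟨CF, hCF0, hCF⟩ := c.exists_bound_flux M hM
  obtain ⟨Cβ, hCβ0, hCβ⟩ := exists_bound_of_hasCompactSupport hβ.continuous hβc
  obtain ⟨Cd, hCd0, hCd⟩ := exists_bound_of_hasCompactSupport (hβ.continuous_fderiv one_ne_zero)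
    (hβc.fderiv (𝕜 := ℝ))
  set lam := paramMeasure m T c.r with hlam
  set vs := (volume : Measure ℝ).restrict (Ioo 0 c.r) with hvs
  set Θ : (ℝ × Vec m) × ℝ → ℝ × Vec (m + 1) := fun p => (p.1.1, c.E (p.1.2, p.2)) with hΘ
  have hΘm : Measurable Θ := c.measurable_interiorParam
  have hdI : Measurable fun p : (ℝ × Vec m) × ℝ => fderiv ℝ c.I (Θ p).2 :=
    (measurable_fderiv ℝ c.I).comp hΘm.snd
  set f₁ : (ℝ × Vec m) × ℝ → ℝ := fun p => c.flux q p.2 p.1 * β p.1 with hf₁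
  set f₂ : (ℝ × Vec m) × ℝ → ℝ := fun p => c.jac (p.1.2, p.2) *
    (h (Θ p) * fderiv ℝ β p.1 (1, (fderiv ℝ c.I (Θ p).2 0).1)
      + fderiv ℝ β p.1 (0, (fderiv ℝ c.I (Θ p).2 (q (Θ p))).1) + S (Θ p) * β p.1) with hf₂
  have hf₁m : Measurable f₁ := (c.measurable_flux hq).mul (hβ.continuous.measurable.comp measurable_fst)
  have hf₂m : Measurable f₂ := by
    have hdβ : Measurable fun p : (ℝ × Vec m) × ℝ => fderiv ℝ β p.1 :=
      ((hβ.continuous_fderiv one_ne_zero).measurable).comp measurable_fst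
    refine (c.measurable_jac.comp (measurable_fst.snd.prodMk measurable_snd)).mul (((?_ : Measurable
      _).add ?_).add ((hS.comp hΘm).mul (hβ.continuous.measurable.comp measurable_fst)))
    · exact (hh.comp hΘm).mul (Measurable.clm_apply_apply hdβ (measurable_const.prodMk
        (Measurable.clm_apply_apply hdI measurable_const).fst))
    · exact Measurable.clm_apply_apply hdβ (measurable_const.prodMk
        (Measurable.clm_apply_apply hdI (hq.comp hΘm)).fst)
  have hf₁b : ∀ᵐ p ∂(lam.prod vs), ‖f₁ p‖ ≤ CF * Cβ := by
    filter_upwards [c.ae_openBox T] with p hp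
    rw [hf₁, Real.norm_eq_abs, abs_mul]
    exact mul_le_mul (hCF q hqM p.1.1 _ hp.2) (hCβ _) (abs_nonneg _) hCF0
  set C₂ := CJ * (M * (Cd * 1) + Cd * (CI * M) + M * Cβ) with hC₂
  have hf₂b : ∀ᵐ p ∂(lam.prod vs), ‖f₂ p‖ ≤ C₂ := by
    filter_upwards [c.ae_openBox T] with p hp
    have hz := c.openHalfBox_subset_closedBox hp.2
    rw [hf₂, Real.norm_eq_abs, abs_mul]
    refine mul_le_mul (hCJ _ hz) ?_ (abs_nonneg _) hCJ0
    refine (abs_add_le _ _).trans (add_le_add ((abs_add_le _ _).trans (add_le_add ?_ ?_)) ?_)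
    · rw [abs_mul]
      refine mul_le_mul (hhM _) ((ContinuousLinearMap.le_opNorm _ _).trans
        (mul_le_mul (hCd _) ?_ (norm_nonneg _) hCd0)) (abs_nonneg _) hM
      simp
    · refine (ContinuousLinearMap.le_opNorm _ _).trans
        (mul_le_mul (hCd _) ?_ (norm_nonneg _) hCd0)
      rw [Prod.norm_mk, norm_zero, max_eq_right (norm_nonneg _)]
      exact (norm_fst_le _).trans ((ContinuousLinearMap.le_opNorm _ _).trans
        (mul_le_mul (hCI _ hz) (hqM _) (norm_nonneg _) hCI0))
    · rw [abs_mul]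
      exact mul_le_mul (hSM _) (hCβ _) (abs_nonneg _) hM
  have hf₁i : Integrable f₁ (lam.prod vs) :=
    Integrable.of_bound hf₁m.aestronglyMeasurable _ hf₁b
  have hf₂i : Integrable f₂ (lam.prod vs) :=
    Integrable.of_bound hf₂m.aestronglyMeasurable _ hf₂b
  set B := ∫ x, c.dens x.2 * b (x.1, c.E (x.2, 0)) * β x ∂lam with hB
  set G : ℝ → ℝ := fun s => ∫ x, f₁ (x, s) ∂lam with hG
  set R : ℝ → ℝ := fun s => ∫ x, f₂ (x, s) ∂lam with hR
  have hbound : ∀ {f : (ℝ × Vec m) × ℝ → ℝ} {C : ℝ}, (∀ᵐ p ∂(lam.prod vs), ‖f p‖ ≤ C) →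
      ∀ᵐ s ∂vs, |∫ x, f (x, s) ∂lam| ≤ C * lam.real univ := by
    intro f C hf
    have h1 : ∀ᵐ p ∂(vs.prod lam), ‖f (p.2, p.1)‖ ≤ C := by
      rw [← Measure.prod_swap] at hf
      exact ae_of_ae_map measurable_swap.aemeasurable hf
    filter_upwards [Measure.ae_ae_of_ae_prod h1] with s hs
    exact norm_integral_le_of_norm_le_const hs
  have hGR := essLimNonneg_of_weak_ineq (G := G) (R := R) (B := B) c.r_pos
    (M := max (max (CF * Cβ * lam.real univ) (C₂ * lam.real univ)) 0) (le_max_right _ _)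
    hf₁m.stronglyMeasurable.integral_prod_left'.aestronglyMeasurable
    ((hbound hf₁b).mono fun s hs => hs.trans ((le_max_left _ _).trans (le_max_left _ _)))
    ((hbound hf₂b).mono fun s hs => hs.trans ((le_max_right _ _).trans (le_max_left _ _))) ?_
  · refine hGR.congr (eventually_essZero_of_ae c.r_pos ?_)
    filter_upwards [hf₁i.prod_left_ae] with s hs
    have hbi : Integrable (fun x : ℝ × Vec m => c.dens x.2 * b (x.1, c.E (x.2, 0)) * β x) lam := by
      refine Integrable.of_bound (((c.measurable_dens.comp measurable_snd).coe_nnreal_real.mul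
        (hb.comp c.measurable_lateralParam)).mul hβ.continuous.measurable).aestronglyMeasurable
        (c.densBound * M * Cβ) (Eventually.of_forall fun x => ?_)
      rw [Real.norm_eq_abs, abs_mul, abs_mul, NNReal.abs_eq]
      exact mul_le_mul (mul_le_mul (c.dens_le _) (hbM _) (abs_nonneg _) NNReal.zero_le_coe)
        (hCβ _) (abs_nonneg _) (by positivity)
    change B - ∫ x, f₁ (x, s) ∂lam = _
    rw [hB, ← integral_sub hbi hs]
    congr 1; ext x
    simp only [hf₁]; ring
  · intro θ hθ hθ0 hθs
    have hθc : HasCompactSupport θ :=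
      (isCompact_Icc (a := -c.r) (b := c.r)).of_isClosed_subset (isClosed_tsupport _)
        (hθs.trans Ioo_subset_Icc_self)
    obtain ⟨Cθ, hCθ0, hCθ⟩ := exists_bound_of_hasCompactSupport hθ.continuous hθc
    obtain ⟨Cθ', hCθ'0, hCθ'⟩ := exists_bound_of_hasCompactSupport
      (hθ.continuous_deriv le_rfl) hθc.deriv
    set φ := c.localTest β θ with hφ
    obtain ⟨K, hK, hKs, hsupp⟩ := c.exists_isCompact_tsupport_localTest hβc hβs hθs
    have hφc : ContDiff ℝ 1 φ := c.contDiff_localTest hβ hβc hβs hθ hθs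
    have hφts : ∀ p : ℝ × Vec (m + 1), p.2 ∉ c.tube → p ∉ tsupport φ :=
      fun p hp hp' => hp (hKs (hsupp hp')).2
    have hineq := hweak φ hφc (hK.of_isClosed_subset (isClosed_tsupport _) hsupp)
      (hsupp.trans (hKs.trans (Set.prod_mono subset_rfl (subset_univ _))))
      (c.localTest_nonneg hβ0 hθ0)
    have hdφ : Measurable (fderiv ℝ φ) := (hφc.continuous_fderiv one_ne_zero).measurable
    have e1 : (∫ p, (h p * fderiv ℝ φ p (1, 0) + fderiv ℝ φ p (0, q p) + S p * φ p)
        ∂(interiorMeasure T Ω)) = (∫ s, deriv θ s * G s ∂vs) + ∫ s, θ s * R s ∂vs := by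
      have hgm : Measurable fun p =>
          h p * fderiv ℝ φ p (1, 0) + fderiv ℝ φ p (0, q p) + S p * φ p :=
        ((hh.mul (Measurable.clm_apply_apply hdφ measurable_const)).add
          (Measurable.clm_apply_apply hdφ (measurable_const.prodMk hq))).add
          (hS.mul hφc.continuous.measurable)
      rw [← setIntegral_eq_integral_of_forall_compl_eq_zero (s := univ ×ˢ c.tube),
        c.setIntegral_interior hgm.aestronglyMeasurable]
      · have h1 : ∀ᵐ p ∂(lam.prod vs), c.jac (p.1.2, p.2) * (h (Θ p) * fderiv ℝ φ (Θ p) (1, 0)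
            + fderiv ℝ φ (Θ p) (0, q (Θ p)) + S (Θ p) * φ (Θ p))
            = deriv θ p.2 * f₁ p + θ p.2 * f₂ p := by
          filter_upwards [c.ae_openBox T] with p hp
          have hz := c.openHalfBox_subset hp.2
          simp only [hΘ, hφ, hf₁, hf₂, flux]
          rw [c.fderiv_localTest hβ hθ hz, c.fderiv_localTest hβ hθ hz, c.localTest_apply hz]
          simp only [map_zero, Prod.snd_zero, Prod.mk.eta]
          ring
        rw [integral_congr_ae h1]
        have hi1 : Integrable (fun p : (ℝ × Vec m) × ℝ => deriv θ p.2 * f₁ p) (lam.prod vs) :=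
          hf₁i.bdd_mul ((hθ.continuous_deriv le_rfl).comp continuous_snd).aestronglyMeasurable
            (Eventually.of_forall fun p => hCθ' p.2)
        have hi2 : Integrable (fun p : (ℝ × Vec m) × ℝ => θ p.2 * f₂ p) (lam.prod vs) :=
          hf₂i.bdd_mul (hθ.continuous.comp continuous_snd).aestronglyMeasurable
            (Eventually.of_forall fun p => hCθ p.2)
        rw [integral_add hi1 hi2, integral_prod_symm _ hi1, integral_prod_symm _ hi2]
        simp only [integral_const_mul, hG, hR]
      · intro p hp
        have hp' : p ∉ tsupport φ := hφts p fun h' => hp ⟨mem_univ _, h'⟩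
        have h0 : fderiv ℝ φ p = 0 := by
          by_contra hne
          exact hp' (support_fderiv_subset ℝ hne)
        rw [h0, image_eq_zero_of_notMem_tsupport hp']
        simp
    have e2 : (∫ p, b p * φ p ∂(lateralMeasure T Ω)) = θ 0 * B := by
      have hfr : ∀ᵐ p ∂(lateralMeasure T Ω), p.2 ∈ frontier Ω :=
        Measure.quasiMeasurePreserving_snd.ae
          (ae_restrict_mem isClosed_frontier.measurableSet)
      have hbφ : Measurable fun p => b p * φ p := hb.mul hφc.continuous.measurable
      have h1 : (∫ p in univ ×ˢ c.patch, b p * φ p ∂(lateralMeasure T Ω))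
          = ∫ p, b p * φ p ∂(lateralMeasure T Ω) := by
        refine setIntegral_eq_integral_of_ae_compl_eq_zero ?_
        filter_upwards [hfr] with p hp hp'
        rw [image_eq_zero_of_notMem_tsupport
          (hφts p fun ht => hp' ⟨mem_univ _, ht, hp⟩), mul_zero]
      have h2 : (∫ p in univ ×ˢ c.patch, b p * φ p ∂(lateralMeasure T Ω))
          = ∫ x, c.dens x.2 * (b (x.1, c.E (x.2, 0)) * φ (x.1, c.E (x.2, 0))) ∂lam :=
        c.setIntegral_lateral (g := fun p => b p * φ p) hbφ.aestronglyMeasurable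
      have h3 : θ 0 * B
          = ∫ x, θ 0 * (c.dens x.2 * b (x.1, c.E (x.2, 0)) * β x) ∂lam :=
        (integral_const_mul _ _).symm
      rw [← h1, h2, h3]
      refine integral_congr_ae ?_
      filter_upwards [ae_paramMeasure T c.r] with x hx
      have h4 : φ (x.1, c.E (x.2, 0)) = β (x.1, x.2) * θ 0 :=
        c.localTest_apply ⟨hx.2, c.zero_mem_Ioo⟩
      rw [h4]
      ring
    rw [e1, e2] at hineq
    exact hineq

end NormalChart

/-! ### Bounded measurable fields from the entropy inequality -/

/-- A `C¹` function on a set `K` that need not be open has a locally bounded derivative up to the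
boundary of any open subset of `K`. -/
theorem exists_bound_fderiv_of_contDiffOn {V W : Type*} [NormedAddCommGroup V] [NormedSpace ℝ V]
    [NormedAddCommGroup W] [NormedSpace ℝ W] {g : V → W} {K K' O : Set V}
    (hg : ContDiffOn ℝ 1 g K) (hO : IsOpen O) (hOK : O ⊆ K) (hK' : IsCompact K') (hK'K : K' ⊆ K) :
    ∃ C, 0 ≤ C ∧ ∀ x ∈ O ∩ K', ‖fderiv ℝ g x‖ ≤ C := by
  suffices h : ∃ C, ∀ x ∈ K' ∩ O, ‖fderiv ℝ g x‖ ≤ C by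
    obtain ⟨C, hC⟩ := h
    exact ⟨max C 0, le_max_right _ _, fun x hx => (hC x hx.symm).trans (le_max_left _ _)⟩
  refine hK'.induction_on (p := fun s => ∃ C, ∀ x ∈ s ∩ O, ‖fderiv ℝ g x‖ ≤ C) ⟨0, by simp⟩ ?_ ?_ ?_
  · rintro s t hst ⟨C, hC⟩
    exact ⟨C, fun x hx => hC x ⟨hst hx.1, hx.2⟩⟩
  · rintro s t ⟨C, hC⟩ ⟨C', hC'⟩
    refine ⟨max C C', fun x hx => ?_⟩
    rcases hx.1 with h | h
    · exact (hC x ⟨h, hx.2⟩).trans (le_max_left _ _)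
    · exact (hC' x ⟨h, hx.2⟩).trans (le_max_right _ _)
  · intro x hx
    have h1 : ContDiffWithinAt ℝ (0 + 1) g K x := by simpa using hg x (hK'K hx)
    obtain ⟨u, hu, -, -, g', hg', hg'c⟩ :=
      (contDiffWithinAt_succ_iff_hasFDerivWithinAt' (by simp)).1 h1
    rw [insert_eq_of_mem (hK'K hx)] at hu
    have h2 : ∀ᶠ y in 𝓝[K] x, ‖g' y‖ < ‖g' x‖ + 1 :=
      hg'c.continuousWithinAt.norm.eventually (gt_mem_nhds (lt_add_one _))
    have h3 : u ∩ {y | ‖g' y‖ < ‖g' x‖ + 1} ∈ 𝓝[K] x := inter_mem hu h2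
    refine ⟨_, nhdsWithin_mono x hK'K h3, ‖g' x‖ + 1, fun y hy => ?_⟩
    have h4 : HasFDerivAt g (g' y) y :=
      (hg' y hy.1.1).hasFDerivAt (mem_of_superset (hO.mem_nhds hy.2) hOK)
    rw [h4.fderiv]
    exact le_of_lt hy.1.2

variable {N : ℕ} {T : ℝ} {Ω : Set (Vec N)}

/-- The open set `]0,T[ × Ω`. -/
abbrev cylinder (T : ℝ) (Ω : Set (Vec N)) : Set (ℝ × Vec N) := Ioo 0 T ×ˢ Ω

section Superposition

variable {V : Type*} [NormedAddCommGroup V] [NormedSpace ℝ V] {v : ℝ × Vec N → ℝ}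

theorem measurable_indicator_superposition [MeasurableSpace V] [BorelSpace V]
    {g : ℝ → Vec N → ℝ → V} (hg : IsC2 T Ω g)
    (hΩ : IsOpen Ω) (hv : Measurable v) :
    Measurable ((cylinder T Ω).indicator fun p => g p.1 p.2 (v p)) := by
  classical
  have hK : MeasurableSet (Icc 0 T ×ˢ closure Ω ×ˢ (univ : Set ℝ)) :=
    measurableSet_Icc.prod (isClosed_closure.measurableSet.prod MeasurableSet.univ)
  have h1 : Measurable ((Icc 0 T ×ˢ closure Ω ×ˢ (univ : Set ℝ)).indicator
      fun p : ℝ × Vec N × ℝ => g p.1 p.2.1 p.2.2) := by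
    rw [← piecewise_eq_indicator]
    exact hg.continuousOn.measurable_piecewise continuousOn_const hK
  have h2 := (h1.comp (measurable_fst.prodMk (measurable_snd.prodMk hv))).indicator
    (measurableSet_Ioo.prod hΩ.measurableSet : MeasurableSet (cylinder T Ω))
  convert h2 using 1
  refine indicator_congr fun p hp => ?_
  have hpK : (p.1, p.2, v p) ∈ Icc 0 T ×ˢ closure Ω ×ˢ (univ : Set ℝ) :=
    ⟨Ioo_subset_Icc_self hp.1, subset_closure hp.2, mem_univ _⟩
  rw [Function.comp_apply, indicator_of_mem hpK]

theorem exists_bound_indicator_superposition {g : ℝ → Vec N → ℝ → V} (hg : IsC2 T Ω g)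
    (hΩ : Bornology.IsBounded Ω) {B : ℝ} (hvB : ∀ p, |v p| ≤ B) :
    ∃ C, 0 ≤ C ∧ ∀ p, ‖(cylinder T Ω).indicator (fun p => g p.1 p.2 (v p)) p‖ ≤ C := by
  have hK : IsCompact (Icc 0 T ×ˢ closure Ω ×ˢ Icc (-B) B) :=
    isCompact_Icc.prod (hΩ.isCompact_closure.prod isCompact_Icc)
  obtain ⟨C, hC⟩ := hK.exists_bound_of_continuousOn (hg.continuousOn.mono
    (Set.prod_mono subset_rfl (Set.prod_mono subset_rfl (subset_univ _))))
  refine ⟨max C 0, le_max_right _ _, fun p => ?_⟩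
  by_cases hp : p ∈ cylinder T Ω
  · rw [indicator_of_mem hp]
    exact (hC (p.1, p.2, v p) ⟨Ioo_subset_Icc_self hp.1, subset_closure hp.2,
      abs_le.1 (hvB p)⟩).trans (le_max_left _ _)
  · rw [indicator_of_notMem hp, norm_zero]
    exact le_max_right _ _

theorem divergence_eq_of_isC2 {g : ℝ → Vec N → ℝ → Vec N} (hg : IsC2 T Ω g) (hΩ : IsOpen Ω)
    {t z : ℝ} {x : Vec N} (hx : (t, x) ∈ cylinder T Ω) :
    divergence (fun x => g t x z) x = ∑ i : Fin N,
      fderiv ℝ (fun p : ℝ × Vec N × ℝ => g p.1 p.2.1 p.2.2) (t, x, z)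
        (0, EuclideanSpace.single i 1, 0) i := by
  have hd : DifferentiableAt ℝ (fun p : ℝ × Vec N × ℝ => g p.1 p.2.1 p.2.2) (t, x, z) := by
    refine (hg.contDiffAt ?_).differentiableAt two_ne_zero
    refine mem_of_superset ((isOpen_Ioo.prod (hΩ.prod isOpen_univ)).mem_nhds
      (show (t, x, z) ∈ _ from ⟨hx.1, hx.2, mem_univ z⟩)) ?_
    exact Set.prod_mono Ioo_subset_Icc_self (Set.prod_mono subset_closure subset_rfl)
  have h1 : HasFDerivAt (fun y : Vec N => ((t, y, z) : ℝ × Vec N × ℝ))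
      ((0 : Vec N →L[ℝ] ℝ).prod ((ContinuousLinearMap.id ℝ (Vec N)).prod 0)) x :=
    (hasFDerivAt_const t x).prodMk ((hasFDerivAt_id x).prodMk (hasFDerivAt_const z x))
  have h2 : HasFDerivAt (fun y => g t y z) _ x :=
    HasFDerivAt.comp x (g := fun p : ℝ × Vec N × ℝ => g p.1 p.2.1 p.2.2) hd.hasFDerivAt h1
  rw [divergence, h2.fderiv]
  rfl

theorem measurable_indicator_divergence {g : ℝ → Vec N → ℝ → Vec N} (hg : IsC2 T Ω g)
    (hΩ : IsOpen Ω) (hv : Measurable v) :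
    Measurable ((cylinder T Ω).indicator fun p => divergence (fun x => g p.1 x (v p)) p.2) := by
  rw [indicator_congr fun p (hp : p ∈ cylinder T Ω) =>
    divergence_eq_of_isC2 hg hΩ (z := v p) hp]
  refine Measurable.indicator (Finset.measurable_sum _ fun i _ => ?_)
    (measurableSet_Ioo.prod hΩ.measurableSet)
  have h1 : Measurable fun p : ℝ × Vec N =>
      fderiv ℝ (fun p : ℝ × Vec N × ℝ => g p.1 p.2.1 p.2.2) (p.1, p.2, v p) :=
    (measurable_fderiv ℝ _).comp (measurable_fst.prodMk (measurable_snd.prodMk hv))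
  have h2 := Measurable.clm_apply_apply h1
    (measurable_const (a := ((0, EuclideanSpace.single i 1, 0) : ℝ × Vec N × ℝ)))
  exact (EuclideanSpace.proj (𝕜 := ℝ) i).continuous.measurable.comp h2

theorem exists_bound_indicator_divergence {g : ℝ → Vec N → ℝ → Vec N} (hg : IsC2 T Ω g)
    (hΩ : IsOpen Ω) (hΩb : Bornology.IsBounded Ω) {B : ℝ} (hvB : ∀ p, |v p| ≤ B) :
    ∃ C, 0 ≤ C ∧ ∀ p, |(cylinder T Ω).indicator
      (fun p => divergence (fun x => g p.1 x (v p)) p.2) p| ≤ C := by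
  have hK : IsCompact (Icc 0 T ×ˢ closure Ω ×ˢ Icc (-B) B) :=
    isCompact_Icc.prod (hΩb.isCompact_closure.prod isCompact_Icc)
  obtain ⟨C, hC0, hC⟩ := exists_bound_fderiv_of_contDiffOn (ContDiffOn.of_le hg one_le_two)
    (isOpen_Ioo.prod (hΩ.prod isOpen_univ))
    (Set.prod_mono Ioo_subset_Icc_self (Set.prod_mono subset_closure subset_rfl)) hK
    (Set.prod_mono subset_rfl (Set.prod_mono subset_rfl (subset_univ _)))
  refine ⟨∑ i : Fin N, C * ‖((0, EuclideanSpace.single i 1, 0) : ℝ × Vec N × ℝ)‖,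
    Finset.sum_nonneg fun i _ => by positivity, fun p => ?_⟩
  by_cases hp : p ∈ cylinder T Ω
  · rw [indicator_of_mem hp, divergence_eq_of_isC2 hg hΩ hp]
    refine (Finset.abs_sum_le_sum_abs _ _).trans (Finset.sum_le_sum fun i _ => ?_)
    rw [← Real.norm_eq_abs]
    refine (PiLp.norm_apply_le (_ : Vec N) i).trans
      ((ContinuousLinearMap.le_opNorm (F := Vec N) _ _).trans ?_)
    exact mul_le_mul_of_nonneg_right (hC (p.1, p.2, v p) ⟨⟨hp.1, hp.2, mem_univ _⟩,
      Ioo_subset_Icc_self hp.1, subset_closure hp.2, abs_le.1 (hvB p)⟩) (norm_nonneg _)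
  · rw [indicator_of_notMem hp, abs_zero]
    exact Finset.sum_nonneg fun i _ => by positivity

theorem exists_bound_continuous_comp {G : ℝ → ℝ} (hG : Continuous G) {X : Type*} {v : X → ℝ}
    {B : ℝ} (hvB : ∀ p, |v p| ≤ B) : ∃ C, 0 ≤ C ∧ ∀ p, |G (v p)| ≤ C := by
  obtain ⟨C, hC⟩ := (isCompact_Icc (a := -B) (b := B)).exists_bound_of_continuousOn hG.continuousOn
  exact ⟨max C 0, le_max_right _ _, fun p => (hC _ (abs_le.1 (hvB p))).trans (le_max_left _ _)⟩

end Superposition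

theorem IsBoundaryEntropyPair.isC2_const {f : ℝ → Vec N → ℝ → Vec N} {H : ℝ → ℝ → ℝ}
    {Q : ℝ → Vec N → ℝ → ℝ → Vec N} (hHQ : IsBoundaryEntropyPair T Ω f H Q) (k : ℝ) :
    IsC2 T Ω fun t x z => Q t x z k := by
  refine hHQ.contDiffOn_Q.comp (f := fun p : ℝ × Vec N × ℝ => (p.1, p.2.1, p.2.2, k))
    (by fun_prop) fun p hp => ⟨hp.1, hp.2.1, mem_univ _⟩

theorem ae_mem_cylinder (hΩ : IsOpen Ω) : ∀ᵐ p ∂(interiorMeasure T Ω), p ∈ cylinder T Ω := by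
  rw [interiorMeasure, Measure.prod_restrict]
  exact ae_restrict_mem (measurableSet_Ioo.prod hΩ.measurableSet)

theorem isFiniteMeasure_interiorMeasure (hΩb : Bornology.IsBounded Ω) :
    IsFiniteMeasure (interiorMeasure T Ω) := by
  have : IsFiniteMeasure ((volume : Measure (Vec N)).restrict Ω) :=
    ⟨by simpa using hΩb.measure_lt_top⟩
  rw [interiorMeasure]
  infer_instance

/-- The entropy inequality of a regular entropy solution as a distributional inequality for bounded
measurable fields, for everywhere bounded measurable versions of the solution and of the boundary
datum. -/
theorem IsRESolution.exists_weak_ineq (hΩ : IsOpen Ω) (hΩb : Bornology.IsBounded Ω)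
    {f : ℝ → Vec N → ℝ → Vec N} {F : ℝ → Vec N → ℝ → ℝ} {u₀ : Vec N → ℝ}
    {u u_b : ℝ → Vec N → ℝ} (hf : IsC2 T Ω f) (hF : IsC2 T Ω F)
    (hu : IsRESolution T Ω f F u₀ u_b u) {H : ℝ → ℝ → ℝ} {Q : ℝ → Vec N → ℝ → ℝ → Vec N}
    (hHQ : IsBoundaryEntropyPair T Ω f H Q) {v w : ℝ × Vec N → ℝ} (hv : Measurable v)
    (hw : Measurable w) (hvu : ∀ᵐ p ∂(interiorMeasure T Ω), u p.1 p.2 = v p)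
    (hwu : ∀ᵐ p ∂(lateralMeasure T Ω), u_b p.1 p.2 = w p) {A B : ℝ} (hvA : ∀ p, |v p| ≤ A)
    (hwB : ∀ p, |w p| ≤ B) (k : ℝ) :
    ∃ (M : ℝ) (S : ℝ × Vec N → ℝ),
      let h := fun p => H (v p) k
      let q := (cylinder T Ω).indicator fun p => Q p.1 p.2 (v p) k
      let b := fun p => fluxLipschitzConst T Ω f (supNorm T Ω u) * H (w p) k
      Measurable h ∧ Measurable S ∧ Measurable b ∧ Measurable q ∧ (∀ p, |h p| ≤ M) ∧
      (∀ p, |S p| ≤ M) ∧ (∀ p, |b p| ≤ M) ∧ (∀ p, ‖q p‖ ≤ M) ∧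
      ∀ φ : ℝ × Vec N → ℝ, ContDiff ℝ 1 φ → HasCompactSupport φ →
        tsupport φ ⊆ Ioo 0 T ×ˢ univ → (∀ p, 0 ≤ φ p) →
        0 ≤ (∫ p, (h p * fderiv ℝ φ p (1, 0) + fderiv ℝ φ p (0, q p) + S p * φ p)
          ∂(interiorMeasure T Ω)) + ∫ p, b p * φ p ∂(lateralMeasure T Ω) := by
  have hQ := hHQ.isC2_const k
  have hHk : ContDiff ℝ 2 fun z => H z k :=
    hHQ.contDiff_H.comp (contDiff_id.prodMk contDiff_const)
  have hH' : Continuous (deriv fun z => H z k) := hHk.continuous_deriv one_le_two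
  set D := cylinder T Ω with hD
  set L := fluxLipschitzConst T Ω f (supNorm T Ω u) with hL
  set h : ℝ × Vec N → ℝ := fun p => H (v p) k with hh
  set q := D.indicator fun p => Q p.1 p.2 (v p) k with hq
  set b : ℝ × Vec N → ℝ := fun p => L * H (w p) k with hb
  set η : ℝ × Vec N → ℝ := fun p => deriv (fun z => H z k) (v p) with hη
  set S₁ := D.indicator fun p => F p.1 p.2 (v p) with hS₁
  set S₂ := D.indicator fun p => divergence (fun x => f p.1 x (v p)) p.2 with hS₂
  set S₃ := D.indicator fun p => divergence (fun x => Q p.1 x (v p) k) p.2 with hS₃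
  have hhm : Measurable h := hHk.continuous.measurable.comp hv
  have hqm : Measurable q := measurable_indicator_superposition hQ hΩ hv
  have hbm : Measurable b := (hHk.continuous.measurable.comp hw).const_mul L
  have hηm : Measurable η := hH'.measurable.comp hv
  have hS₁m : Measurable S₁ := measurable_indicator_superposition hF hΩ hv
  have hS₂m : Measurable S₂ := measurable_indicator_divergence hf hΩ hv
  have hS₃m : Measurable S₃ := measurable_indicator_divergence hQ hΩ hv
  obtain ⟨Mh, hMh0, hMh⟩ := exists_bound_continuous_comp hHk.continuous hvA
  obtain ⟨Mw, hMw0, hMw⟩ := exists_bound_continuous_comp hHk.continuous hwB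
  obtain ⟨Mη, hMη0, hMη⟩ := exists_bound_continuous_comp hH' hvA
  obtain ⟨Mq, hMq0, hMq⟩ := exists_bound_indicator_superposition hQ hΩb hvA
  obtain ⟨M₁, hM₁0, hM₁⟩ := exists_bound_indicator_superposition hF hΩb hvA
  obtain ⟨M₂, hM₂0, hM₂⟩ := exists_bound_indicator_divergence hf hΩ hΩb hvA
  obtain ⟨M₃, hM₃0, hM₃⟩ := exists_bound_indicator_divergence hQ hΩ hΩb hvA
  have hMS : ∀ p, |η p * (S₁ p - S₂ p)| ≤ Mη * (M₁ + M₂) := fun p => by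
    rw [abs_mul]
    exact mul_le_mul (hMη p) ((abs_sub _ _).trans (add_le_add (hM₁ p) (hM₂ p))) (abs_nonneg _) hMη0
  have hp0 : 0 ≤ Mη * (M₁ + M₂) := by positivity
  have hp1 : 0 ≤ |L| * Mw := by positivity
  refine ⟨Mh + Mq + |L| * Mw + (Mη * (M₁ + M₂) + M₃), fun p => η p * (S₁ p - S₂ p) + S₃ p, hhm,
    (hηm.mul (hS₁m.sub hS₂m)).add hS₃m, hbm, hqm, fun p => (hMh p).trans (by linarith),
    fun p => ((abs_add_le _ _).trans (add_le_add (hMS p) (hM₃ p))).trans (by linarith),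
    fun p => ?_, fun p => (hMq p).trans (by linarith), ?_⟩
  · have : |b p| ≤ |L| * Mw := by
      rw [hb, abs_mul]
      exact mul_le_mul_of_nonneg_left (hMw p) (abs_nonneg _)
    linarith
  intro φ hφ hφc hφs hφ0
  have hfin := isFiniteMeasure_interiorMeasure (T := T) hΩb
  have hent := hu.entropy_ineq H Q hHQ k φ
    ⟨hφ, hφc, hφs.trans (Set.prod_mono Ioo_subset_Iio_self subset_rfl), hφ0⟩
  have hinit : ∀ x, φ (0, x) = 0 := fun x =>
    image_eq_zero_of_notMem_tsupport fun h0 => lt_irrefl _ (hφs h0).1.1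
  have hgrad : ∀ p : ℝ × Vec N, deriv (fun t => φ (t, p.2)) p.1 = fderiv ℝ φ p (1, 0) ∧
      ∀ y, inner ℝ y (gradient (fun x => φ (p.1, x)) p.2) = fderiv ℝ φ p (0, y) := by
    rintro ⟨t, x⟩
    have hd : HasFDerivAt φ (fderiv ℝ φ (t, x)) (t, x) :=
      (hφ.differentiable one_ne_zero _).hasFDerivAt
    refine ⟨?_, fun y => ?_⟩
    · exact (hd.comp_hasDerivAt t ((hasDerivAt_id t).prodMk (hasDerivAt_const t x))).deriv
    · have h1 : HasFDerivAt (fun x => φ (t, x)) _ x :=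
        HasFDerivAt.comp x (g := φ) hd ((hasFDerivAt_const t x).prodMk (hasFDerivAt_id x))
      rw [inner_gradient_right, h1.fderiv]
      simp
  obtain ⟨Cφ, hCφ0, hCφ⟩ := exists_bound_of_hasCompactSupport hφ.continuous hφc
  obtain ⟨Cd, hCd0, hCd⟩ := exists_bound_of_hasCompactSupport (hφ.continuous_fderiv one_ne_zero)
    (hφc.fderiv (𝕜 := ℝ))
  have hdφ : Measurable (fderiv ℝ φ) := (hφ.continuous_fderiv one_ne_zero).measurable
  have e1 : (∫ p, (H (u p.1 p.2) k * deriv (fun t => φ (t, p.2)) p.1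
      + inner ℝ (Q p.1 p.2 (u p.1 p.2) k) (gradient (fun x => φ (p.1, x)) p.2))
      ∂(interiorMeasure T Ω))
      = ∫ p, (h p * fderiv ℝ φ p (1, 0) + fderiv ℝ φ p (0, q p)) ∂(interiorMeasure T Ω) := by
    refine integral_congr_ae ?_
    filter_upwards [hvu, ae_mem_cylinder hΩ] with p hp hpD
    rw [hp, (hgrad p).1, (hgrad p).2, hq, indicator_of_mem hpD]
  have e2 : (∫ p, deriv (fun z => H z k) (u p.1 p.2)
      * (F p.1 p.2 (u p.1 p.2) - divergence (fun x => f p.1 x (u p.1 p.2)) p.2) * φ p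
      ∂(interiorMeasure T Ω)) = ∫ p, η p * (S₁ p - S₂ p) * φ p ∂(interiorMeasure T Ω) := by
    refine integral_congr_ae ?_
    filter_upwards [hvu, ae_mem_cylinder hΩ] with p hp hpD
    rw [hp, hS₁, hS₂, indicator_of_mem hpD, indicator_of_mem hpD]
  have e3 : (∫ p, divergence (fun x => Q p.1 x (u p.1 p.2) k) p.2 * φ p ∂(interiorMeasure T Ω))
      = ∫ p, S₃ p * φ p ∂(interiorMeasure T Ω) := by
    refine integral_congr_ae ?_
    filter_upwards [hvu, ae_mem_cylinder hΩ] with p hp hpD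
    rw [hp, hS₃, indicator_of_mem hpD]
  have e4 : L * (∫ p, H (u_b p.1 p.2) k * φ p ∂(lateralMeasure T Ω))
      = ∫ p, b p * φ p ∂(lateralMeasure T Ω) := by
    rw [← integral_const_mul]
    refine integral_congr_ae ?_
    filter_upwards [hwu] with p hp
    rw [hp, hb, mul_assoc]
  have i1 : Integrable (fun p => h p * fderiv ℝ φ p (1, 0) + fderiv ℝ φ p (0, q p))
      (interiorMeasure T Ω) := by
    refine Integrable.of_bound ((hhm.mul (Measurable.clm_apply_apply hdφ measurable_const)).add
      (Measurable.clm_apply_apply hdφ (measurable_const.prodMk hqm))).aestronglyMeasurable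
      (Mh * (Cd * 1) + Cd * Mq) (Eventually.of_forall fun p => ?_)
    refine (norm_add_le _ _).trans (add_le_add ?_ ?_)
    · rw [norm_mul]
      refine mul_le_mul (hMh p) ((ContinuousLinearMap.le_opNorm _ _).trans
        (mul_le_mul (hCd _) ?_ (norm_nonneg _) hCd0)) (norm_nonneg _) hMh0
      simp
    · refine (ContinuousLinearMap.le_opNorm _ _).trans
        (mul_le_mul (hCd _) ?_ (norm_nonneg _) hCd0)
      rw [Prod.norm_mk, norm_zero, max_eq_right (norm_nonneg _)]
      exact hMq p
  have i2 : Integrable (fun p => η p * (S₁ p - S₂ p) * φ p) (interiorMeasure T Ω) := by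
    refine Integrable.of_bound ((hηm.mul (hS₁m.sub hS₂m)).mul
      hφ.continuous.measurable).aestronglyMeasurable (Mη * (M₁ + M₂) * Cφ)
      (Eventually.of_forall fun p => ?_)
    rw [norm_mul]
    exact mul_le_mul (hMS p) (hCφ p) (norm_nonneg _) hp0
  have i3 : Integrable (fun p => S₃ p * φ p) (interiorMeasure T Ω) := by
    refine Integrable.of_bound (hS₃m.mul hφ.continuous.measurable).aestronglyMeasurable (M₃ * Cφ)
      (Eventually.of_forall fun p => ?_)
    rw [norm_mul]
    exact mul_le_mul (hM₃ p) (hCφ p) (norm_nonneg _) hM₃0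
  have e5 : (∫ p, (h p * fderiv ℝ φ p (1, 0) + fderiv ℝ φ p (0, q p)
      + (η p * (S₁ p - S₂ p) + S₃ p) * φ p) ∂(interiorMeasure T Ω))
      = (∫ p, (h p * fderiv ℝ φ p (1, 0) + fderiv ℝ φ p (0, q p)) ∂(interiorMeasure T Ω))
        + (∫ p, η p * (S₁ p - S₂ p) * φ p ∂(interiorMeasure T Ω))
        + ∫ p, S₃ p * φ p ∂(interiorMeasure T Ω) := by
    have i23 : Integrable (fun p => η p * (S₁ p - S₂ p) * φ p + S₃ p * φ p)
      (interiorMeasure T Ω) := i2.add i3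
    rw [add_assoc, ← integral_add i2 i3, ← integral_add i1 i23]
    simp only [add_mul]
  rw [e1, e2, e3, e4] at hent
  simp only [hinit, mul_zero, integral_zero, add_zero] at hent
  change 0 ≤ _ + ∫ p, b p * φ p ∂(lateralMeasure T Ω)
  rw [e5]
  exact hent

/-! ### From constant states to the boundary datum -/

/-- From test functions and constant states `k` to integrable weights and a variable state `w x`:
the coefficient may be evaluated at `s = 0`, since it is uniformly continuous in `s`, and `k` may be
replaced by the boundary datum `w x`, for which the term `G (w x) k` vanishes. -/
theorem essLimNonneg_integral_boundary_state {X : Type*} [NormedAddCommGroup X]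
    [NormedSpace ℝ X] [FiniteDimensional ℝ X] [MeasurableSpace X] [BorelSpace X] {lam : Measure X}
    [IsFiniteMeasure lam] {O : Set X} (hO : IsOpen O) (hlam : ∀ᵐ x ∂lam, x ∈ O)
    {r A B C D : ℝ} (hr : 0 < r) {a : X × ℝ × ℝ × ℝ → ℝ} (ha : Measurable a)
    (haC : ∀ p, |a p| ≤ C)
    (hunif : ∀ ε > 0, ∃ δ > 0, ∀ x ∈ O, ∀ s ∈ Icc 0 r, ∀ s' ∈ Icc 0 r, ∀ z ∈ Icc (-A) A,
      ∀ k ∈ Icc (-(B + 1)) (B + 1), ∀ k' ∈ Icc (-(B + 1)) (B + 1), |s - s'| ≤ δ → |k - k'| ≤ δ →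
        |a (x, s, z, k) - a (x, s', z, k')| ≤ ε)
    {v : ℝ → X → ℝ} (hv : ∀ s, Measurable (v s)) (hvA : ∀ s x, |v s x| ≤ A)
    {w : X → ℝ} (hw : Measurable w) (hwB : ∀ x, |w x| ≤ B)
    {G : ℝ → ℝ → ℝ} (hG : Continuous fun p : ℝ × ℝ => G p.1 p.2) (hGd : ∀ k, G k k = 0)
    {d : X → ℝ} (hd : Measurable d) (hdD : ∀ x, |d x| ≤ D)
    (h : ∀ k ∈ Icc (-(B + 1)) (B + 1), ∀ β : X → ℝ, ContDiff ℝ 1 β → HasCompactSupport β →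
      tsupport β ⊆ O →
      (∀ x, 0 ≤ β x) →
      EssLimNonneg (fun s => ∫ x, (a (x, s, v s x, k) + d x * G (w x) k) * β x ∂lam))
    {β : X → ℝ} (hβ : Integrable β lam) (hβ0 : ∀ᵐ x ∂lam, 0 ≤ β x) :
    EssLimNonneg (fun s => ∫ x, a (x, 0, v s x, w x) * β x ∂lam) := by
  have hD0 : 0 ≤ D := (abs_nonneg _).trans (hdD 0)
  have hGc : IsCompact (Icc (-B) B ×ˢ Icc (-(B + 1)) (B + 1)) := isCompact_Icc.prod isCompact_Icc
  obtain ⟨E, hE⟩ := hGc.exists_bound_of_continuousOn hG.continuousOn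
  have hGu := hGc.uniformContinuousOn_of_continuous hG.continuousOn
  have hmeas : ∀ s s', ∀ {κ : X → ℝ}, Measurable κ →
      Measurable fun x => a (x, s, v s' x, κ x) + d x * G (w x) (κ x) := fun s s' κ hκ =>
    (ha.comp (measurable_id.prodMk (measurable_const.prodMk ((hv s').prodMk hκ)))).add
      (hd.mul (hG.measurable.comp (hw.prodMk hκ)))
  have hbd : ∀ s s' x, ∀ k ∈ Icc (-(B + 1)) (B + 1),
      |a (x, s, v s' x, k) + d x * G (w x) k| ≤ C + D * E := by
    intro s s' x k hk
    refine (abs_add_le _ _).trans (add_le_add (haC _) ?_)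
    rw [abs_mul]
    exact mul_le_mul (hdD x) (hE (w x, k) ⟨abs_le.1 (hwB x), hk⟩) (abs_nonneg _) hD0
  have hs0 : (0 : ℝ) ∈ Icc 0 r := ⟨le_rfl, hr.le⟩
  have hconst : ∀ k ∈ Icc (-(B + 1)) (B + 1), ∀ β : X → ℝ, Integrable β lam →
      (∀ᵐ x ∂lam, 0 ≤ β x) →
      EssLimNonneg (fun s => ∫ x, (a (x, 0, v s x, k) + d x * G (w x) k) * β x ∂lam) := by
    intro k hk β hβ hβ0
    have h1 := essLimNonneg_integral_of_test hO hlam (a := fun s x =>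
      a (x, s, v s x, k) + d x * G (w x) k) (M := C + D * E) (Eventually.of_forall fun s =>
        ⟨(hmeas s s measurable_const).aestronglyMeasurable,
          Eventually.of_forall fun x => hbd s s x k hk⟩) (h k hk) hβ hβ0
    refine EssLimNonneg.of_approx fun ε hε => ⟨_, h1, ?_⟩
    set J := ∫ x, |β x| ∂lam with hJ
    have hJ0 : 0 ≤ J := integral_nonneg fun _ => abs_nonneg _
    obtain ⟨δ, hδ, hδu⟩ := hunif (ε / (J + 1)) (by positivity)
    refine eventually_essZero_of_forall (lt_min hr hδ) fun s hs => ?_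
    have hi : ∀ s', Integrable (fun x => (a (x, s', v s x, k) + d x * G (w x) k) * β x) lam :=
      fun s' => integrable_mul_of_bounded (hmeas s' s measurable_const).aestronglyMeasurable
        (Eventually.of_forall fun x => hbd s' s x k hk) hβ
    rw [← integral_sub (hi 0) (hi s), ← Real.norm_eq_abs]
    calc ‖∫ x, ((a (x, 0, v s x, k) + d x * G (w x) k) * β x
            - (a (x, s, v s x, k) + d x * G (w x) k) * β x) ∂lam‖
        ≤ ∫ x, ε / (J + 1) * |β x| ∂lam := by
          refine norm_integral_le_of_norm_le (hβ.abs.const_mul _) ?_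
          filter_upwards [hlam] with x hx
          rw [← sub_mul, norm_mul, Real.norm_eq_abs, Real.norm_eq_abs, add_sub_add_right_eq_sub]
          refine mul_le_mul_of_nonneg_right (hδu x hx 0 hs0 s
            ⟨hs.1.le, hs.2.le.trans (min_le_left _ _)⟩ _ (abs_le.1 (hvA s x)) k hk k hk ?_ ?_)
            (abs_nonneg _)
          · rw [zero_sub, abs_neg, abs_of_pos hs.1]
            exact hs.2.le.trans (min_le_right _ _)
          · simpa using hδ.le
      _ = ε / (J + 1) * J := integral_const_mul _ _
      _ ≤ ε := by
          rw [div_mul_eq_mul_div, div_le_iff₀ (by positivity)]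
          nlinarith
  have h2 := essLimNonneg_integral_of_const (lam := lam) hw hr hwB (M := C + D * E)
    (a := fun k s x => a (x, 0, v s x, k) + d x * G (w x) k)
    (fun k s _ => (hmeas 0 s measurable_const).aestronglyMeasurable)
    (fun s _ => Eventually.of_forall fun x k hk => hbd 0 s x k hk)
    (fun s _ => (hmeas 0 s hw).aestronglyMeasurable) ?_ hconst hβ hβ0
  · simpa only [hGd, mul_zero, add_zero] using h2
  · intro ε hε
    obtain ⟨δ, hδ, hδu⟩ := hunif (ε / 2) (half_pos hε)
    obtain ⟨δ', hδ', hδu'⟩ := Metric.uniformContinuousOn_iff_le.1 hGu (ε / (2 * (D + 1)))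
      (by positivity)
    refine ⟨min δ δ', lt_min hδ hδ', fun s hs => ?_⟩
    filter_upwards [hlam] with x hx k hk k' hk' hkk
    have h3 := hδu x hx 0 hs0 0 hs0 (v s x) (abs_le.1 (hvA s x)) k hk k' hk' (by simpa using hδ.le)
      (hkk.trans (min_le_left _ _))
    have h4 := hδu' (w x, k) ⟨abs_le.1 (hwB x), hk⟩ (w x, k') ⟨abs_le.1 (hwB x), hk'⟩ (by
      rw [Prod.dist_eq, dist_self, max_eq_right dist_nonneg, Real.dist_eq]
      exact hkk.trans (min_le_right _ _))
    rw [Real.dist_eq] at h4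
    have h5 : |d x * (G (w x) k - G (w x) k')| ≤ ε / 2 := by
      rw [abs_mul]
      calc |d x| * |G (w x) k - G (w x) k'| ≤ D * (ε / (2 * (D + 1))) :=
            mul_le_mul (hdD x) h4 (abs_nonneg _) hD0
        _ ≤ ε / 2 := by
            rw [mul_div_assoc', div_le_div_iff₀ (by positivity) (by positivity)]
            nlinarith
    calc |a (x, 0, v s x, k) + d x * G (w x) k - (a (x, 0, v s x, k') + d x * G (w x) k')|
        = |(a (x, 0, v s x, k) - a (x, 0, v s x, k')) + d x * (G (w x) k - G (w x) k')| := by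
          congr 1; ring
      _ ≤ ε / 2 + ε / 2 := (abs_add_le _ _).trans (add_le_add h3 h5)
      _ = ε := add_halves ε

/-! ### The trace inequality in a chart -/

theorem ae_lateralMeasure {N : ℕ} (T : ℝ) (Ω : Set (Vec N)) [IsFiniteMeasure (surfaceMeasure Ω)] :
    ∀ᵐ p ∂(lateralMeasure T Ω), p ∈ Ioo 0 T ×ˢ frontier Ω := by
  filter_upwards [Measure.quasiMeasurePreserving_fst.ae
    (ae_restrict_mem (μ := (volume : Measure ℝ)) measurableSet_Ioo),
    Measure.quasiMeasurePreserving_snd.ae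
      (ae_restrict_mem isClosed_frontier.measurableSet)] with p h1 h2 using ⟨h1, h2⟩

namespace NormalChart

variable {m : ℕ} {Ω : Set (Vec (m + 1))} (c : NormalChart Ω)

theorem E_mem_closure {z : Vec m × ℝ} (hz : z ∈ Metric.closedBall (0 : Vec m) c.r ×ˢ Icc 0 c.r) :
    c.E z ∈ closure Ω := by
  have h1 : z ∈ closure (Metric.ball (0 : Vec m) c.r ×ˢ Ioo 0 c.r) := by
    rw [closure_prod_eq, closure_ball _ c.r_pos.ne', closure_Ioo c.r_pos.ne]
    exact hz
  have h2 : ContinuousWithinAt c.E (Metric.ball (0 : Vec m) c.r ×ˢ Ioo 0 c.r) z :=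
    (c.contDiffOn_E.continuousOn z (c.box_subset (Set.prod_mono subset_rfl
      (Icc_subset_Icc_left (by linarith [c.r_pos])) hz))).mono
      (c.openHalfBox_subset_closedBox.trans c.box_subset)
  refine closure_mono ?_ (h2.mem_closure_image h1)
  rintro _ ⟨y, hy, rfl⟩
  exact (c.mem_iff y.1 hy.1 y.2 (c.openHalfBox_subset hy).2).2 hy.2.1

/-- The compact set of arguments `((t, y), s, z, k)` on which the fluxes are evaluated. -/
def argBox (T A B : ℝ) : Set ((ℝ × Vec m) × ℝ × ℝ × ℝ) :=
  (Icc 0 T ×ˢ Metric.closedBall 0 c.r) ×ˢ Icc 0 c.r ×ˢ Icc (-A) A ×ˢ Icc (-(B + 1)) (B + 1)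

theorem isCompact_argBox (T A B : ℝ) : IsCompact (c.argBox T A B) :=
  (isCompact_Icc.prod (isCompact_closedBall _ _)).prod
    (isCompact_Icc.prod (isCompact_Icc.prod isCompact_Icc))

/-- The outward flux of `Q(t, ·, z, k)` through the surface at normal distance `s` from the boundary,
as a density in the parameters `(t, y)`, extended by zero outside `argBox`. -/
noncomputable def outflux (Q : ℝ → Vec (m + 1) → ℝ → ℝ → Vec (m + 1)) (T A B : ℝ) :
    (ℝ × Vec m) × ℝ × ℝ × ℝ → ℝ :=
  (c.argBox T A B).indicator fun p =>
    -(fderiv ℝ c.I (c.E (p.1.2, p.2.1)) (Q p.1.1 (c.E (p.1.2, p.2.1)) p.2.2.1 p.2.2.2)).2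
      * c.jac (p.1.2, p.2.1)

variable {Q : ℝ → Vec (m + 1) → ℝ → ℝ → Vec (m + 1)} {T A B : ℝ}

theorem continuousOn_outflux
    (hQ : ContinuousOn (fun p : ℝ × Vec (m + 1) × ℝ × ℝ => Q p.1 p.2.1 p.2.2.1 p.2.2.2)
      (Icc 0 T ×ˢ closure Ω ×ˢ (univ : Set (ℝ × ℝ)))) :
    ContinuousOn (c.outflux Q T A B) (c.argBox T A B) := by
  have hz : ∀ p ∈ c.argBox T A B,
      (p.1.2, p.2.1) ∈ Metric.closedBall (0 : Vec m) c.r ×ˢ Icc 0 c.r :=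
    fun p hp => ⟨hp.1.2, hp.2.1⟩
  have hU : MapsTo (fun p : (ℝ × Vec m) × ℝ × ℝ × ℝ => (p.1.2, p.2.1)) (c.argBox T A B) c.U :=
    fun p hp => c.box_subset (Set.prod_mono subset_rfl
      (Icc_subset_Icc_left (by linarith [c.r_pos])) (hz p hp))
  have hzc : ContinuousOn (fun p : (ℝ × Vec m) × ℝ × ℝ × ℝ => (p.1.2, p.2.1))
      (c.argBox T A B) := by fun_prop
  have hE := c.contDiffOn_E.continuousOn.comp hzc hU
  have hQ' : ContinuousOn (fun p : (ℝ × Vec m) × ℝ × ℝ × ℝ =>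
      Q p.1.1 (c.E (p.1.2, p.2.1)) p.2.2.1 p.2.2.2) (c.argBox T A B) := by
    have h1 : ContinuousOn (fun p : (ℝ × Vec m) × ℝ × ℝ × ℝ => p.1.1) (c.argBox T A B) := by
      fun_prop
    have h2 : ContinuousOn (fun p : (ℝ × Vec m) × ℝ × ℝ × ℝ => p.2.2) (c.argBox T A B) := by
      fun_prop
    exact hQ.comp (h1.prodMk (hE.prodMk h2)) fun p hp =>
      ⟨hp.1.1, c.E_mem_closure (hz p hp), mem_univ _⟩
  refine ContinuousOn.congr ?_ fun p hp => indicator_of_mem hp _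
  exact (((c.continuousOn_fderiv_I.comp hzc hU).clm_apply hQ').snd.neg).mul
    (c.continuousOn_jac.comp hzc hU)

theorem measurable_outflux
    (hQ : ContinuousOn (fun p : ℝ × Vec (m + 1) × ℝ × ℝ => Q p.1 p.2.1 p.2.2.1 p.2.2.2)
      (Icc 0 T ×ˢ closure Ω ×ˢ (univ : Set (ℝ × ℝ)))) :
    Measurable (c.outflux Q T A B) := by
  classical
  have h1 : c.outflux Q T A B = (c.argBox T A B).indicator (c.outflux Q T A B) := by
    rw [outflux, indicator_indicator, inter_self]
  rw [h1, ← piecewise_eq_indicator]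
  exact (c.continuousOn_outflux hQ).measurable_piecewise continuousOn_const
    (c.isCompact_argBox T A B).isClosed.measurableSet

theorem exists_bound_outflux
    (hQ : ContinuousOn (fun p : ℝ × Vec (m + 1) × ℝ × ℝ => Q p.1 p.2.1 p.2.2.1 p.2.2.2)
      (Icc 0 T ×ˢ closure Ω ×ˢ (univ : Set (ℝ × ℝ)))) :
    ∃ C, ∀ p, |c.outflux Q T A B p| ≤ C := by
  obtain ⟨C, hC⟩ := (c.isCompact_argBox T A B).exists_bound_of_continuousOn
    (c.continuousOn_outflux hQ)
  refine ⟨max C 0, fun p => ?_⟩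
  by_cases hp : p ∈ c.argBox T A B
  · exact (hC p hp).trans (le_max_left _ _)
  · rw [outflux, indicator_of_notMem hp, abs_zero]
    exact le_max_right _ _

theorem outflux_uniform
    (hQ : ContinuousOn (fun p : ℝ × Vec (m + 1) × ℝ × ℝ => Q p.1 p.2.1 p.2.2.1 p.2.2.2)
      (Icc 0 T ×ˢ closure Ω ×ˢ (univ : Set (ℝ × ℝ)))) {ε : ℝ} (hε : 0 < ε) :
    ∃ δ > 0, ∀ x ∈ Ioo 0 T ×ˢ Metric.ball (0 : Vec m) c.r, ∀ s ∈ Icc 0 c.r, ∀ s' ∈ Icc 0 c.r,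
      ∀ z ∈ Icc (-A) A, ∀ k ∈ Icc (-(B + 1)) (B + 1), ∀ k' ∈ Icc (-(B + 1)) (B + 1),
        |s - s'| ≤ δ → |k - k'| ≤ δ →
        |c.outflux Q T A B (x, s, z, k) - c.outflux Q T A B (x, s', z, k')| ≤ ε := by
  obtain ⟨δ, hδ, h⟩ := Metric.uniformContinuousOn_iff_le.1
    ((c.isCompact_argBox T A B).uniformContinuousOn_of_continuous (c.continuousOn_outflux hQ)) ε hε
  refine ⟨δ, hδ, fun x hx s hs s' hs' z hz k hk k' hk' hss hkk => ?_⟩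
  have hx' : x ∈ Icc 0 T ×ˢ Metric.closedBall (0 : Vec m) c.r :=
    Set.prod_mono Ioo_subset_Icc_self Metric.ball_subset_closedBall hx
  refine h (x, s, z, k) ⟨hx', hs, hz, hk⟩ (x, s', z, k') ⟨hx', hs', hz, hk'⟩ ?_
  simp only [Prod.dist_eq, dist_self, Real.dist_eq]
  refine max_le hδ.le (max_le hss (max_le hδ.le hkk))

/-- On the boundary the flux through the parallel surfaces is the normal component. -/
theorem outflux_zero {t : ℝ} (ht : t ∈ Ioo 0 T) {y : Vec m} (hy : y ∈ Metric.ball (0 : Vec m) c.r)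
    {z k : ℝ} (hz : |z| ≤ A) (hk : |k| ≤ B) :
    c.outflux Q T A B ((t, y), 0, z, k)
      = inner ℝ (Q t (c.E (y, 0)) z k) (exteriorNormal Ω (c.E (y, 0))) * c.jac (y, 0) := by
  have hmem : ((t, y), (0 : ℝ), z, k) ∈ c.argBox T A B :=
    ⟨⟨Ioo_subset_Icc_self ht, Metric.ball_subset_closedBall hy⟩, ⟨le_rfl, c.r_pos.le⟩,
      abs_le.1 hz, abs_le.1 (hk.trans (by linarith))⟩
  rw [outflux, indicator_of_mem hmem, c.fderiv_I y hy, neg_neg]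

theorem jac_zero_pos {y : Vec m} (hy : y ∈ Metric.ball (0 : Vec m) c.r) : 0 < c.jac (y, 0) := by
  have h1 : (y, (0 : ℝ)) ∈ Metric.ball (0 : Vec m) c.r ×ˢ Ioo (-c.r) c.r := ⟨hy, c.zero_mem_Ioo⟩
  exact c.jac_pos (c.openBox_subset h1)

/-- The first chart coordinate, as a measurable function on the whole space. -/
noncomputable def foot (x : Vec (m + 1)) : Vec m := (c.tube.indicator c.I x).1

theorem measurable_foot : Measurable c.foot := by
  classical
  have h1 : Measurable (c.tube.indicator c.I) := by
    rw [← piecewise_eq_indicator]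
    exact (c.contDiffOn_I.continuousOn.mono (image_mono c.openBox_subset)).measurable_piecewise
      continuousOn_const c.isOpen_tube.measurableSet
  exact h1.fst

theorem foot_E {y : Vec m} (hy : y ∈ Metric.ball (0 : Vec m) c.r) : c.foot (c.E (y, 0)) = y := by
  have h1 : (y, (0 : ℝ)) ∈ Metric.ball (0 : Vec m) c.r ×ˢ Ioo (-c.r) c.r := ⟨hy, c.zero_mem_Ioo⟩
  rw [foot, indicator_of_mem (show c.E (y, 0) ∈ c.tube from ⟨_, h1, rfl⟩),
    c.left_inv _ (c.openBox_subset h1)]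

theorem sub_smul_normal {x : Vec (m + 1)} (hx : x ∈ c.patch) {s : ℝ} (hs : s ∈ Ioo 0 c.r) :
    x - s • exteriorNormal Ω x = c.E (c.foot x, s) := by
  obtain ⟨y, hy, rfl⟩ := c.exists_of_mem_patch hx
  rw [c.foot_E hy, c.E_eq y hy s ⟨by linarith [hs.1, c.r_pos], hs.2⟩]

theorem ae_restrict_patch [IsFiniteMeasure (surfaceMeasure Ω)] :
    ∀ᵐ p ∂((lateralMeasure T Ω).restrict (univ ×ˢ c.patch)), p ∈ Ioo 0 T ×ˢ c.patch := by
  filter_upwards [ae_restrict_of_ae (ae_lateralMeasure T Ω),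
    ae_restrict_mem (MeasurableSet.univ.prod c.measurableSet_patch)] with p h1 h2
    using ⟨h1.1, h2.2⟩

theorem integrableOn_patch_iff [IsFiniteMeasure (surfaceMeasure Ω)] {g : ℝ × Vec (m + 1) → ℝ}
    (hg : Measurable g) : IntegrableOn g (univ ×ˢ c.patch) (lateralMeasure T Ω)
      ↔ Integrable (fun x => c.dens x.2 * g (x.1, c.E (x.2, 0))) (paramMeasure m T c.r) := by
  have hd : Measurable fun x : ℝ × Vec m => c.dens x.2 := c.measurable_dens.comp measurable_snd
  rw [IntegrableOn, c.lateral_restrict_eq T, integrable_map_measure hg.aestronglyMeasurable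
    c.measurable_lateralParam.aemeasurable, integrable_withDensity_iff_integrable_smul hd]
  rfl

variable {v w β : ℝ × Vec (m + 1) → ℝ}

/-- The boundary integrand in terms of the chart, as a measurable function. -/
noncomputable def chartIntegrand (Q : ℝ → Vec (m + 1) → ℝ → ℝ → Vec (m + 1)) (T A B : ℝ)
    (v w β : ℝ × Vec (m + 1) → ℝ) (s : ℝ) (p : ℝ × Vec (m + 1)) : ℝ :=
  c.outflux Q T A B ((p.1, c.foot p.2), 0, v (p.1, c.E (c.foot p.2, s)), w p)
    * ((c.jac (c.foot p.2, 0))⁻¹ * β p)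

theorem measurable_chartIntegrand
    (hQ : ContinuousOn (fun p : ℝ × Vec (m + 1) × ℝ × ℝ => Q p.1 p.2.1 p.2.2.1 p.2.2.2)
      (Icc 0 T ×ˢ closure Ω ×ˢ (univ : Set (ℝ × ℝ))))
    (hv : Measurable v) (hw : Measurable w) (hβ : Measurable β) (s : ℝ) :
    Measurable (c.chartIntegrand Q T A B v w β s) := by
  have hf : Measurable fun p : ℝ × Vec (m + 1) => c.foot p.2 :=
    c.measurable_foot.comp measurable_snd
  refine ((c.measurable_outflux hQ).comp ((measurable_fst.prodMk hf).prodMk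
    (measurable_const.prodMk (Measurable.prodMk ?_ hw)))).mul
    ((c.measurable_jac.comp (hf.prodMk measurable_const)).inv.mul hβ)
  exact hv.comp (measurable_fst.prodMk (c.measurable_E.comp (hf.prodMk measurable_const)))

theorem boundaryIntegrand_eq_chartIntegrand [IsFiniteMeasure (surfaceMeasure Ω)]
    (hvA : ∀ p, |v p| ≤ A) (hwB : ∀ p, |w p| ≤ B) {s : ℝ} (hs : s ∈ Ioo 0 c.r) :
    boundaryIntegrand Ω Q (fun t x => v (t, x)) (fun t x => w (t, x)) (fun t x => β (t, x)) s
      =ᵐ[(lateralMeasure T Ω).restrict (univ ×ˢ c.patch)] c.chartIntegrand Q T A B v w β s := by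
  filter_upwards [c.ae_restrict_patch] with p hp
  rw [boundaryIntegrand, chartIntegrand, c.sub_smul_normal hp.2 hs]
  obtain ⟨t, x⟩ := p
  obtain ⟨y, hy, rfl⟩ := c.exists_of_mem_patch hp.2
  have hJ := (c.jac_zero_pos hy).ne'
  simp only [c.foot_E hy]
  rw [c.outflux_zero hp.1 hy (hvA _) (hwB _), mul_assoc, mul_inv_cancel_left₀ hJ]

/-- The weight on the parameter domain that corresponds to the weight `β` on the boundary. -/
noncomputable def chartWeight (β : ℝ × Vec (m + 1) → ℝ) (x : ℝ × Vec m) : ℝ :=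
  (c.jac (x.2, 0))⁻¹ * (c.dens x.2 * β (x.1, c.E (x.2, 0)))

theorem integrable_chartWeight [IsFiniteMeasure (surfaceMeasure Ω)] (hβm : Measurable β)
    (hβ : IntegrableOn β (univ ×ˢ c.patch) (lateralMeasure T Ω)) :
    Integrable (c.chartWeight β) (paramMeasure m T c.r) := by
  have h1 : ContinuousOn (fun y : Vec m => (c.jac (y, 0))⁻¹) (Metric.closedBall 0 c.r) := by
    have hmem : MapsTo (fun y : Vec m => (y, (0 : ℝ))) (Metric.closedBall 0 c.r) c.U :=
      fun y hy => c.box_subset ⟨hy, Ioo_subset_Icc_self c.zero_mem_Ioo⟩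
    exact (c.continuousOn_jac.comp (by fun_prop) hmem).inv₀ fun y hy => (c.jac_pos (hmem hy)).ne'
  obtain ⟨C, hC⟩ := (isCompact_closedBall _ _).exists_bound_of_continuousOn h1
  refine ((c.integrableOn_patch_iff hβm).1 hβ).bdd_mul (c := C)
    (c.measurable_jac.comp (measurable_snd.prodMk measurable_const)).inv.aestronglyMeasurable ?_
  filter_upwards [ae_paramMeasure T c.r] with x hx
  exact hC x.2 (Metric.ball_subset_closedBall hx.2)

theorem dens_mul_chartIntegrand {s : ℝ} {x : ℝ × Vec m}
    (hx : x ∈ Ioo 0 T ×ˢ Metric.ball (0 : Vec m) c.r) :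
    c.dens x.2 * c.chartIntegrand Q T A B v w β s (x.1, c.E (x.2, 0))
      = c.outflux Q T A B (x, 0, v (x.1, c.E (x.2, s)), w (x.1, c.E (x.2, 0)))
        * c.chartWeight β x := by
  simp only [chartIntegrand, chartWeight, c.foot_E hx.2]
  ring

variable [IsFiniteMeasure (surfaceMeasure Ω)]

theorem integrableOn_patch_boundaryIntegrand
    (hQ : ContinuousOn (fun p : ℝ × Vec (m + 1) × ℝ × ℝ => Q p.1 p.2.1 p.2.2.1 p.2.2.2)
      (Icc 0 T ×ˢ closure Ω ×ˢ (univ : Set (ℝ × ℝ))))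
    (hv : Measurable v) (hw : Measurable w) (hβm : Measurable β) (hvA : ∀ p, |v p| ≤ A)
    (hwB : ∀ p, |w p| ≤ B) (hβ : IntegrableOn β (univ ×ˢ c.patch) (lateralMeasure T Ω)) {s : ℝ}
    (hs : s ∈ Ioo 0 c.r) :
    IntegrableOn (boundaryIntegrand Ω Q (fun t x => v (t, x)) (fun t x => w (t, x))
      (fun t x => β (t, x)) s) (univ ×ˢ c.patch) (lateralMeasure T Ω) := by
  refine (integrable_congr (c.boundaryIntegrand_eq_chartIntegrand hvA hwB hs)).2 ?_
  refine (c.integrableOn_patch_iff (c.measurable_chartIntegrand hQ hv hw hβm s)).2 ?_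
  obtain ⟨C, hC⟩ := c.exists_bound_outflux (A := A) (B := B) hQ
  have hm : Measurable fun x : ℝ × Vec m =>
      c.outflux Q T A B (x, 0, v (x.1, c.E (x.2, s)), w (x.1, c.E (x.2, 0))) :=
    (c.measurable_outflux hQ).comp (measurable_id.prodMk (measurable_const.prodMk
      ((hv.comp (measurable_fst.prodMk (c.measurable_E.comp
        (measurable_snd.prodMk measurable_const)))).prodMk (hw.comp c.measurable_lateralParam))))
  refine (integrable_mul_of_bounded hm.aestronglyMeasurable
    (Eventually.of_forall fun x => hC _) (c.integrable_chartWeight hβm hβ)).congr ?_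
  filter_upwards [ae_paramMeasure T c.r] with x hx
  exact (c.dens_mul_chartIntegrand hx).symm

theorem setIntegral_patch_boundaryIntegrand
    (hQ : ContinuousOn (fun p : ℝ × Vec (m + 1) × ℝ × ℝ => Q p.1 p.2.1 p.2.2.1 p.2.2.2)
      (Icc 0 T ×ˢ closure Ω ×ˢ (univ : Set (ℝ × ℝ))))
    (hv : Measurable v) (hw : Measurable w) (hβm : Measurable β) (hvA : ∀ p, |v p| ≤ A)
    (hwB : ∀ p, |w p| ≤ B) {s : ℝ} (hs : s ∈ Ioo 0 c.r) :
    ∫ p in univ ×ˢ c.patch, boundaryIntegrand Ω Q (fun t x => v (t, x)) (fun t x => w (t, x))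
      (fun t x => β (t, x)) s p ∂(lateralMeasure T Ω)
      = ∫ x, c.outflux Q T A B (x, 0, v (x.1, c.E (x.2, s)), w (x.1, c.E (x.2, 0)))
        * c.chartWeight β x ∂(paramMeasure m T c.r) := by
  rw [integral_congr_ae (c.boundaryIntegrand_eq_chartIntegrand hvA hwB hs),
    c.setIntegral_lateral (c.measurable_chartIntegrand hQ hv hw hβm s).aestronglyMeasurable]
  refine integral_congr_ae ?_
  filter_upwards [ae_paramMeasure T c.r] with x hx
  exact c.dens_mul_chartIntegrand hx

/-- The boundary trace inequality on the part of the boundary described by one chart. -/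
theorem essLimNonneg_patch (hΩ : IsOpen Ω) (hΩb : Bornology.IsBounded Ω)
    {f : ℝ → Vec (m + 1) → ℝ → Vec (m + 1)} {F : ℝ → Vec (m + 1) → ℝ → ℝ} {u₀ : Vec (m + 1) → ℝ}
    {u u_b : ℝ → Vec (m + 1) → ℝ} (hf : IsC2 T Ω f) (hF : IsC2 T Ω F)
    (hu : IsRESolution T Ω f F u₀ u_b u) {H : ℝ → ℝ → ℝ}
    (hHQ : IsBoundaryEntropyPair T Ω f H Q) (hv : Measurable v)
    (hw : Measurable w) (hvu : ∀ᵐ p ∂(interiorMeasure T Ω), u p.1 p.2 = v p)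
    (hwu : ∀ᵐ p ∂(lateralMeasure T Ω), u_b p.1 p.2 = w p) (hvA : ∀ p, |v p| ≤ A)
    (hwB : ∀ p, |w p| ≤ B) (hβm : Measurable β)
    (hβ : IntegrableOn β (univ ×ˢ c.patch) (lateralMeasure T Ω)) (hβ0 : ∀ p, 0 ≤ β p) :
    EssLimNonneg fun s => ∫ p in univ ×ˢ c.patch, boundaryIntegrand Ω Q (fun t x => v (t, x))
      (fun t x => w (t, x)) (fun t x => β (t, x)) s p ∂(lateralMeasure T Ω) := by
  have hQ := hHQ.contDiffOn_Q.continuousOn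
  obtain ⟨C, hC⟩ := c.exists_bound_outflux (A := A) (B := B) hQ
  have hchart : EssLimNonneg fun s => ∫ x, c.outflux Q T A B
      (x, 0, v (x.1, c.E (x.2, s)), w (x.1, c.E (x.2, 0))) * c.chartWeight β x
      ∂(paramMeasure m T c.r) := by
    refine essLimNonneg_integral_boundary_state
      (isOpen_Ioo.prod Metric.isOpen_ball) (ae_paramMeasure T c.r) (A := A) (B := B) c.r_pos
      (c.measurable_outflux hQ) hC
      (fun ε hε => c.outflux_uniform hQ hε)
      (v := fun s x => v (x.1, c.E (x.2, s)))
      (fun s => hv.comp (measurable_fst.prodMk (c.measurable_E.comp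
          (measurable_snd.prodMk measurable_const)))) (fun s x => hvA _)
      (w := fun x => w (x.1, c.E (x.2, 0))) (hw.comp c.measurable_lateralParam) (fun x => hwB _)
      (G := fun z k => fluxLipschitzConst T Ω f (supNorm T Ω u) * H z k)
      (hHQ.contDiff_H.continuous.const_mul _) (fun k => by rw [hHQ.H_diag, mul_zero])
      (d := fun x => c.dens x.2) (c.measurable_dens.comp measurable_snd).coe_nnreal_real
      (D := c.densBound) (fun x => by rw [NNReal.abs_eq]; exact c.dens_le _) ?_
      (c.integrable_chartWeight hβm hβ) ?_
    · intro k hk η hη hηc hηs hη0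
      obtain ⟨M, S, h1, h2, h3, h4, h5, h6, h7, h8, h9⟩ :=
        hu.exists_weak_ineq hΩ hΩb hf hF hHQ hv hw hvu hwu hvA hwB k
      refine (c.essLimNonneg_flux h1 h2 h3 h4 h5 h6 h7 h8 h9 hη hηc hηs hη0).congr
        (eventually_essZero_of_forall c.r_pos fun s hs => integral_congr_ae ?_)
      filter_upwards [ae_paramMeasure T c.r] with x hx
      have hmem : (x, s, v (x.1, c.E (x.2, s)), k) ∈ c.argBox T A B :=
        ⟨⟨Ioo_subset_Icc_self hx.1, Metric.ball_subset_closedBall hx.2⟩, Ioo_subset_Icc_self hs,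
          abs_le.1 (hvA _), hk⟩
      have hcyl : (x.1, c.E (x.2, s)) ∈ cylinder T Ω :=
        ⟨hx.1, (c.mem_iff x.2 hx.2 s ⟨by linarith [hs.1, c.r_pos], hs.2⟩).2 hs.1⟩
      rw [flux, indicator_of_mem hcyl, outflux, indicator_of_mem hmem, neg_mul]
    · filter_upwards [ae_paramMeasure T c.r] with x hx
      exact mul_nonneg (inv_nonneg.2 (c.jac_zero_pos hx.2).le)
        (mul_nonneg NNReal.zero_le_coe (hβ0 _))
  exact hchart.congr (eventually_essZero_of_forall c.r_pos fun s hs =>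
    (c.setIntegral_patch_boundaryIntegrand hQ hv hw hβm hvA hwB hs).symm)

/-- Replacing the solution by a version of it does not change its values on almost every surface
parallel to the boundary. -/
theorem ae_ae_patch_eq {u : ℝ → Vec (m + 1) → ℝ}
    (hvu : ∀ᵐ p ∂(interiorMeasure T Ω), u p.1 p.2 = v p) :
    ∀ᶠ s in essZero, ∀ᵐ p ∂((lateralMeasure T Ω).restrict (univ ×ˢ c.patch)),
      u p.1 (p.2 - s • exteriorNormal Ω p.2) = v (p.1, p.2 - s • exteriorNormal Ω p.2) := by
  obtain ⟨Z, hZ, hZm, hZ0⟩ := exists_measurable_superset_of_null (ae_iff.1 hvu)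
  have h1 : ∀ᵐ p ∂(interiorMeasure T Ω), p ∉ Z := measure_eq_zero_iff_ae_notMem.1 hZ0
  have h2 : ∀ᶠ s in essZero, s ∈ Ioo 0 c.r :=
    eventually_essZero_of_forall c.r_pos fun s hs => hs
  filter_upwards [eventually_essZero_of_ae c.r_pos (c.ae_ae_of_ae_interior h1), h2] with s hs hsr
  have hm : Measurable fun p : ℝ × Vec (m + 1) => (p.1, c.E (c.foot p.2, s)) :=
    measurable_fst.prodMk (c.measurable_E.comp
      ((c.measurable_foot.comp measurable_snd).prodMk measurable_const))
  have h3 : ∀ᵐ p ∂((lateralMeasure T Ω).restrict (univ ×ˢ c.patch)),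
      (p.1, c.E (c.foot p.2, s)) ∉ Z := by
    refine c.ae_lateral_of_ae_param (hm hZm).compl ?_
    filter_upwards [hs, ae_paramMeasure T c.r] with x hx hxm
    rwa [c.foot_E hxm.2]
  filter_upwards [h3, c.ae_restrict_patch] with p hp hpp
  rw [c.sub_smul_normal hpp.2 hsr]
  by_contra hne
  exact hp (hZ hne)

end NormalChart

/-! ### Covering the boundary by charts -/

/-- An essentially bounded function has a measurable version that is bounded everywhere. -/
theorem exists_measurable_bounded_version {X : Type*} [MeasurableSpace X] {μ : Measure X}
    {g : X → ℝ} (hg : MemLp g ⊤ μ) :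
    ∃ (v : X → ℝ) (A : ℝ), Measurable v ∧ (∀ p, |v p| ≤ A) ∧ ∀ᵐ p ∂μ, g p = v p := by
  have hgm := hg.1.aemeasurable
  set A := (eLpNorm g ⊤ μ).toReal with hA
  have hA0 : 0 ≤ A := ENNReal.toReal_nonneg
  refine ⟨fun p => max (-A) (min A (hgm.mk g p)), A,
    measurable_const.max (measurable_const.min hgm.measurable_mk), fun p => abs_le.2
    ⟨le_max_left _ _, max_le (by linarith) (min_le_left _ _)⟩, ?_⟩
  filter_upwards [hgm.ae_eq_mk, ae_le_eLpNormEssSup (f := g) (μ := μ)] with p hp hpA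
  have h1 : |g p| ≤ A := by
    rw [← eLpNorm_exponent_top] at hpA
    have h2 := ENNReal.toReal_mono hg.2.ne hpA
    simpa [hA] using h2
  rw [← hp, min_eq_right (abs_le.1 h1).2, max_eq_right (abs_le.1 h1).1]

section Cover

variable {m : ℕ} {Ω : Set (Vec (m + 1))}

theorem exists_finite_charts (hΩ : IsOpen Ω) (hΩb : Bornology.IsBounded Ω)
    (hsm : HasSmoothBoundary Ω) :
    ∃ t : Set (NormalChart Ω), t.Finite ∧ frontier Ω ⊆ ⋃ c ∈ t, c.patch := by
  have hK : IsCompact (frontier Ω) :=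
    hΩb.isCompact_closure.of_isClosed_subset isClosed_frontier frontier_subset_closure
  choose c hc using fun ξ : frontier Ω => exists_normalChart hΩ hsm ξ.2
  obtain ⟨t, ht⟩ := hK.elim_finite_subcover (fun ξ : frontier Ω => (c ξ).tube)
    (fun ξ => (c ξ).isOpen_tube) fun ξ hξ => mem_iUnion.2 ⟨⟨ξ, hξ⟩, (0, 0),
      ⟨Metric.mem_ball_self (c ⟨ξ, hξ⟩).r_pos, (c ⟨ξ, hξ⟩).zero_mem_Ioo⟩, hc ⟨ξ, hξ⟩⟩
  refine ⟨c '' t, t.finite_toSet.image c, fun ξ hξ => ?_⟩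
  obtain ⟨i, hi, hξi⟩ := mem_iUnion₂.1 (ht hξ)
  exact mem_iUnion₂.2 ⟨c i, mem_image_of_mem c hi, hξi, hξ⟩

theorem isFiniteMeasure_surfaceMeasure (hΩ : IsOpen Ω) (hΩb : Bornology.IsBounded Ω)
    (hsm : HasSmoothBoundary Ω) : IsFiniteMeasure (surfaceMeasure Ω) := by
  obtain ⟨t, ht, hcov⟩ := exists_finite_charts hΩ hΩb hsm
  refine ⟨?_⟩
  have h1 : surfaceMeasure Ω univ = surfaceMeasure Ω (frontier Ω) := by
    rw [surfaceMeasure, Measure.restrict_apply_univ, Measure.restrict_apply_self]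
  rw [h1]
  refine (measure_mono hcov).trans_lt ?_
  exact measure_biUnion_lt_top ht fun c _ => c.surfaceMeasure_patch_lt_top

/-- A measurable partition of unity subordinate to the boundary patches of the charts in `t`: the
indicators of the patches divided by their sum. Off all patches the value is `0 / 0 = 0`. -/
noncomputable def patchWeight (t : Finset (NormalChart Ω)) (c : NormalChart Ω)
    (x : Vec (m + 1)) : ℝ :=
  c.patch.indicator 1 x / ∑ c' ∈ t, c'.patch.indicator 1 x

theorem measurable_patchWeight (t : Finset (NormalChart Ω)) (c : NormalChart Ω) :
    Measurable (patchWeight t c) :=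
  (measurable_one.indicator c.measurableSet_patch).div
    (Finset.measurable_sum _ fun c' _ => measurable_one.indicator c'.measurableSet_patch)

theorem patchWeight_nonneg (t : Finset (NormalChart Ω)) (c : NormalChart Ω) (x : Vec (m + 1)) :
    0 ≤ patchWeight t c x :=
  div_nonneg (indicator_nonneg (fun _ _ => zero_le_one) _)
    (Finset.sum_nonneg fun _ _ => indicator_nonneg (fun _ _ => zero_le_one) _)

theorem patchWeight_le_one {t : Finset (NormalChart Ω)} {c : NormalChart Ω} (hc : c ∈ t)
    (x : Vec (m + 1)) : patchWeight t c x ≤ 1 :=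
  div_le_one_of_le₀ (Finset.single_le_sum (f := fun c' : NormalChart Ω => c'.patch.indicator 1 x)
    (fun _ _ => indicator_nonneg (fun _ _ => zero_le_one) _) hc)
    (Finset.sum_nonneg fun _ _ => indicator_nonneg (fun _ _ => zero_le_one) _)

theorem patchWeight_of_notMem {t : Finset (NormalChart Ω)} {c : NormalChart Ω} {x : Vec (m + 1)}
    (hx : x ∉ c.patch) : patchWeight t c x = 0 := by
  rw [patchWeight, indicator_of_notMem hx, zero_div]

theorem sum_patchWeight {t : Finset (NormalChart Ω)} {c : NormalChart Ω} (hc : c ∈ t)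
    {x : Vec (m + 1)} (hx : x ∈ c.patch) : ∑ c' ∈ t, patchWeight t c' x = 1 := by
  have h1 : (1 : ℝ) ≤ ∑ c' ∈ t, c'.patch.indicator 1 x := by
    refine le_trans ?_ (Finset.single_le_sum
      (f := fun c' : NormalChart Ω => c'.patch.indicator (1 : Vec (m + 1) → ℝ) x)
      (fun _ _ => indicator_nonneg (fun _ _ => zero_le_one) _) hc)
    simp [indicator_of_mem hx]
  simp only [patchWeight]
  rw [← Finset.sum_div, div_self (by linarith)]

/-- The trace inequality on the whole boundary, with essential limits along the filter `essZero`. -/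
theorem boundary_trace (hΩ : IsOpen Ω) (hΩb : Bornology.IsBounded Ω) (hsm : HasSmoothBoundary Ω)
    {T : ℝ} {f : ℝ → Vec (m + 1) → ℝ → Vec (m + 1)} {F : ℝ → Vec (m + 1) → ℝ → ℝ}
    {u₀ : Vec (m + 1) → ℝ} {u u_b β : ℝ → Vec (m + 1) → ℝ} (hf : IsC2 T Ω f) (hF : IsC2 T Ω F)
    (hu_b : MemLp (fun p : ℝ × Vec (m + 1) => u_b p.1 p.2) ⊤ (lateralMeasure T Ω))
    (hu : IsRESolution T Ω f F u₀ u_b u) {H : ℝ → ℝ → ℝ}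
    {Q : ℝ → Vec (m + 1) → ℝ → ℝ → Vec (m + 1)} (hHQ : IsBoundaryEntropyPair T Ω f H Q)
    (hβ : Integrable (fun p : ℝ × Vec (m + 1) => β p.1 p.2) (lateralMeasure T Ω))
    (hβ0 : ∀ᵐ p ∂(lateralMeasure T Ω), 0 ≤ β p.1 p.2) :
    (∀ᶠ s in essZero, Integrable (boundaryIntegrand Ω Q u u_b β s) (lateralMeasure T Ω)) ∧
      EssLimNonneg fun s => ∫ p, boundaryIntegrand Ω Q u u_b β s p ∂(lateralMeasure T Ω) := by
  have hfin := isFiniteMeasure_surfaceMeasure hΩ hΩb hsm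
  obtain ⟨t₀, ht₀, hcov⟩ := exists_finite_charts hΩ hΩb hsm
  lift t₀ to Finset (NormalChart Ω) using ht₀ with t
  have hQ := hHQ.contDiffOn_Q.continuousOn
  obtain ⟨v, A, hv, hvA, hvu⟩ := exists_measurable_bounded_version hu.memLp
  obtain ⟨w, B, hw, hwB, hwu⟩ := exists_measurable_bounded_version hu_b
  obtain ⟨b, hbm, hb0, hbβ⟩ : ∃ b : ℝ × Vec (m + 1) → ℝ, Measurable b ∧ (∀ p, 0 ≤ b p) ∧
      ∀ᵐ p ∂(lateralMeasure T Ω), β p.1 p.2 = b p := by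
    have hm := hβ.1.aemeasurable
    refine ⟨fun p => max 0 (hm.mk _ p), measurable_const.max hm.measurable_mk,
      fun p => le_max_left _ _, ?_⟩
    filter_upwards [hm.ae_eq_mk, hβ0] with p hp hp0
    rw [← hp, max_eq_right hp0]
  have hbi : Integrable b (lateralMeasure T Ω) := hβ.congr hbβ
  -- The patches overlap, so the weight is distributed over them by a partition of unity.
  set bw : NormalChart Ω → ℝ × Vec (m + 1) → ℝ := fun c p => patchWeight t c p.2 * b p with hbw
  have hbwm : ∀ c, Measurable (bw c) := fun c =>
    ((measurable_patchWeight t c).comp measurable_snd).mul hbm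
  have hbw0 : ∀ c p, 0 ≤ bw c p := fun c p => mul_nonneg (patchWeight_nonneg t c _) (hb0 p)
  have hbwi : ∀ c ∈ t, Integrable (bw c) (lateralMeasure T Ω) := fun c hc =>
    hbi.bdd_mul (c := 1) ((measurable_patchWeight t c).comp measurable_snd).aestronglyMeasurable
      (Eventually.of_forall fun p => by
        rw [Real.norm_eq_abs, abs_of_nonneg (patchWeight_nonneg t c _)]
        exact patchWeight_le_one hc _)
  set g : NormalChart Ω → ℝ → ℝ × Vec (m + 1) → ℝ := fun c s =>
    boundaryIntegrand Ω Q (fun t x => v (t, x)) (fun t x => w (t, x)) (fun t x => bw c (t, x)) s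
    with hg
  have hg0 : ∀ c s p, p ∉ (univ ×ˢ c.patch : Set (ℝ × Vec (m + 1))) → g c s p = 0 := by
    intro c s p hp
    have h1 : bw c (p.1, p.2) = 0 := by
      simp only [hbw]
      rw [patchWeight_of_notMem fun h => hp ⟨mem_univ _, h⟩, zero_mul]
    simp only [hg, boundaryIntegrand, h1, mul_zero]
  have hgi : ∀ c ∈ t, ∀ᶠ s in essZero, Integrable (g c s) (lateralMeasure T Ω) := by
    intro c hc
    refine eventually_essZero_of_forall c.r_pos fun s hs => ?_
    refine (integrableOn_iff_integrable_of_support_subset fun p hp => ?_).1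
      (c.integrableOn_patch_boundaryIntegrand hQ hv hw (hbwm c) hvA hwB (hbwi c hc).integrableOn hs)
    by_contra hpc
    exact hp (hg0 c s p hpc)
  have hglim : ∀ c ∈ t, EssLimNonneg fun s => ∫ p, g c s p ∂(lateralMeasure T Ω) := by
    intro c hc
    refine (c.essLimNonneg_patch hΩ hΩb hf hF hu hHQ hv hw hvu hwu hvA hwB (hbwm c)
      (hbwi c hc).integrableOn (hbw0 c)).congr (Eventually.of_forall fun s => ?_)
    exact setIntegral_eq_integral_of_forall_compl_eq_zero fun p hp => hg0 c s p hp
  have hgi' : ∀ᶠ s in essZero, ∀ c ∈ t, Integrable (g c s) (lateralMeasure T Ω) :=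
    (Filter.eventually_all_finset t).2 hgi
  have huv : ∀ᶠ s in essZero, ∀ c ∈ t,
      ∀ᵐ p ∂((lateralMeasure T Ω).restrict (univ ×ˢ c.patch)),
      u p.1 (p.2 - s • exteriorNormal Ω p.2) = v (p.1, p.2 - s • exteriorNormal Ω p.2) :=
    (Filter.eventually_all_finset t).2 fun c _ => c.ae_ae_patch_eq hvu
  have hsum : ∀ᶠ s in essZero,
      boundaryIntegrand Ω Q u u_b β s =ᵐ[lateralMeasure T Ω] fun p => ∑ c ∈ t, g c s p := by
    filter_upwards [huv] with s hs
    have hs' : ∀ᵐ p ∂(lateralMeasure T Ω), ∀ c ∈ t, p ∈ univ ×ˢ c.patch →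
        u p.1 (p.2 - s • exteriorNormal Ω p.2) = v (p.1, p.2 - s • exteriorNormal Ω p.2) :=
      (Filter.eventually_all_finset t).2 fun c hc => (ae_restrict_iff'
        (MeasurableSet.univ.prod c.measurableSet_patch)).1 (hs c hc)
    filter_upwards [hs', hwu, hbβ, ae_lateralMeasure T Ω] with p hp hpw hpb hpΩ
    obtain ⟨c, hc, hpc⟩ := mem_iUnion₂.1 (hcov hpΩ.2)
    have hc' : c ∈ t := hc
    simp only [hg, boundaryIntegrand, hbw]
    rw [hp c hc' ⟨mem_univ _, hpc⟩, hpw, hpb, ← Finset.mul_sum, ← Finset.sum_mul,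
      sum_patchWeight hc' hpc, one_mul]
  constructor
  · filter_upwards [hsum, hgi'] with s hs hi
    exact (integrable_finsetSum t hi).congr hs.symm
  · refine (EssLimNonneg.sum t hglim).congr ?_
    filter_upwards [hsum, hgi'] with s hs hi
    rw [integral_congr_ae hs, integral_finsetSum t hi]

end Cover

end BalanceLaw

theorem mainTheorem5 (N : ℕ) (hN : 1 ≤ N) (Ω : Set (BalanceLaw.Vec N)) (hΩ_open : IsOpen Ω)
    (hΩ_bdd : Bornology.IsBounded Ω) (hΩ_smooth : BalanceLaw.HasSmoothBoundary Ω)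
    (T : ℝ) (hT : 0 < T)
    (f : ℝ → BalanceLaw.Vec N → ℝ → BalanceLaw.Vec N) (hf : BalanceLaw.IsC2 T Ω f)
    (F : ℝ → BalanceLaw.Vec N → ℝ → ℝ) (hF : BalanceLaw.IsC2 T Ω F)
    (u₀ : BalanceLaw.Vec N → ℝ) (hu₀ : MemLp u₀ ⊤ (volume.restrict Ω))
    (u_b : ℝ → BalanceLaw.Vec N → ℝ)
    (hu_b : MemLp (fun p : ℝ × BalanceLaw.Vec N => u_b p.1 p.2) ⊤
      (BalanceLaw.lateralMeasure T Ω))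
    (u : ℝ → BalanceLaw.Vec N → ℝ) (hu : BalanceLaw.IsRESolution T Ω f F u₀ u_b u)
    (H : ℝ → ℝ → ℝ) (Q : ℝ → BalanceLaw.Vec N → ℝ → ℝ → BalanceLaw.Vec N)
    (hHQ : BalanceLaw.IsBoundaryEntropyPair T Ω f H Q)
    (β : ℝ → BalanceLaw.Vec N → ℝ)
    (hβ : Integrable (fun p : ℝ × BalanceLaw.Vec N => β p.1 p.2)
      (BalanceLaw.lateralMeasure T Ω))
    (hβ_nonneg : ∀ᵐ p ∂(BalanceLaw.lateralMeasure T Ω), 0 ≤ β p.1 p.2) :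
    (∃ ρ₀ > 0, ∀ᵐ ρ : ℝ, ρ ∈ Ioo 0 ρ₀ →
      Integrable (BalanceLaw.boundaryIntegrand Ω Q u u_b β ρ)
        (BalanceLaw.lateralMeasure T Ω)) ∧
    ∃ l : ℝ, 0 ≤ l ∧
      BalanceLaw.HasEssLimZero
        (fun ρ => ∫ p, BalanceLaw.boundaryIntegrand Ω Q u u_b β ρ p
          ∂(BalanceLaw.lateralMeasure T Ω)) l := by
  obtain ⟨m, rfl⟩ : ∃ m, N = m + 1 := ⟨N - 1, by omega⟩
  obtain ⟨h1, l, hl, h2⟩ := BalanceLaw.boundary_trace hΩ_open hΩ_bdd hΩ_smooth hf hF hu_b hu hHQ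
    hβ hβ_nonneg
  exact ⟨BalanceLaw.eventually_essZero_iff.1 h1, l, hl, BalanceLaw.hasEssLimZero_of_tendsto h2⟩
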